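/- Let $\mathbb K$ be a commutative ring; modules, $\otimes$, Hopf algebras are over $\mathbb K$ and ungraded, and $\Delta,\varepsilon,s$ denote comultiplication, counit, antipode (Sweedler notation $\Delta(x)=x'\otimes x''=x^{(1)}\otimes x^{(2)}$, and similarly for iterated comultiplications). **Data on $A$.** Let $A$ be a cocommutative Hopf algebra. A *Fox pairing* in $A$ is a bilinear map $\rho:A\times A\to A$ with $\rho(x,yz)=\rho(x,y)z+\varepsilon(y)\rho(x,z)$ and $\rho(xy,z)=\rho(x,z)\varepsilon(y)+x\rho(y,z)$. Its transpose is $\overline\rho(x,y)=s^{-1}\rho(s(y),s(x))$, and $\rho$ is *antisymmetric* if $\overline\rho=-\rho$. Let $\digamma:A^{\otimes 3}\to A^{\otimes 3}$ be the linear map $$\digamma(x,y,z)=y's(\rho(x'',y'')')x'\otimes z's\big(\rho(\rho(x'',y'')''',z'')'\big)\rho(x'',y'')''\otimes\rho(\rho(x'',y'')''',z'')'',$$ let $P(x_1\otimes x_2\otimes x_3)=x_3\otimes x_1\otimes x_2$, and let $T_\rho=\sum_{i=0}^{2}P^i\circ\digamma\circ P^{-i}$. The pairing $\rho$ is *quasi-Poisson*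 if it is an antisymmetric Fox pairing and for all $x,y,z\in A$ $$T_\rho(x,y,z)=1\otimes y\otimes xz+yx\otimes1\otimes z+x\otimes zy\otimes1+y\otimes z\otimes x-1\otimes zy\otimes x-y\otimes1\otimes xz-yx\otimes z\otimes1-x\otimes y\otimes z .$$ **Data on $B$.** Let $B$ be a commutative Hopf algebra, $I=\ker\varepsilon$, $p:B\to I/I^2$, $p(b)=b-\varepsilon(b)1 \bmod I^2$, and let $\mathfrak g$ be the module of linear maps $\mu:B\to\mathbb K$ with $\mu(bc)=\varepsilon(b)\mu(c)+\varepsilon(c)\mu(b)$. An element $t\in B$ is *trace-like* if $t'\otimes t''=t''\otimes t'$ and the map $\mathfrak g\to I/I^2$, $\mu\mapsto\mu(t')\,p(t'')$, is bijective. For such $t$ put $b\bullet_t c=\overline b(c)$, where $\overline b\in\mathfrak g$ is the preimage of $p(b)$. **The representation algebra.** $A_B$ is the commutative algebra generated by symbols $x_b$ ($x\in A$, $b\in B$), bilinear in $(x,b)$, with relations $(xy)_b=x_{b'}y_{b''}$, $1_b=\varepsilon(b)1$, $x_{bc}=x'_b\,x''_c$, $x_{1}=\varepsilon(x)1$. It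 carries the $B$-coaction (algebra homomorphism and right comodule structure) $\Delta:A_B\to A_B\otimes B$ with $\Delta(x_b)=x_{b''}\otimes s(b')b'''$; write $\Delta(m)=m^\ell\otimes m^r$. Let $A_B^{\rm inv}=\{m\in A_B:\Delta(m)=m\otimes1\}$. **Theorem.** Let $\rho$ be a quasi-Poisson Fox pairing in a cocommutative Hopf algebra $A$, let $B$ be a commutative Hopf algebra with a trace-like element $t$, and let $\bullet=\bullet_t$. Then there is a unique bilinear map $\{-,-\}:A_B\times A_B\to A_B$ satisfying the Leibniz rules $\{u,vw\}=\{u,v\}w+v\{u,w\}$, $\{uv,w\}=u\{v,w\}+\{u,w\}v$ and $$\{x_b,y_c\}=(c''\bullet b^{(2)})\,\rho(x',y')_{s(b^{(3)})b^{(1)}}\,x''_{b^{(4)}}\,y''_{c'}\qquad(x,y\in A,\ b,c\in B).$$ This bracket is quasi-Poisson with respect to $t$; that is, besides the Leibniz rules, it is - $B$-equivariant: $\{m_1,m_2^\ell\}\otimes m_2^r=\{m_1^\ell,m_2\}^\ell\otimes\{m_1^\ell,m_2\}^r\,s(m_1^r)$ for all $m_1,m_2\in A_B$; - antisymmetric: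 $\{u,v\}=-\{v,u\}$ for all $u,v\in A_B$; - subject to the quasi-Jacobi identity: for all $u,v,w\in A_B$, $$\{u,\{v,w\}\}+\{w,\{u,v\}\}+\{v,\{w,u\}\}=(u^r\bullet t')(v^r\bullet t'')(w^r\bullet t''')\,u^\ell v^\ell w^\ell-(u^r\bullet t')(v^r\bullet t''')(w^r\bullet t'')\,u^\ell v^\ell w^\ell .$$ Consequently it restricts to a Poisson bracket on the subalgebra $A_B^{\rm inv}$, i.e. $\{A_B^{\rm inv},A_B^{\rm inv}\}\subset A_B^{\rm inv}$ and the restriction is antisymmetric and satisfies the Leibniz rules and the Jacobi identity $\{u,\{v,w\}\}+\{v,\{w,u\}\}+\{w,\{u,v\}\}=0$. -/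

import Mathlib

open TensorProduct Coalgebra HopfAlgebra WithConv

namespace RepAlg

/-! ### Sweedler notation -/

/-- Sweedler sum attached to a tensor `z = ∑ mᵢ ⊗ nᵢ`: the value `∑ f mᵢ nᵢ`, computed with a chosen
finite expansion of `z`.  It is only used with `f` bilinear, and then it does not depend on the
expansion (`sweedler_eq_lift`). -/
noncomputable def sweedler {K M N P : Type*} [CommRing K] [AddCommGroup M] [Module K M]
    [AddCommGroup N] [Module K N] [AddCommMonoid P] (z : M ⊗[K] N) (f : M → N → P) : P :=
  ∑ i ∈ (TensorProduct.exists_finset (R := K) z).choose, f i.1 i.2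

theorem sweedler_eq_lift {K M N P : Type*} [CommRing K] [AddCommGroup M] [Module K M]
    [AddCommGroup N] [Module K N] [AddCommGroup P] [Module K P]
    (z : M ⊗[K] N) (f : M →ₗ[K] N →ₗ[K] P) :
    sweedler z (fun m n => f m n) = TensorProduct.lift f z := by
  conv_rhs => rw [(TensorProduct.exists_finset (R := K) z).choose_spec]
  simp [sweedler]

/-- `sw K c f = f(c', c'')` in Sweedler notation `Δ(c) = c' ⊗ c''`. -/
noncomputable def sw (K : Type*) {C P : Type*} [CommRing K] [AddCommGroup C] [Module K C]
    [Coalgebra K C] [AddCommMonoid P] (c : C) (f : C → C → P) : P :=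
  sweedler (comul (R := K) c) f

/-- `sw3 K c f = f(c⁽¹⁾, c⁽²⁾, c⁽³⁾)`. -/
noncomputable def sw3 (K : Type*) {C P : Type*} [CommRing K] [AddCommGroup C] [Module K C]
    [Coalgebra K C] [AddCommMonoid P] (c : C) (f : C → C → C → P) : P :=
  sw K c fun c₁ d => sw K d fun c₂ c₃ => f c₁ c₂ c₃

/-- `sw4 K c f = f(c⁽¹⁾, c⁽²⁾, c⁽³⁾, c⁽⁴⁾)`. -/
noncomputable def sw4 (K : Type*) {C P : Type*} [CommRing K] [AddCommGroup C] [Module K C]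
    [Coalgebra K C] [AddCommMonoid P] (c : C) (f : C → C → C → C → P) : P :=
  sw K c fun c₁ d => sw3 K d fun c₂ c₃ c₄ => f c₁ c₂ c₃ c₄

/-! ### The representation algebra `A_B` -/

section RepAlgebra

variable (K A B : Type*) [CommRing K] [Ring A] [HopfAlgebra K A] [CommRing B] [HopfAlgebra K B]

/-- The relators of `A_B`, in the polynomial algebra on the symbols `x_b = X (x, b)`. -/
inductive Relator : MvPolynomial (A × B) K → Prop
  | add_left (x y : A) (b : B) : Relator (.X (x + y, b) - (.X (x, b) + .X (y, b)))
  | add_right (x : A) (b c : B) : Relator (.X (x, b + c) - (.X (x, b) + .X (x, c)))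
  | smul_left (k : K) (x : A) (b : B) : Relator (.X (k • x, b) - k • .X (x, b))
  | smul_right (k : K) (x : A) (b : B) : Relator (.X (x, k • b) - k • .X (x, b))
  | mul_left (x y : A) (b : B) :
      Relator (.X (x * y, b) - sw K b fun b' b'' => .X (x, b') * .X (y, b''))
  | one_left (b : B) : Relator (.X (1, b) - .C (counit (R := K) b))
  | mul_right (x : A) (b c : B) :
      Relator (.X (x, b * c) - sw K x fun x' x'' => .X (x', b) * .X (x'', c))
  | one_right (x : A) : Relator (.X (x, 1) - .C (counit (R := K) x))

/-- The `B`-representation algebra `A_B` of `A` : the commutative algebra generated by the symbols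
`x_b` subject to bilinearity, the two multiplicativity and the two unitality relations. -/
def RepAlgebra : Type _ :=
  MvPolynomial (A × B) K ⧸ Ideal.span {r | Relator K A B r}

noncomputable instance : CommRing (RepAlgebra K A B) :=
  inferInstanceAs (CommRing (MvPolynomial (A × B) K ⧸ Ideal.span {r | Relator K A B r}))

noncomputable instance : Algebra K (RepAlgebra K A B) :=
  inferInstanceAs (Algebra K (MvPolynomial (A × B) K ⧸ Ideal.span {r | Relator K A B r}))

/-- The projection of the polynomial algebra onto `A_B`. -/
noncomputable def proj : MvPolynomial (A × B) K →ₐ[K] RepAlgebra K A B :=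
  Ideal.Quotient.mkₐ K (Ideal.span {r | Relator K A B r})

theorem proj_eq {p q : MvPolynomial (A × B) K} (h : Relator K A B (p - q)) :
    proj K A B p = proj K A B q :=
  (Ideal.Quotient.eq).2 (Ideal.subset_span h)

/-- The generators `x_b` of `A_B`, as a bilinear map of `(x, b)`. -/
noncomputable def gen : A →ₗ[K] B →ₗ[K] RepAlgebra K A B :=
  LinearMap.mk₂ K (fun x b => proj K A B (.X (x, b)))
    (fun x y b => by rw [proj_eq K A B (.add_left x y b), map_add])
    (fun k x b => by rw [proj_eq K A B (.smul_left k x b), map_smul])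
    (fun x b c => by rw [proj_eq K A B (.add_right x b c), map_add])
    (fun k x b => by rw [proj_eq K A B (.smul_right k x b), map_smul])

variable {K A B}

theorem gen_mul_left (x y : A) (b : B) :
    gen K A B (x * y) b = sw K b fun b' b'' => gen K A B x b' * gen K A B y b'' := by
  change proj K A B _ = _
  rw [proj_eq K A B (.mul_left x y b)]
  simp [sw, sweedler, gen]

theorem gen_one_left (b : B) :
    gen K A B 1 b = algebraMap K _ (counit (R := K) b) := by
  change proj K A B _ = _
  rw [proj_eq K A B (.one_left b)]
  exact AlgHom.commutes (proj K A B) _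

theorem gen_mul_right (x : A) (b c : B) :
    gen K A B x (b * c) = sw K x fun x' x'' => gen K A B x' b * gen K A B x'' c := by
  change proj K A B _ = _
  rw [proj_eq K A B (.mul_right x b c)]
  simp [sw, sweedler, gen]

theorem gen_one_right (x : A) :
    gen K A B x 1 = algebraMap K _ (counit (R := K) x) := by
  change proj K A B _ = _
  rw [proj_eq K A B (.one_right x)]
  exact AlgHom.commutes (proj K A B) _

/-- Universal property of `A_B`. -/
noncomputable def liftRep {C : Type*} [CommRing C] [Algebra K C] (u : A →ₗ[K] B →ₗ[K] C)
    (hmul : ∀ x y b, u (x * y) b = sw K b fun b' b'' => u x b' * u y b'')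
    (hone : ∀ b, u 1 b = algebraMap K C (counit (R := K) b))
    (hmul' : ∀ x b c, u x (b * c) = sw K x fun x' x'' => u x' b * u x'' c)
    (hone' : ∀ x, u x 1 = algebraMap K C (counit (R := K) x)) :
    RepAlgebra K A B →ₐ[K] C :=
  Ideal.Quotient.liftₐ _ (MvPolynomial.aeval fun p : A × B => u p.1 p.2) (by
    intro a ha
    induction ha using Submodule.span_induction with
    | mem r hr =>
      cases hr with
      | add_left x y b => simp
      | add_right x b c => simp
      | smul_left k x b => simp
      | smul_right k x b => simp
      | mul_left x y b => simp [hmul, sw, sweedler]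
      | one_left b => simp [hone]
      | mul_right x b c => simp [hmul', sw, sweedler]
      | one_right x => simp [hone']
    | zero => simp
    | add p q _ _ hp hq => rw [map_add, hp, hq, add_zero]
    | smul a p _ hp => rw [smul_eq_mul, map_mul, hp, mul_zero])

@[simp] theorem liftRep_gen {C : Type*} [CommRing C] [Algebra K C] (u : A →ₗ[K] B →ₗ[K] C)
    (hmul) (hone) (hmul') (hone') (x : A) (b : B) :
    liftRep u hmul hone hmul' hone' (gen K A B x b) = u x b := by
  change MvPolynomial.aeval (fun p : A × B => u p.1 p.2) (MvPolynomial.X (x, b)) = _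
  simp

theorem repAlgebra_hom_ext {C : Type*} [CommRing C] [Algebra K C]
    {f g : RepAlgebra K A B →ₐ[K] C} (h : ∀ x b, f (gen K A B x b) = g (gen K A B x b)) :
    f = g := by
  have : f.comp (proj K A B) = g.comp (proj K A B) :=
    MvPolynomial.algHom_ext fun p => h p.1 p.2
  ext m
  obtain ⟨p, rfl⟩ : ∃ p, proj K A B p = m := Ideal.Quotient.mk_surjective m
  exact congr($this p)

end RepAlgebra


/-! ### Coactions -/

/-- A (right) coaction of `B` on the algebra `M`: an algebra homomorphism `Δ : M → M ⊗ B` turning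
`M` into a right `B`-comodule. -/
structure Coaction (K B M : Type*) [CommRing K] [CommRing B] [HopfAlgebra K B] [Ring M]
    [Algebra K M] where
  toAlgHom : M →ₐ[K] M ⊗[K] B
  coassoc : ∀ m, TensorProduct.assoc K M B B
      (LinearMap.rTensor B toAlgHom.toLinearMap (toAlgHom m)) =
    LinearMap.lTensor M (comul (R := K) (A := B)) (toAlgHom m)
  counit : ∀ m, TensorProduct.rid K M
    (LinearMap.lTensor M (counit (R := K) (A := B)) (toAlgHom m)) = m

/-- The subalgebra of `B`-invariant elements `m`, i.e. those with `Δ(m) = m ⊗ 1`. -/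
def Coaction.invariants {K B M : Type*} [CommRing K] [CommRing B] [HopfAlgebra K B] [Ring M]
    [Algebra K M] (δ : Coaction K B M) : Subalgebra K M :=
  AlgHom.equalizer δ.toAlgHom Algebra.TensorProduct.includeLeft

section RepCoaction

variable {K A B : Type*} [CommRing K] [Ring A] [HopfAlgebra K A] [CommRing B] [HopfAlgebra K B]

theorem sw_eq_convMul {C R : Type*} [AddCommGroup C] [Module K C] [Coalgebra K C] [Ring R]
    [Algebra K R] (f g : WithConv (C →ₗ[K] R)) (c : C) :
    sw K c (fun c' c'' => f c' * g c'') = (f * g) c := by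
  rw [LinearMap.convMul_apply]
  refine (sweedler_eq_lift (comul c)
    ((LinearMap.mul K R).compl₁₂ f.ofConv g.ofConv)).trans ?_
  generalize comul (R := K) c = z
  induction z with
  | zero => simp
  | tmul a b => simp
  | add p q hp hq => simp only [map_add, hp, hq]

/-- Postcomposition with an algebra homomorphism, on convolution algebras. -/
def post {C R S : Type*} [AddCommGroup C] [Module K C] [Ring R] [Algebra K R] [Ring S]
    [Algebra K S] (h : R →ₐ[K] S) (f : WithConv (C →ₗ[K] R)) : WithConv (C →ₗ[K] S) :=
  toConv (h.toLinearMap ∘ₗ f.ofConv)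

theorem post_mul {C R S : Type*} [AddCommGroup C] [Module K C] [Coalgebra K C] [Ring R]
    [Algebra K R] [Ring S] [Algebra K S] (h : R →ₐ[K] S) (f g : WithConv (C →ₗ[K] R)) :
    post h (f * g) = post h f * post h g := by
  simp only [post, LinearMap.algHom_comp_convMul_distrib]

theorem post_one {C R S : Type*} [AddCommGroup C] [Module K C] [Coalgebra K C] [Ring R]
    [Algebra K R] [Ring S] [Algebra K S] (h : R →ₐ[K] S) :
    post h (1 : WithConv (C →ₗ[K] R)) = 1 := by
  ext c
  exact h.commutes _

/-- An algebra homomorphism `B → R`, as an element of the convolution algebra. -/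
def cv {R : Type*} [Ring R] [Algebra K R] (f : B →ₐ[K] R) : WithConv (B →ₗ[K] R) :=
  toConv f.toLinearMap

/-- The convolution inverse of an algebra homomorphism `B → R`. -/
noncomputable def cvInv {R : Type*} [Ring R] [Algebra K R] (f : B →ₐ[K] R) :
    WithConv (B →ₗ[K] R) :=
  toConv (f.toLinearMap ∘ₗ antipode K)

theorem cv_mul_cvInv {R : Type*} [Ring R] [Algebra K R] (f : B →ₐ[K] R) :
    cv f * cvInv f = 1 := by
  have h := congrArg (post f) (LinearMap.id_mul_antipode (R := K) (C := B))
  rw [post_mul, post_one] at h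
  exact h

theorem cvInv_mul_cv {R : Type*} [Ring R] [Algebra K R] (f : B →ₐ[K] R) :
    cvInv f * cv f = 1 := by
  have h := congrArg (post f) (LinearMap.antipode_mul_id (R := K) (C := B))
  rw [post_mul, post_one] at h
  exact h

/-- The map `b ↦ j (x_b)` in the convolution algebra. -/
noncomputable def genConv {R : Type*} [Ring R] [Algebra K R] (j : RepAlgebra K A B →ₐ[K] R)
    (x : A) : WithConv (B →ₗ[K] R) :=
  toConv (j.toLinearMap ∘ₗ gen K A B x)

theorem genConv_mul {R : Type*} [Ring R] [Algebra K R] (j : RepAlgebra K A B →ₐ[K] R) (x y : A) :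
    genConv j (x * y) = genConv j x * genConv j y := by
  have h : toConv (gen K A B (x * y)) = toConv (gen K A B x) * toConv (gen K A B y) := by
    ext b
    exact (gen_mul_left x y b).trans
      (sw_eq_convMul (toConv (gen K A B x)) (toConv (gen K A B y)) b)
  have h' := congrArg (post j) h
  rw [post_mul] at h'
  exact h'

theorem genConv_one {R : Type*} [Ring R] [Algebra K R] (j : RepAlgebra K A B →ₐ[K] R) :
    genConv j 1 = 1 := by
  have h : toConv (gen K A B 1) = 1 := by
    ext b
    exact gen_one_left b
  have h' := congrArg (post j) h
  rw [post_one] at h'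
  exact h'

/-- The map `b ↦ x_{b⁽²⁾} ⊗ s(b⁽¹⁾) b⁽³⁾`, as a convolution product. -/
noncomputable def coactConv (x : A) : WithConv (B →ₗ[K] RepAlgebra K A B ⊗[K] B) :=
  cvInv Algebra.TensorProduct.includeRight *
    (genConv Algebra.TensorProduct.includeLeft x * cv Algebra.TensorProduct.includeRight)

theorem coactConv_add (x y : A) :
    coactConv (K := K) (B := B) (x + y) = coactConv x + coactConv y := by
  have : genConv (B := B) (R := RepAlgebra K A B ⊗[K] B) Algebra.TensorProduct.includeLeft (x + y)
      = genConv Algebra.TensorProduct.includeLeft x +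
        genConv Algebra.TensorProduct.includeLeft y := by
    ext b; simp [genConv, TensorProduct.add_tmul]
  rw [coactConv, this, add_mul, mul_add]; rfl

theorem coactConv_smul (k : K) (x : A) :
    coactConv (K := K) (B := B) (k • x) = k • coactConv x := by
  have : genConv (B := B) (R := RepAlgebra K A B ⊗[K] B) Algebra.TensorProduct.includeLeft (k • x)
      = k • genConv Algebra.TensorProduct.includeLeft x := by
    ext b; simp [genConv, TensorProduct.smul_tmul']
  rw [coactConv, this, smul_mul_assoc, mul_smul_comm]; rfl

theorem coactConv_mul (x y : A) :
    coactConv (K := K) (B := B) (x * y) = coactConv x * coactConv y := by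
  simp only [coactConv, genConv_mul, mul_assoc]
  congr 2
  rw [← mul_assoc (cv _) (cvInv _), cv_mul_cvInv, one_mul]

theorem coactConv_one : coactConv (K := K) (A := A) (B := B) 1 = 1 := by
  rw [coactConv, genConv_one, one_mul, cvInv_mul_cv]

/-- The map `(x, b) ↦ x_{b⁽²⁾} ⊗ s(b⁽¹⁾) b⁽³⁾`. -/
noncomputable def coactPre : A →ₗ[K] B →ₗ[K] RepAlgebra K A B ⊗[K] B where
  toFun x := (coactConv x).ofConv
  map_add' x y := by rw [coactConv_add]; rfl
  map_smul' k x := by rw [coactConv_smul]; rfl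

theorem coactPre_apply (x : A) (b : B) :
    coactPre (K := K) x b = sw3 K b fun b₁ b₂ b₃ =>
      gen K A B x b₂ ⊗ₜ[K] (antipode K b₁ * b₃) := by
  change (coactConv x) b = _
  rw [coactConv, ← sw_eq_convMul, sw3]
  congr 1
  ext b₁ d
  rw [← sw_eq_convMul]
  simp only [sw, sweedler, Finset.mul_sum]
  refine Finset.sum_congr rfl fun i _ => ?_
  simp [cvInv, cv, genConv]

/-- `coactPre x b` as a linear function of the iterated comultiplication of `b`. -/
noncomputable def coactTri : A →ₗ[K] B ⊗[K] (B ⊗[K] B) →ₗ[K] RepAlgebra K A B ⊗[K] B where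
  toFun x := (TensorProduct.map (gen K A B x) (LinearMap.mul' K B)) ∘ₗ
    (TensorProduct.map LinearMap.id (LinearMap.rTensor B (antipode K))) ∘ₗ
    (TensorProduct.leftComm K B B B).toLinearMap
  map_add' x y := by
    ext
    simp [TensorProduct.add_tmul]
  map_smul' k x := by
    ext
    simp [TensorProduct.smul_tmul']

theorem coactTri_tmul (x : A) (b₁ b₂ b₃ : B) :
    coactTri (K := K) x (b₁ ⊗ₜ (b₂ ⊗ₜ b₃)) = gen K A B x b₂ ⊗ₜ[K] (antipode K b₁ * b₃) := by
  simp [coactTri]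

/-- The iterated comultiplication. -/
noncomputable def comul3 : B →ₐ[K] B ⊗[K] (B ⊗[K] B) :=
  (Algebra.TensorProduct.map (AlgHom.id K B) (Bialgebra.comulAlgHom K B)).comp
    (Bialgebra.comulAlgHom K B)

theorem coactPre_eq_coactTri (x : A) (b : B) :
    coactPre (K := K) x b = coactTri x (comul3 (K := K) b) := by
  have h (z : B ⊗[K] B) : sweedler z (fun b₁ d => sw K d fun b₂ b₃ =>
      gen K A B x b₂ ⊗ₜ[K] (antipode K b₁ * b₃)) =
      coactTri x (LinearMap.lTensor B (comul (R := K)) z) := by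
    conv_rhs => rw [(TensorProduct.exists_finset (R := K) z).choose_spec]
    simp only [sweedler, sw, map_sum, LinearMap.lTensor_tmul]
    refine Finset.sum_congr rfl fun i _ => ?_
    conv_rhs => rw [(TensorProduct.exists_finset (R := K) (comul (R := K) i.2)).choose_spec]
    simp [TensorProduct.tmul_sum, coactTri_tmul]
  rw [coactPre_apply]
  exact h (comul b)

theorem coactTri_mul (x : A) (p q : B ⊗[K] (B ⊗[K] B)) :
    coactTri x (p * q) = sw K x fun x' x'' => coactTri x' p * coactTri x'' q := by
  have tri {P : B ⊗[K] (B ⊗[K] B) → Prop} (h0 : P 0)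
      (ht : ∀ a b c : B, P (a ⊗ₜ (b ⊗ₜ c))) (ha : ∀ u v, P u → P v → P (u + v)) (z) : P z := by
    induction z with
    | zero => exact h0
    | tmul a w =>
      induction w with
      | zero => simpa using h0
      | tmul b c => exact ht a b c
      | add u v hu hv => rw [TensorProduct.tmul_add]; exact ha _ _ hu hv
    | add u v hu hv => exact ha _ _ hu hv
  induction p using tri with
  | h0 => simp [sw, sweedler]
  | ha u v hu hv => simp [add_mul, hu, hv, sw, sweedler, Finset.sum_add_distrib]
  | ht b₁ b₂ b₃ =>
    induction q using tri with
    | h0 => simp [sw, sweedler]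
    | ha u v hu hv => simp only [mul_add, map_add, hu, hv, sw, sweedler, Finset.sum_add_distrib]
    | ht c₁ c₂ c₃ =>
      rw [Algebra.TensorProduct.tmul_mul_tmul, Algebra.TensorProduct.tmul_mul_tmul, coactTri_tmul,
        gen_mul_right]
      simp only [sw, sweedler, coactTri_tmul, Algebra.TensorProduct.tmul_mul_tmul,
        TensorProduct.sum_tmul, HopfAlgebra.antipode_mul_distrib]
      refine Finset.sum_congr rfl fun i _ => ?_
      congr 1
      ring

/-- The algebra homomorphism `A_B → A_B ⊗ B`, `x_b ↦ x_{b⁽²⁾} ⊗ s(b⁽¹⁾) b⁽³⁾`. -/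
noncomputable def coactHom : RepAlgebra K A B →ₐ[K] RepAlgebra K A B ⊗[K] B :=
  liftRep coactPre
    (fun x y b => by
      change (coactConv (x * y)) b = _
      rw [coactConv_mul, ← sw_eq_convMul]; rfl)
    (fun b => by
      change (coactConv 1) b = _
      rw [coactConv_one]; rfl)
    (fun x b c => by
      simp only [coactPre_eq_coactTri, map_mul, coactTri_mul])
    (fun x => by
      rw [coactPre_eq_coactTri, map_one, Algebra.TensorProduct.one_def,
        Algebra.TensorProduct.one_def, coactTri_tmul, gen_one_right]
      simp [Algebra.TensorProduct.algebraMap_apply])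

theorem coactHom_gen (x : A) (b : B) :
    coactHom (gen K A B x b) = sw3 K b fun b₁ b₂ b₃ =>
      gen K A B x b₂ ⊗ₜ[K] (antipode K b₁ * b₃) := by
  rw [coactHom, liftRep_gen, coactPre_apply]

end RepCoaction

section RepCoaction2

variable {K A B : Type*} [CommRing K] [Ring A] [HopfAlgebra K A] [CommRing B] [HopfAlgebra K B]

theorem post_coactHom {R : Type*} [Ring R] [Algebra K R]
    (h : RepAlgebra K A B ⊗[K] B →ₐ[K] R) (x : A) :
    genConv (h.comp coactHom) x =
      cvInv (h.comp Algebra.TensorProduct.includeRight) *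
        (genConv (h.comp Algebra.TensorProduct.includeLeft) x *
          cv (h.comp Algebra.TensorProduct.includeRight)) := by
  have e : genConv (h.comp coactHom) x = post h (coactConv x) := by
    ext b
    change h (coactHom (gen K A B x b)) = h (coactPre x b)
    rw [coactHom, liftRep_gen]
  rw [e, coactConv, post_mul, post_mul]
  rfl

theorem cvInv_eq_of_mul {R : Type*} [Ring R] [Algebra K R] {f : B →ₐ[K] R}
    {g : WithConv (B →ₗ[K] R)} (h : cv f * g = 1) : cvInv f = g :=
  left_inv_eq_right_inv (cvInv_mul_cv f) h

variable (K A B) in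
/-- `m ⊗ b ↦ m ⊗ (b ⊗ 1)`. -/
noncomputable def incl12 : RepAlgebra K A B ⊗[K] B →ₐ[K] RepAlgebra K A B ⊗[K] (B ⊗[K] B) :=
  Algebra.TensorProduct.map (AlgHom.id K _) Algebra.TensorProduct.includeLeft

variable (K A B) in
/-- `b ↦ 1 ⊗ (1 ⊗ b)`. -/
noncomputable def incl3 : B →ₐ[K] RepAlgebra K A B ⊗[K] (B ⊗[K] B) :=
  Algebra.TensorProduct.includeRight.comp Algebra.TensorProduct.includeRight

/-- `(Δ_M ⊗ id)`, with values in `M ⊗ (B ⊗ B)`. -/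
noncomputable def coassL : RepAlgebra K A B ⊗[K] B →ₐ[K] RepAlgebra K A B ⊗[K] (B ⊗[K] B) :=
  (Algebra.TensorProduct.assoc K K K (RepAlgebra K A B) B B).toAlgHom.comp
    (Algebra.TensorProduct.map coactHom (AlgHom.id K B))

/-- `(id ⊗ Δ_B)`. -/
noncomputable def coassR : RepAlgebra K A B ⊗[K] B →ₐ[K] RepAlgebra K A B ⊗[K] (B ⊗[K] B) :=
  Algebra.TensorProduct.map (AlgHom.id K _) (Bialgebra.comulAlgHom K B)

theorem coassL_includeLeft : (coassL (K := K) (A := A) (B := B)).comp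
    Algebra.TensorProduct.includeLeft = (incl12 K A B).comp coactHom := by
  refine AlgHom.ext fun m => ?_
  change TensorProduct.assoc K _ B B (coactHom m ⊗ₜ[K] (1 : B)) = incl12 K A B (coactHom m)
  generalize coactHom m = z
  induction z with
  | zero => simp
  | tmul a b => simp [incl12]
  | add p q hp hq => rw [TensorProduct.add_tmul, map_add, map_add, hp, hq]

theorem coassL_includeRight : (coassL (K := K) (A := A) (B := B)).comp
    Algebra.TensorProduct.includeRight = incl3 K A B := by
  refine AlgHom.ext fun b => ?_
  simp [coassL, incl3, Algebra.TensorProduct.one_def]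

theorem coassR_includeLeft : (coassR (K := K) (A := A) (B := B)).comp
    Algebra.TensorProduct.includeLeft = (incl12 K A B).comp Algebra.TensorProduct.includeLeft := by
  refine AlgHom.ext fun m => ?_
  simp [coassR, incl12, Algebra.TensorProduct.one_def]

theorem cv_coassR_includeRight : cv ((coassR (K := K) (A := A) (B := B)).comp
    Algebra.TensorProduct.includeRight) =
    cv ((incl12 K A B).comp Algebra.TensorProduct.includeRight) * cv (incl3 K A B) := by
  ext b
  rw [← sw_eq_convMul]
  change coassR (1 ⊗ₜ[K] b) = _
  simp only [coassR, Algebra.TensorProduct.map_tmul, map_one, Bialgebra.comulAlgHom_apply]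
  conv_lhs => rw [(TensorProduct.exists_finset (R := K) (comul (R := K) b)).choose_spec]
  simp [sw, sweedler, cv, incl12, incl3, TensorProduct.tmul_sum]

theorem coassL_coactHom : (coassL (K := K) (A := A) (B := B)).comp coactHom =
    (coassR (K := K) (A := A) (B := B)).comp coactHom := by
  refine repAlgebra_hom_ext fun x b => ?_
  have hinv : cvInv ((coassR (K := K) (A := A) (B := B)).comp
      Algebra.TensorProduct.includeRight) =
      cvInv (incl3 K A B) * cvInv ((incl12 K A B).comp Algebra.TensorProduct.includeRight) := by
    apply cvInv_eq_of_mul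
    rw [cv_coassR_includeRight, mul_assoc, ← mul_assoc (cv (incl3 K A B)), cv_mul_cvInv, one_mul,
      cv_mul_cvInv]
  have h : genConv ((coassL (K := K) (A := A) (B := B)).comp coactHom) x =
      genConv ((coassR (K := K) (A := A) (B := B)).comp coactHom) x := by
    rw [post_coactHom, post_coactHom, coassL_includeLeft, coassL_includeRight, post_coactHom,
      coassR_includeLeft, cv_coassR_includeRight, hinv]
    simp only [mul_assoc]
  exact congr($h b)

/-- `id ⊗ ε`, with values in `M`. -/
noncomputable def counR : RepAlgebra K A B ⊗[K] B →ₐ[K] RepAlgebra K A B :=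
  (Algebra.TensorProduct.rid K K (RepAlgebra K A B)).toAlgHom.comp
    (Algebra.TensorProduct.map (AlgHom.id K _) (Bialgebra.counitAlgHom K B))

theorem counR_coactHom :
    (counR (K := K) (A := A) (B := B)).comp coactHom = AlgHom.id K _ := by
  refine repAlgebra_hom_ext fun x b => ?_
  have h1 : cv ((counR (K := K) (A := A) (B := B)).comp Algebra.TensorProduct.includeRight) = 1 := by
    ext b
    simp [cv, counR, Algebra.smul_def]
  have h2 : cvInv ((counR (K := K) (A := A) (B := B)).comp Algebra.TensorProduct.includeRight)
      = 1 := cvInv_eq_of_mul (by rw [h1, one_mul])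
  have h := post_coactHom (counR (K := K) (A := A) (B := B)) x
  rw [h1, h2, one_mul, mul_one] at h
  refine congr($h b).trans ?_
  simp [genConv, counR]

variable (K A B) in
/-- The coaction of `B` on `A_B`, characterised by `Δ(x_b) = x_{b⁽²⁾} ⊗ s(b⁽¹⁾) b⁽³⁾`
(`coactHom_gen`). -/
noncomputable def repCoaction : Coaction K B (RepAlgebra K A B) where
  toAlgHom := coactHom
  coassoc m := congr($(coassL_coactHom (K := K) (A := A) (B := B)) m)
  counit m := congr($(counR_coactHom (K := K) (A := A) (B := B)) m)

end RepCoaction2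

/-! ### Fox pairings -/

section Fox

variable {K A : Type*} [CommRing K] [Ring A] [HopfAlgebra K A]

theorem sw_flip [IsCocomm K A] {P : Type*} [AddCommGroup P] [Module K P]
    (f : A →ₗ[K] A →ₗ[K] P) (a : A) :
    sw K a (fun a' a'' => f a'' a') = sw K a (fun a' a'' => f a' a'') := by
  refine (sweedler_eq_lift (comul a) f.flip).trans
    (Eq.trans ?_ (sweedler_eq_lift (comul a) f).symm)
  conv_rhs => rw [← comm_comul K a]
  generalize comul (R := K) a = z
  induction z with
  | zero => simp
  | tmul a b => simp
  | add p q hp hq => simp only [map_add, hp, hq]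

/-- The antipode of a cocommutative Hopf algebra is an involution. -/
theorem antipode_involutive [IsCocomm K A] : Function.Involutive (antipode K (A := A)) := by
  have h : toConv (antipode K (A := A) ∘ₗ antipode K) * toConv (antipode K) = 1 := by
    ext a
    rw [← sw_eq_convMul]
    have c := sw_flip ((LinearMap.mul K A).compl₁₂ LinearMap.id (antipode K)) a
    have s := sw_eq_convMul (K := K) (toConv LinearMap.id) (toConv (antipode K)) a
    rw [LinearMap.id_mul_antipode] at s
    have e := congrArg (antipode K) (c.trans s)
    simp only [sw, sweedler, map_sum, LinearMap.compl₁₂_apply, LinearMap.id_apply,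
      LinearMap.mul_apply', HopfAlgebra.antipode_mul_antidistrib] at e
    refine e.trans ?_
    simp [Algebra.algebraMap_eq_smul_one]
  intro a
  have := left_inv_eq_right_inv h (LinearMap.antipode_mul_id (R := K) (C := A))
  exact congr($this a)

/-- A Fox pairing (of degree `0`) in the Hopf algebra `A`. -/
structure IsFoxPairing (ρ : A →ₗ[K] A →ₗ[K] A) : Prop where
  map_mul_right : ∀ x y z, ρ x (y * z) = ρ x y * z + counit (R := K) y • ρ x z
  map_mul_left : ∀ x y z, ρ (x * y) z = counit (R := K) y • ρ x z + x * ρ y z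

/-- The antipode of a cocommutative Hopf algebra as a linear isomorphism. -/
noncomputable def antipodeEquiv [IsCocomm K A] : A ≃ₗ[K] A :=
  LinearEquiv.ofInvolutive (antipode K) antipode_involutive

/-- The transpose `ρ̄(x, y) = s⁻¹(ρ(s(y), s(x)))` of a bilinear pairing `ρ` in `A`. -/
noncomputable def foxTranspose [IsCocomm K A] (ρ : A →ₗ[K] A →ₗ[K] A) : A →ₗ[K] A →ₗ[K] A :=
  (ρ.flip.compl₁₂ (antipode K (A := A)) (antipode K (A := A))).compr₂
    (antipodeEquiv (K := K) (A := A)).symm.toLinearMap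

theorem foxTranspose_apply [IsCocomm K A] (ρ : A →ₗ[K] A →ₗ[K] A) (x y : A) :
    foxTranspose ρ x y =
      (antipodeEquiv (K := K) (A := A)).symm (ρ (antipode K y) (antipode K x)) := rfl

/-- The permutation `x₁ ⊗ x₂ ⊗ x₃ ↦ x₃ ⊗ x₁ ⊗ x₂` of `A ⊗ A ⊗ A`. -/
noncomputable def perm312 : A ⊗[K] A ⊗[K] A →ₗ[K] A ⊗[K] A ⊗[K] A :=
  (TensorProduct.assoc K A A A).symm.toLinearMap ∘ₗ (TensorProduct.comm K (A ⊗[K] A) A).toLinearMap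

/-- The value at `x ⊗ y ⊗ z` of the map `ϝ : A ⊗ A ⊗ A → A ⊗ A ⊗ A` determined by `ρ`:
`y' s(ρ(x'', y'')') x' ⊗ z' s(ρ(ρ(x'', y'')''', z'')') ρ(x'', y'')'' ⊗ ρ(ρ(x'', y'')''', z'')''`. -/
noncomputable def digamma (ρ : A →ₗ[K] A →ₗ[K] A) (x y z : A) : A ⊗[K] A ⊗[K] A :=
  sw K x fun x' x'' => sw K y fun y' y'' => sw K z fun z' z'' =>
    sw3 K (ρ x'' y'') fun r₁ r₂ r₃ => sw K (ρ r₃ z'') fun q₁ q₂ =>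
      (y' * antipode K r₁ * x') ⊗ₜ[K] (z' * antipode K q₁ * r₂) ⊗ₜ[K] q₂

/-- The value at `x ⊗ y ⊗ z` of the tritensor map `∑_{i = 0, 1, 2} P₃₁₂ⁱ ∘ ϝ ∘ P₃₁₂⁻ⁱ` induced by
`ρ`; here `P₃₁₂⁻¹(x ⊗ y ⊗ z) = y ⊗ z ⊗ x`. -/
noncomputable def tritensor (ρ : A →ₗ[K] A →ₗ[K] A) (x y z : A) : A ⊗[K] A ⊗[K] A :=
  digamma ρ x y z + perm312 (digamma ρ y z x) + perm312 (perm312 (digamma ρ z x y))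

/-- A quasi-Poisson Fox pairing in a cocommutative Hopf algebra. -/
structure IsQuasiPoissonFox [IsCocomm K A] (ρ : A →ₗ[K] A →ₗ[K] A) : Prop
    extends IsFoxPairing ρ where
  antisymm : foxTranspose ρ = -ρ
  tritensor_eq : ∀ x y z, tritensor ρ x y z =
    1 ⊗ₜ y ⊗ₜ (x * z) + (y * x) ⊗ₜ 1 ⊗ₜ z + x ⊗ₜ (z * y) ⊗ₜ 1 + y ⊗ₜ z ⊗ₜ x
      - 1 ⊗ₜ (z * y) ⊗ₜ x - y ⊗ₜ 1 ⊗ₜ (x * z) - (y * x) ⊗ₜ z ⊗ₜ 1 - x ⊗ₜ y ⊗ₜ z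

end Fox

/-! ### Trace-like elements -/

section Trace

variable (K B : Type*) [CommRing K] [CommRing B] [HopfAlgebra K B]

/-- The module `𝔤` of derivations `μ : B → K`, `K` being a `B`-module through the counit. -/
def counitDer : Submodule K (B →ₗ[K] K) where
  carrier := {μ | ∀ b c, μ (b * c) = counit (R := K) b * μ c + counit (R := K) c * μ b}
  add_mem' {μ ν} hμ hν b c := by
    simp only [LinearMap.add_apply, hμ b c, hν b c]; ring
  zero_mem' b c := by simp
  smul_mem' k μ hμ b c := by
    simp only [LinearMap.smul_apply, hμ b c, smul_eq_mul]; ring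

/-- The augmentation ideal `I = Ker ε`. -/
noncomputable def augIdeal : Ideal B := RingHom.ker (Bialgebra.counitAlgHom K B)

variable {B}

/-- The projection `p : B → I/I²`, `p(b) = b - ε(b) 1 mod I²`. -/
noncomputable def augProj : B →ₗ[K] (augIdeal K B).Cotangent where
  toFun b := (augIdeal K B).toCotangent
    ⟨b - algebraMap K B (counit (R := K) b), by simp [augIdeal, RingHom.mem_ker]⟩
  map_add' b c := by
    rw [← map_add]; congr 1; ext; simp; ring
  map_smul' k b := by
    rw [← LinearMap.map_smul_of_tower]; congr 1; ext; simp [Algebra.smul_def]; ring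

/-- The linear map `𝔤 → I/I²`, `μ ↦ μ(t') p(t'')`. -/
noncomputable def infMap (t : B) : counitDer K B →ₗ[K] (augIdeal K B).Cotangent where
  toFun μ := sw K t fun t' t'' => μ.1 t' • augProj K t''
  map_add' μ ν := by simp [sw, sweedler, add_smul, Finset.sum_add_distrib]
  map_smul' k μ := by simp [sw, sweedler, mul_smul, Finset.smul_sum]

/-- `t` is trace-like: cosymmetric and infinitesimally-nonsingular. -/
structure IsTraceLike (t : B) : Prop where
  cosymmetric : TensorProduct.comm K B B (comul t) = comul t
  nonsingular : Function.Bijective (infMap K t)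

variable {K}

/-- The bilinear form `b •ₜ c = b̄(c)`, where `b̄ ∈ 𝔤` is the preimage of `p(b)` under
`μ ↦ μ(t') p(t'')`. -/
noncomputable def IsTraceLike.form {t : B} (ht : IsTraceLike K t) : B →ₗ[K] B →ₗ[K] K :=
  (counitDer K B).subtype ∘ₗ
    (LinearEquiv.ofBijective (infMap K t) ht.nonsingular).symm.toLinearMap ∘ₗ augProj K

end Trace

/-! ### Brackets -/

section Brackets

variable {K M : Type*} [CommRing K] [Ring M] [Algebra K M]

/-- A bracket in an (ungraded) algebra: a bilinear map satisfying the two Leibniz rules. -/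
structure IsBracket (br : M →ₗ[K] M →ₗ[K] M) : Prop where
  leibniz_right : ∀ x y z, br x (y * z) = br x y * z + y * br x z
  leibniz_left : ∀ x y z, br (x * y) z = x * br y z + br x z * y

/-- A Poisson bracket: an antisymmetric bracket satisfying the Jacobi identity. -/
structure IsPoissonBracket (br : M →ₗ[K] M →ₗ[K] M) : Prop extends IsBracket br where
  antisymm : ∀ x y, br x y = -br y x
  jacobi : ∀ x y z, br x (br y z) + br y (br z x) + br z (br x y) = 0

variable {B : Type*} [CommRing B] [HopfAlgebra K B]

/-- `B`-equivariance of a bilinear map `q : M × M → M`: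
`q(m₁, m₂ˡ) ⊗ m₂ʳ = q(m₁ˡ, m₂)ˡ ⊗ q(m₁ˡ, m₂)ʳ s(m₁ʳ)`. -/
def IsEquivariant (δ : Coaction K B M) (q : M →ₗ[K] M →ₗ[K] M) : Prop :=
  ∀ m₁ m₂ : M,
    sweedler (δ.toAlgHom m₂) (fun m₂l m₂r => q m₁ m₂l ⊗ₜ[K] m₂r) =
      sweedler (δ.toAlgHom m₁) fun m₁l m₁r =>
        sweedler (δ.toAlgHom (q m₁l m₂)) fun nl nr => nl ⊗ₜ[K] (nr * antipode K m₁r)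

/-- A quasi-Poisson bracket with respect to the trace-like element `t`. -/
structure IsQuasiPoissonBracket (δ : Coaction K B M) {t : B} (ht : IsTraceLike K t)
    (br : M →ₗ[K] M →ₗ[K] M) : Prop extends IsBracket br where
  equivariant : IsEquivariant δ br
  antisymm : ∀ x y, br x y = -br y x
  quasi_jacobi : ∀ u v w, br u (br v w) + br w (br u v) + br v (br w u) =
    (sweedler (δ.toAlgHom u) fun ul ur => sweedler (δ.toAlgHom v) fun vl vr =>
      sweedler (δ.toAlgHom w) fun wl wr => sw3 K t fun t₁ t₂ t₃ =>
        (ht.form ur t₁ * ht.form vr t₂ * ht.form wr t₃) • (ul * vl * wl)) -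
    (sweedler (δ.toAlgHom u) fun ul ur => sweedler (δ.toAlgHom v) fun vl vr =>
      sweedler (δ.toAlgHom w) fun wl wr => sw3 K t fun t₁ t₂ t₃ =>
        (ht.form ur t₁ * ht.form vr t₃ * ht.form wr t₂) • (ul * vl * wl))

end Brackets

/-- The bracket in `A_B` built from a pairing `ρ` in `A` and a bilinear form `•` in `B`: `br` is a
bracket and
`{x_b, y_c} = (c'' • b⁽²⁾) ρ(x', y')_{s(b⁽³⁾) b⁽¹⁾} x''_{b⁽⁴⁾} y''_{c'}`. -/
structure IsInducedBracket {K A B : Type*} [CommRing K] [Ring A] [HopfAlgebra K A] [CommRing B]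
    [HopfAlgebra K B] (ρ : A →ₗ[K] A →ₗ[K] A) (form : B →ₗ[K] B →ₗ[K] K)
    (br : RepAlgebra K A B →ₗ[K] RepAlgebra K A B →ₗ[K] RepAlgebra K A B) : Prop
    extends IsBracket br where
  apply_gen : ∀ x y b c, br (gen K A B x b) (gen K A B y c) =
    sw K x fun x' x'' => sw K y fun y' y'' => sw4 K b fun b₁ b₂ b₃ b₄ => sw K c fun c' c'' =>
      form c'' b₂ • (gen K A B (ρ x' y') (antipode K b₃ * b₁) * gen K A B x'' b₄ *
        gen K A B y'' c')

end RepAlg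

/-! The argument takes place in the convolution algebra E of linear maps B ⊗ B ⊗ B → A_B (`Slot`).
The relation (xy)_b = x_{b'} y_{b''} says that x ↦ (b ↦ x_b) is an algebra homomorphism, so each of
the three variables gives a homomorphism X₁, X₂, X₃ : A → E, and these three commute with one
another. The form • placed on two of the variables gives scalar-valued elements Ω₁₂, Ω₂₃, Ω₃₁. With
Ad_X(a)(e) = X(a') e X(s(a'')) and κ(x, y) = -ρ(x, s(y)), the bracket of generators becomes {X₁(x),
X₂(y)} = Ad_{X₁}(κ(x', y'))(Ω₁₂) X₁(x'') X₂(y'') (`brak`; `brak_eq` and `genBracket_formula` recover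
the formula of the theorem).

Four facts about • are used: it is a derivation along the counit in each variable; it is symmetric;
it is invariant (`form_invariant`), so that Ω₁₂ commutes with X₁(a') X₂(a'') and conjugation of Ω₁₂
in one slot can be traded for antipodal conjugation in the other (`ad_eq_ad_antipode`); and the
commutators [Ω₁₂, Ω₂₃], [Ω₂₃, Ω₃₁], [Ω₃₁, Ω₁₂] equal one element φ (`commutator_form_rotate`). The
last three come from the reproducing formula μ(b) = (b • t') μ(t'') for derivations μ along the
counit (`eq_sw_form`), together with the cosymmetry of t.

Existence: the Fox rule of ρ becomes the Leibniz rule for products in A, the derivation property of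
• gives compatibility with products in B, and antisymmetry carries both to the first argument
(`exists_bracket`). Uniqueness holds because the x_b generate A_B. Equivariance: with scalars
extended to A_B ⊗ B, the coaction conjugates the generators by the inclusion of B, and this
conjugation in two slots fixes Ω₁₂ (`brak_conj`).

Quasi-Jacobi identity: after division by a generator, bracketing with X₁(x) is a derivation on
functions of the other two variables. Hence a double bracket of generators is an explicit sum `jac`
of products of two conjugated tensors, multiplied by generators (`deriv_bracket`). In the cyclic
sum, the terms with the same two tensors combine into commutators, which are values of Φ(a, b, c) =
Ad_{X₁}(a) Ad_{X₂}(b) Ad_{X₃}(c) φ (`cyc_eq`). The same values arise from T_ρ at s(x), s(y), s(z),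
once outer factors are cancelled and l₁ ⊗ l₂ ⊗ l₃ ↦ ε(l₂) Φ(1, l₁, s(l₃)) is applied (`foxCyc_add`).
The quasi-Poisson property thus replaces the cyclic sum by eight terms, and multiplied by generators
these are the expansion of -[X₁(x), [X₂(y), [X₃(z), φ]]] (`dress_commutator`). A commutator with a
generator turns the factor b • τ into (mʳ • τ) mˡ with m = x_b, which produces the trivector of t
(`iterComm_form_apply`).

Both sides of the identity are cyclically symmetric and are derivations in each argument, so
generators suffice (`jacobiator_eq_of_gen`). On invariants the derivations m ↦ (mʳ • τ) mˡ vanish,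
and the Jacobi identity remains. -/

namespace RepAlg

set_option linter.unusedSectionVars false

/-! ### Convolution algebras -/

section Convolution

variable {K C D S T P : Type*} [CommRing K] [AddCommGroup C] [Module K C] [Coalgebra K C]
  [AddCommGroup D] [Module K D] [Coalgebra K D] [Ring S] [Algebra K S] [Ring T] [Algebra K T]
  [AddCommGroup P] [Module K P]

theorem conv_apply (f g : WithConv (C →ₗ[K] S)) (c : C) :
    (f * g) c = sw K c fun c' c'' => f c' * g c'' :=
  (sw_eq_convMul f g c).symm

theorem sw_eq_lift (f : C →ₗ[K] C →ₗ[K] P) (c : C) :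
    sw K c (fun a b => f a b) = TensorProduct.lift f (comul c) :=
  sweedler_eq_lift _ _

theorem map_sw {F Q : Type*} [AddCommMonoid Q] [FunLike F P Q] [AddMonoidHomClass F P Q]
    (g : F) (c : C) (f : C → C → P) : g (sw K c f) = sw K c fun a b => g (f a b) :=
  map_sum g _ _

theorem sw_counit_smul (f : C →ₗ[K] P) (c : C) :
    sw K c (fun a b => counit (R := K) a • f b) = f c := by
  refine (sw_eq_lift ((LinearMap.lsmul K P).compl₁₂ counit f) c).trans ?_
  have := congrArg (TensorProduct.lift ((LinearMap.lsmul K P).compl₁₂ LinearMap.id f))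
    (rTensor_counit_comul (R := K) c)
  simp only [TensorProduct.lift.tmul, LinearMap.compl₁₂_apply, LinearMap.id_apply,
    LinearMap.lsmul_apply, one_smul] at this
  rw [← this]
  generalize comul (R := K) c = z
  induction z with
  | zero => simp
  | tmul a b => simp
  | add p q hp hq => simp only [map_add, hp, hq]

theorem sw_smul_counit (f : C →ₗ[K] P) (c : C) :
    sw K c (fun a b => counit (R := K) b • f a) = f c := by
  refine (sw_eq_lift ((LinearMap.lsmul K P).compl₁₂ counit f).flip c).trans ?_
  have := congrArg (TensorProduct.lift ((LinearMap.lsmul K P).compl₁₂ LinearMap.id f).flip)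
    (lTensor_counit_comul (R := K) c)
  simp only [TensorProduct.lift.tmul, LinearMap.flip_apply, LinearMap.compl₁₂_apply,
    LinearMap.id_apply, LinearMap.lsmul_apply, one_smul] at this
  rw [← this]
  generalize comul (R := K) c = z
  induction z with
  | zero => simp
  | tmul a b => simp
  | add p q hp hq => simp only [map_add, hp, hq]

/-- The constant `c ↦ ε(c) s` of a convolution algebra. -/
noncomputable def cst (s : S) : WithConv (C →ₗ[K] S) :=
  toConv ((LinearMap.toSpanSingleton K S s) ∘ₗ counit)

theorem cst_apply (s : S) (c : C) : (cst s : WithConv (C →ₗ[K] S)) c = counit (R := K) c • s := rfl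

theorem cst_mul_apply (s : S) (f : WithConv (C →ₗ[K] S)) (c : C) : (cst s * f : WithConv (C →ₗ[K] S)) c = s * f c := by
  rw [conv_apply]
  simp only [cst_apply, smul_mul_assoc]
  exact sw_counit_smul (LinearMap.mulLeft K s ∘ₗ f.ofConv) c

theorem mul_cst_apply (s : S) (f : WithConv (C →ₗ[K] S)) (c : C) : (f * cst s : WithConv (C →ₗ[K] S)) c = f c * s := by
  rw [conv_apply]
  simp only [cst_apply, mul_smul_comm]
  exact sw_smul_counit (LinearMap.mulRight K s ∘ₗ f.ofConv) c

theorem cst_mul (s t : S) : (cst (s * t) : WithConv (C →ₗ[K] S)) = cst s * cst t := by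
  ext c
  exact ((cst_mul_apply s (cst t) c).trans (by rw [cst_apply, cst_apply, mul_smul_comm])).symm

theorem commute_cst {s : S} {f : WithConv (C →ₗ[K] S)} (h : ∀ c, Commute s (f c)) :
    Commute (cst s : WithConv (C →ₗ[K] S)) f := by
  refine WithConv.ext (LinearMap.ext fun c => ?_)
  exact (cst_mul_apply s f c).trans ((h c).eq.trans (mul_cst_apply s f c).symm)

end Convolution

/-! ### Convolution over a cocommutative Hopf algebra -/

section Hopf

variable {K A S T P : Type*} [CommRing K] [Ring A] [HopfAlgebra K A] [Ring S] [Algebra K S]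
  [Ring T] [Algebra K T] [AddCommGroup P] [Module K P]

/-- An algebra homomorphism out of `A`, as an element of the convolution algebra. -/
def hv (f : A →ₐ[K] S) : WithConv (A →ₗ[K] S) :=
  toConv f.toLinearMap

/-- The convolution inverse of an algebra homomorphism. -/
noncomputable def hvInv (f : A →ₐ[K] S) : WithConv (A →ₗ[K] S) :=
  toConv (f.toLinearMap ∘ₗ antipode K)

theorem hv_apply (f : A →ₐ[K] S) (a : A) : hv f a = f a := rfl

theorem hv_mul_hvInv (f : A →ₐ[K] S) : hv f * hvInv f = 1 := by
  have h := congrArg (post f) (LinearMap.id_mul_antipode (R := K) (C := A))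
  rw [post_mul, post_one] at h
  exact h

theorem hvInv_mul_hv (f : A →ₐ[K] S) : hvInv f * hv f = 1 := by
  have h := congrArg (post f) (LinearMap.antipode_mul_id (R := K) (C := A))
  rw [post_mul, post_one] at h
  exact h

@[simp] theorem hv_mul_hvInv_assoc (f : A →ₐ[K] S) (g : WithConv (A →ₗ[K] S)) :
    hv f * (hvInv f * g) = g := by
  rw [← mul_assoc, hv_mul_hvInv, one_mul]

@[simp] theorem hvInv_mul_hv_assoc (f : A →ₐ[K] S) (g : WithConv (A →ₗ[K] S)) :
    hvInv f * (hv f * g) = g := by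
  rw [← mul_assoc, hvInv_mul_hv, one_mul]

theorem sw_mul (f : A →ₗ[K] A →ₗ[K] P) (a b : A) :
    sw K (a * b) (fun u v => f u v) =
      sw K a fun a' a'' => sw K b fun b' b'' => f (a' * b') (a'' * b'') := by
  rw [sw_eq_lift, Bialgebra.comul_mul]
  conv_lhs => rw [(TensorProduct.exists_finset (R := K) (comul (R := K) a)).choose_spec,
    (TensorProduct.exists_finset (R := K) (comul (R := K) b)).choose_spec]
  simp [sw, sweedler, Finset.sum_mul_sum]

variable [IsCocomm K A]

/-- Commuting values alone give f(c') g(c'') = g(c'') f(c'); cocommutativity then exchanges c' and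
c''. -/
theorem conv_commute {f g : WithConv (A →ₗ[K] S)} (h : ∀ a b, Commute (f a) (g b)) :
    Commute f g := by
  refine WithConv.ext (LinearMap.ext fun c => ?_)
  refine (conv_apply f g c).trans (Eq.trans ?_ (conv_apply g f c).symm)
  refine Eq.trans ?_ (sw_flip ((LinearMap.mul K S).compl₁₂ g.ofConv f.ofConv) c)
  simp only [LinearMap.compl₁₂_apply, LinearMap.mul_apply', (h _ _).eq]

/-- Both sides are convolution inverses of Δ. Indeed Δ is the product of the two inclusions A → A ⊗
A, and the right side is the product of their inverses, whose order is immaterial because they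
commute. -/
theorem comul_antipode (a : A) : comul (R := K) (antipode K a) =
    TensorProduct.map (antipode K) (antipode K) (comul (R := K) a) := by
  have h : hvInv (Bialgebra.comulAlgHom K A) =
      toConv ((TensorProduct.map (antipode K) (antipode K)) ∘ₗ (comul (R := K) (A := A))) := by
    refine left_inv_eq_right_inv (hvInv_mul_hv _) ?_
    let i₁ : A →ₐ[K] A ⊗[K] A := Algebra.TensorProduct.includeLeft
    let i₂ : A →ₐ[K] A ⊗[K] A := Algebra.TensorProduct.includeRight
    have c1 : hv (Bialgebra.comulAlgHom K A) = hv i₁ * hv i₂ := by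
      refine WithConv.ext (LinearMap.ext fun c => ?_)
      refine Eq.trans ?_ (conv_apply _ _ c).symm
      change comul c = _
      conv_lhs => rw [(TensorProduct.exists_finset (R := K) (comul (R := K) c)).choose_spec]
      simp [sw, sweedler, i₁, i₂, hv]
    have c2 : toConv ((TensorProduct.map (antipode K) (antipode K)) ∘ₗ
        (comul (R := K) (A := A))) = hvInv i₁ * hvInv i₂ := by
      refine WithConv.ext (LinearMap.ext fun c => ?_)
      refine Eq.trans ?_ (conv_apply _ _ c).symm
      change TensorProduct.map _ _ (comul c) = _
      conv_lhs => rw [(TensorProduct.exists_finset (R := K) (comul (R := K) c)).choose_spec]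
      simp [sw, sweedler, i₁, i₂, hvInv]
    have c3 : Commute (hvInv i₁) (hvInv i₂) := conv_commute fun a b => by
      simp [hvInv, i₁, i₂, Commute, SemiconjBy]
    rw [c1, c2, c3.eq, mul_assoc, ← mul_assoc (hv i₂), hv_mul_hvInv, one_mul, hv_mul_hvInv]
  exact congr($h a)

theorem sw_antipode (f : A →ₗ[K] A →ₗ[K] P) (a : A) :
    sw K (antipode K a) (fun u v => f u v) =
      sw K a fun a' a'' => f (antipode K a') (antipode K a'') := by
  rw [sw_eq_lift, comul_antipode]
  conv_lhs => rw [(TensorProduct.exists_finset (R := K) (comul (R := K) a)).choose_spec]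
  simp [sw, sweedler]

/-- The convolution product of two commuting algebra homomorphisms. -/
noncomputable def convHom (f g : A →ₐ[K] S) (h : ∀ a b, Commute (f a) (g b)) : A →ₐ[K] S :=
  (Algebra.TensorProduct.lift f g h).comp (Bialgebra.comulAlgHom K A)

theorem hv_convHom (f g : A →ₐ[K] S) (h : ∀ a b, Commute (f a) (g b)) :
    hv (convHom f g h) = hv f * hv g := by
  refine WithConv.ext (LinearMap.ext fun c => ?_)
  refine Eq.trans ?_ (conv_apply _ _ c).symm
  change Algebra.TensorProduct.lift f g h (comul c) = _
  conv_lhs => rw [(TensorProduct.exists_finset (R := K) (comul (R := K) c)).choose_spec]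
  simp [sw, sweedler, hv]

end Hopf

end RepAlg

namespace RepAlg

set_option linter.unusedSectionVars false

/-! ### Linearity of Sweedler expressions -/

section Lin

/-- A linearity predicate for unbundled maps. -/
@[fun_prop]
structure Lin (K : Type*) {M N : Type*} [CommRing K] [AddCommGroup M] [Module K M]
    [AddCommGroup N] [Module K N] (f : M → N) : Prop where
  add : ∀ x y, f (x + y) = f x + f y
  smul : ∀ (k : K) x, f (k • x) = k • f x

variable {K M N P Q S C : Type*} [CommRing K] [AddCommGroup M] [Module K M]
  [AddCommGroup N] [Module K N] [AddCommGroup P] [Module K P] [AddCommGroup Q] [Module K Q]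
  [Ring S] [Algebra K S] [AddCommGroup C] [Module K C] [Coalgebra K C]

namespace Lin

/-- The bundled linear map. -/
def mk' {f : M → N} (h : Lin K f) : M →ₗ[K] N where
  toFun := f
  map_add' := h.add
  map_smul' := h.smul

@[simp] theorem mk'_apply {f : M → N} (h : Lin K f) (x : M) : h.mk' x = f x := rfl

/-- The bundled bilinear map. -/
def mk₂ {f : M → N → P} (h₁ : ∀ y, Lin K fun x => f x y) (h₂ : ∀ x, Lin K (f x)) :
    M →ₗ[K] N →ₗ[K] P :=
  LinearMap.mk₂ K f (fun x x' y => (h₁ y).add x x') (fun k x y => (h₁ y).smul k x)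
    (fun x => (h₂ x).add) (fun k x => (h₂ x).smul k)

@[simp] theorem mk₂_apply {f : M → N → P} (h₁ : ∀ y, Lin K fun x => f x y)
    (h₂ : ∀ x, Lin K (f x)) (x : M) (y : N) : mk₂ h₁ h₂ x y = f x y := rfl

@[fun_prop] theorem id : Lin K (fun x : M => x) := ⟨fun _ _ => rfl, fun _ _ => rfl⟩

@[fun_prop] theorem comp {f : N → P} {g : M → N} (hf : Lin K f) (hg : Lin K g) :
    Lin K fun x => f (g x) :=
  ⟨fun x y => by rw [hg.add, hf.add], fun k x => by rw [hg.smul, hf.smul]⟩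

@[fun_prop] theorem zero : Lin K (fun _ : M => (0 : N)) :=
  ⟨fun _ _ => (add_zero 0).symm, fun k _ => (smul_zero k).symm⟩

@[fun_prop] theorem neg {f : M → N} (hf : Lin K f) : Lin K fun x => -f x :=
  ⟨fun x y => by rw [hf.add, neg_add], fun k x => by rw [hf.smul, smul_neg]⟩

theorem map_neg {f : M → N} (hf : Lin K f) (x : M) : f (-x) = -f x :=
  _root_.map_neg hf.mk' x

theorem map_sub {f : M → N} (hf : Lin K f) (x y : M) : f (x - y) = f x - f y :=
  _root_.map_sub hf.mk' x y

@[fun_prop] theorem fadd {f g : M → N} (hf : Lin K f) (hg : Lin K g) :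
    Lin K fun x => f x + g x :=
  ⟨fun x y => by rw [hf.add, hg.add]; abel, fun k x => by rw [hf.smul, hg.smul, smul_add]⟩

@[fun_prop] theorem fsub {f g : M → N} (hf : Lin K f) (hg : Lin K g) :
    Lin K fun x => f x - g x :=
  ⟨fun x y => by rw [hf.add, hg.add]; abel, fun k x => by rw [hf.smul, hg.smul, smul_sub]⟩

@[fun_prop] theorem mul_const {f : M → S} (hf : Lin K f) (c : S) : Lin K fun x => f x * c :=
  ⟨fun x y => by rw [hf.add, add_mul], fun k x => by rw [hf.smul, smul_mul_assoc]⟩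

@[fun_prop] theorem const_mul {f : M → S} (hf : Lin K f) (c : S) : Lin K fun x => c * f x :=
  ⟨fun x y => by rw [hf.add, mul_add], fun k x => by rw [hf.smul, mul_smul_comm]⟩

@[fun_prop] theorem const_smul {f : M → N} (hf : Lin K f) (c : K) : Lin K fun x => c • f x :=
  ⟨fun x y => by rw [hf.add, smul_add], fun k x => by rw [hf.smul, smul_comm]⟩

@[fun_prop] theorem smul_const {f : M → K} (hf : Lin K f) (c : N) : Lin K fun x => f x • c :=
  ⟨fun x y => by rw [hf.add, add_smul], fun k x => by rw [hf.smul, smul_eq_mul, mul_smul]⟩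

@[fun_prop] theorem tmul_const {f : M → N} (hf : Lin K f) (c : P) :
    Lin K fun x => f x ⊗ₜ[K] c :=
  ⟨fun x y => by rw [hf.add, TensorProduct.add_tmul],
    fun k x => by rw [hf.smul, TensorProduct.smul_tmul']⟩

@[fun_prop] theorem const_tmul {f : M → N} (hf : Lin K f) (c : P) :
    Lin K fun x => c ⊗ₜ[K] f x :=
  ⟨fun x y => by rw [hf.add, TensorProduct.tmul_add],
    fun k x => by rw [hf.smul, TensorProduct.tmul_smul]⟩

@[fun_prop] theorem coe (L : M →ₗ[K] N) : Lin K fun x => L x := ⟨L.map_add, L.map_smul⟩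

@[fun_prop] theorem coe_comp (L : N →ₗ[K] P) {f : M → N} (hf : Lin K f) : Lin K fun x => L (f x) :=
  comp (coe L) hf

@[fun_prop] theorem coe_alg {T : Type*} [Ring T] [Algebra K T] (L : S →ₐ[K] T) {f : M → S}
    (hf : Lin K f) : Lin K fun x => L (f x) :=
  ⟨fun x y => by rw [hf.add, map_add], fun k x => by rw [hf.smul, map_smul]⟩

@[fun_prop] theorem apply_const {L : M → N →ₗ[K] P} (hL : Lin K L) (c : N) :
    Lin K fun x => L x c :=
  ⟨fun x y => by rw [hL.add, LinearMap.add_apply], fun k x => by rw [hL.smul, LinearMap.smul_apply]⟩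

@[fun_prop] theorem ofConv {L : M → WithConv (N →ₗ[K] P)} (hL : Lin K L) :
    Lin K fun x => (L x).ofConv :=
  ⟨fun x y => by rw [hL.add]; rfl, fun k x => by rw [hL.smul]; rfl⟩

@[fun_prop] theorem sw_const {F : M → C → C → N} (c : C) (h : ∀ a b, Lin K fun x => F x a b) :
    Lin K fun x => sw K c (F x) :=
  ⟨fun x y => by simp only [sw, sweedler, (h _ _).add, Finset.sum_add_distrib],
    fun k x => by simp only [sw, sweedler, (h _ _).smul, Finset.smul_sum]⟩

@[fun_prop] theorem sw_arg {F : C → C → N} {g : M → C} (hg : Lin K g)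
    (h₁ : ∀ b, Lin K fun a => F a b) (h₂ : ∀ a, Lin K (F a)) :
    Lin K fun x => sw K (g x) F :=
  comp (f := fun c => sw K c F) (by
    have : (fun c => sw K c F) = TensorProduct.lift (mk₂ h₁ h₂) ∘ₗ comul := by
      funext c
      exact sw_eq_lift (mk₂ h₁ h₂) c
    rw [this]
    exact coe _) hg

end Lin

theorem sw_counit_left {F : C → P} (h : Lin K F) (c : C) :
    sw K c (fun a b => counit (R := K) a • F b) = F c :=
  sw_counit_smul h.mk' c

theorem sw_counit_right {F : C → P} (h : Lin K F) (c : C) :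
    sw K c (fun a b => counit (R := K) b • F a) = F c :=
  sw_smul_counit h.mk' c

theorem sw_assoc {F : C → C → C → P} (h₁ : ∀ b d, Lin K fun a => F a b d)
    (h₂ : ∀ a d, Lin K fun b => F a b d) (h₃ : ∀ a b, Lin K fun d => F a b d) (c : C) :
    sw K c (fun e d => sw K e fun a b => F a b d) = sw K c fun a e => sw K e fun b d => F a b d := by
  let L : C →ₗ[K] C ⊗[K] C →ₗ[K] P := Lin.mk₂ (f := fun a z => TensorProduct.lift
    (Lin.mk₂ (h₂ a) (h₃ a)) z) (fun z => by
      induction z with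
      | zero => simp only [map_zero]; fun_prop
      | tmul b d => exact h₁ b d
      | add p q hp hq => simp only [map_add]; fun_prop) (fun a => Lin.coe _)
  have l1 := sw_eq_lift (K := K) (C := C) (Lin.mk₂ (f := fun e d => sw K e fun a b => F a b d)
    (by fun_prop) (by fun_prop)) c
  have l2 := sw_eq_lift (K := K) (C := C) (Lin.mk₂ (f := fun a e => sw K e fun b d => F a b d)
    (by fun_prop) (by fun_prop)) c
  refine l1.trans (Eq.trans ?_ l2.symm)
  have h := congrArg (TensorProduct.lift L) (coassoc_apply (R := K) c)
  have e1 : ∀ z : C ⊗[K] C, TensorProduct.lift L (TensorProduct.assoc K C C C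
      ((comul (R := K)).rTensor C z)) = TensorProduct.lift (Lin.mk₂
        (f := fun e d => sw K e fun a b => F a b d) (by fun_prop) (by fun_prop)) z := by
    intro z
    induction z with
    | zero => simp
    | add p q hp hq => simp only [map_add, hp, hq]
    | tmul e d =>
      rw [LinearMap.rTensor_tmul, TensorProduct.lift.tmul, Lin.mk₂_apply]
      refine Eq.trans ?_ (sw_eq_lift (Lin.mk₂ (f := fun a b => F a b d) (by fun_prop)
        (by fun_prop)) e).symm
      generalize comul (R := K) e = w
      induction w with
      | zero => simp
      | add p q hp hq => simp only [map_add, hp, hq, TensorProduct.add_tmul]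
      | tmul a b => simp [L]
  have e2 : ∀ z : C ⊗[K] C, TensorProduct.lift L ((comul (R := K)).lTensor C z) =
      TensorProduct.lift (Lin.mk₂
        (f := fun a e => sw K e fun b d => F a b d) (by fun_prop) (by fun_prop)) z := by
    intro z
    induction z with
    | zero => simp
    | add p q hp hq => simp only [map_add, hp, hq]
    | tmul a e =>
      rw [LinearMap.lTensor_tmul, TensorProduct.lift.tmul, Lin.mk₂_apply]
      exact (sw_eq_lift (Lin.mk₂ (h₂ a) (h₃ a)) e).symm
  rw [← e1, ← e2, h]

theorem sw_sw {D : Type*} [AddCommGroup D] [Module K D] [Coalgebra K D]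
    (c : C) (d : D) (F : C → C → D → D → P) :
    sw K c (fun a b => sw K d fun e f => F a b e f) =
      sw K d fun e f => sw K c fun a b => F a b e f :=
  Finset.sum_comm

theorem sw_add (c : C) (F G : C → C → P) :
    sw K c (fun a b => F a b + G a b) = sw K c F + sw K c G :=
  Finset.sum_add_distrib

theorem sw_sub (c : C) (F G : C → C → P) :
    sw K c (fun a b => F a b - G a b) = sw K c F - sw K c G :=
  Finset.sum_sub_distrib _ _

theorem sw_neg (c : C) (F : C → C → P) : sw K c (fun a b => -F a b) = -sw K c F :=
  Finset.sum_neg_distrib _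

theorem sw_mul_right (c : C) (F : C → C → S) (s : S) :
    sw K c F * s = sw K c fun a b => F a b * s :=
  Finset.sum_mul _ _ _

theorem sw_mul_left (c : C) (F : C → C → S) (s : S) :
    s * sw K c F = sw K c fun a b => s * F a b :=
  Finset.mul_sum _ _ _

theorem sw_smul (c : C) (F : C → C → P) (k : K) :
    k • sw K c F = sw K c fun a b => k • F a b :=
  Finset.smul_sum

theorem lin_sw {F : C → C → P} {g : P → Q} (hg : Lin K g) (c : C) :
    g (sw K c F) = sw K c fun a b => g (F a b) :=
  map_sw hg.mk' c F

section Cocomm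

variable {A : Type*} [Ring A] [HopfAlgebra K A]

theorem sw_prod {F : A → A → P} (h₁ : ∀ b, Lin K fun a => F a b) (h₂ : ∀ a, Lin K (F a)) (a b : A) :
    sw K (a * b) F = sw K a fun a' a'' => sw K b fun b' b'' => F (a' * b') (a'' * b'') :=
  sw_mul (Lin.mk₂ h₁ h₂) a b

theorem sw_mul_antipode_eq (a : A) :
    sw K a (fun b c => b * antipode K c) = counit (R := K) a • (1 : A) := by
  have := sw_eq_convMul (K := K) (toConv LinearMap.id) (toConv (antipode K)) a
  rw [LinearMap.id_mul_antipode] at this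
  exact this.trans (Algebra.algebraMap_eq_smul_one _)

theorem sw_antipode_mul_eq (a : A) :
    sw K a (fun b c => antipode K b * c) = counit (R := K) a • (1 : A) := by
  have := sw_eq_convMul (K := K) (toConv (antipode K)) (toConv LinearMap.id) a
  rw [LinearMap.antipode_mul_id] at this
  exact this.trans (Algebra.algebraMap_eq_smul_one _)

variable [IsCocomm K A]

theorem sw_comm {F : A → A → P} (h₁ : ∀ b, Lin K fun a => F a b) (h₂ : ∀ a, Lin K (F a)) (a : A) :
    sw K a (fun a' a'' => F a'' a') = sw K a F :=
  sw_flip (Lin.mk₂ h₁ h₂) a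

theorem sw_anti {F : A → A → P} (h₁ : ∀ b, Lin K fun a => F a b) (h₂ : ∀ a, Lin K (F a)) (a : A) :
    sw K (antipode K a) F = sw K a fun a' a'' => F (antipode K a') (antipode K a'') :=
  sw_antipode (Lin.mk₂ h₁ h₂) a

theorem sw_swap {F : A → A → A → P} (h₁ : ∀ b d, Lin K fun a => F a b d)
    (h₂ : ∀ a d, Lin K fun b => F a b d) (h₃ : ∀ a b, Lin K fun d => F a b d) (c : A) :
    sw K c (fun e d => sw K e fun a b => F a b d) =
      sw K c fun e d => sw K e fun a b => F a d b := by
  rw [sw_assoc h₁ h₂ h₃, sw_assoc (by fun_prop) (by fun_prop) (by fun_prop)]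
  refine congrArg (sw K c) (funext fun a => funext fun e => ?_)
  exact sw_comm (F := fun b d => F a d b) (by fun_prop) (by fun_prop) e

end Cocomm

end Lin

end RepAlg

namespace RepAlg

set_option linter.unusedSectionVars false

/-! ### The tritensor map of a Fox pairing -/

section FoxTensor

variable {K A T : Type*} [CommRing K] [Ring A] [HopfAlgebra K A] [Ring T] [Algebra K T]
  (i₁ i₂ i₃ : A →ₐ[K] T)

/-- `w ↦ 1 ⊗ s(w') ⊗ w''`. -/
noncomputable def foxTail (w : A) : T :=
  sw K w fun a b => i₂ (antipode K a) * i₃ b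

@[fun_prop] theorem lin_foxTail : Lin K (foxTail i₂ i₃) := by
  unfold foxTail; fun_prop

variable {i₁ i₂ i₃} in
theorem commute_foxTail (c12 : ∀ a b, Commute (i₁ a) (i₂ b)) (c13 : ∀ a b, Commute (i₁ a) (i₃ b))
    (a w : A) : Commute (i₁ a) (foxTail i₂ i₃ w) := by
  rw [foxTail, Commute, SemiconjBy, sw_mul_left, sw_mul_right]
  refine congrArg (sw K w) (funext fun u => funext fun v => ?_)
  exact ((c12 a _).mul_right (c13 a v)).eq

/-- `(w, p) ↦ s(p') ⊗ s(w') p'' ⊗ w''`. -/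
noncomputable def foxCorner (w p : A) : T :=
  sw K p fun p₁ p₂ => i₁ (antipode K p₁) * (foxTail i₂ i₃ w * i₂ p₂)

/-- `r ↦ s(r') ⊗ s(q') r'' ⊗ q''`, where `q = ρ(r''', v)`. -/
noncomputable def foxCore (ρ : A →ₗ[K] A →ₗ[K] A) (v r : A) : T :=
  sw3 K r fun r₁ r₂ r₃ => i₁ (antipode K r₁) * (foxTail i₂ i₃ (ρ r₃ v) * i₂ r₂)

@[fun_prop] theorem lin_foxCore_right (ρ : A →ₗ[K] A →ₗ[K] A) (v : A) :
    Lin K (foxCore i₁ i₂ i₃ ρ v) := by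
  unfold foxCore sw3; fun_prop

@[fun_prop] theorem lin_foxCore_left (ρ : A →ₗ[K] A →ₗ[K] A) (r : A) :
    Lin K (fun v => foxCore i₁ i₂ i₃ ρ v r) := by
  unfold foxCore sw3; fun_prop

theorem foxCore_eq (ρ : A →ₗ[K] A →ₗ[K] A) (v p : A) :
    foxCore i₁ i₂ i₃ ρ v p = sw K p fun p₁ p₂ => foxCorner i₁ i₂ i₃ (ρ p₂ v) p₁ := by
  simp only [foxCore, sw3, foxCorner]
  rw [sw_assoc (by fun_prop) (by fun_prop) (by fun_prop)]

variable [IsCocomm K A]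

variable {i₁ i₂ i₃} in
-- As s is anti-multiplicative with s² = id, the factor s(h) comes out as h'' on the right of slot 2
-- and s(h') on the left of slot 3.
theorem foxTail_antipode_mul (c23 : ∀ a b, Commute (i₂ a) (i₃ b)) (h w : A) : foxTail i₂ i₃ (antipode K h * w) =
    sw K h fun a b => i₃ (antipode K a) * foxTail i₂ i₃ w * i₂ b := by
  rw [foxTail, sw_prod (by fun_prop) (by fun_prop), sw_anti (by fun_prop) (by fun_prop),
    ← sw_comm (by fun_prop) (by fun_prop)]
  refine congrArg (sw K _) (funext₂ fun a b => ?_)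
  rw [foxTail, sw_mul_left, sw_mul_right]
  refine congrArg (sw K _) (funext₂ fun c d => ?_)
  rw [antipode_mul_antidistrib, antipode_involutive, map_mul, map_mul, mul_assoc (i₃ _),
    mul_assoc (i₂ _) (i₃ d), ← (c23 b d).eq, ← mul_assoc, ← mul_assoc,
    (((c23 _ _).mul_left (c23 _ _)).eq : i₂ (antipode K c) *
      i₂ b * i₃ (antipode K a) = _)]
  simp only [mul_assoc]

/-- The bilinear map `ε(h) ρ(p, v) - ε(p) ρ(h, v)`. -/
def foxDiff (ρ : A →ₗ[K] A →ₗ[K] A) (v p h : A) : A :=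
  counit (R := K) h • ρ p v - counit (R := K) p • ρ h v

@[fun_prop] theorem lin_foxDiff (ρ : A →ₗ[K] A →ₗ[K] A) (v p : A) : Lin K (foxDiff ρ v p) := by
  unfold foxDiff; fun_prop

variable {ρ : A →ₗ[K] A →ₗ[K] A}

theorem IsFoxPairing.one_left (hρ : IsFoxPairing ρ) (v : A) : ρ 1 v = 0 := by
  have := hρ.map_mul_left 1 1 v
  simpa using this

theorem IsFoxPairing.one_right (hρ : IsFoxPairing ρ) (v : A) : ρ v 1 = 0 := by
  have := hρ.map_mul_right v 1 1
  simpa using this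

/-- Apply ρ(-, v) to s(x') x'' = ε(x) 1 and use ρ(1, v) = 0. -/
theorem IsFoxPairing.antipode_left (hρ : IsFoxPairing ρ) (x v : A) :
    ρ (antipode K x) v = -sw K x fun a b => antipode K a * ρ b v := by
  have h := congrArg (fun a => ρ a v) (sw_antipode_mul_eq (K := K) x)
  have e : ρ (sw K x fun b c => antipode K b * c) v =
      sw K x fun b c => ρ (antipode K b * c) v :=
    lin_sw (g := fun a => ρ a v) (by fun_prop) x
  simp only [e, map_smul, LinearMap.smul_apply, hρ.one_left, smul_zero, hρ.map_mul_left,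
    sw_add] at h
  rw [← eq_neg_of_add_eq_zero_left h]
  exact (sw_counit_right (F := fun a => ρ (antipode K a) v) (by fun_prop) x).symm

theorem IsFoxPairing.antipode_mul_left (hρ : IsFoxPairing ρ) (h p v : A) :
    ρ (antipode K h * p) v = sw K h fun a b => antipode K a * foxDiff ρ v p b := by
  simp only [foxDiff, mul_sub, mul_smul_comm, sw_sub]
  rw [hρ.map_mul_left, hρ.antipode_left,
    sw_counit_right (F := fun a => antipode K a * ρ p v) (by fun_prop), ← sw_smul, smul_neg]
  abel

variable {i₁ i₂ i₃}

/-- Displays the dependence on h as a single convolution product. Its outer factors `hv i₁` and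
`hvInv i₃` can then be cancelled by multiplication with their inverses, leaving h only inside
`foxDiff`. -/
theorem IsFoxPairing.foxCore_antipode_mul (c23 : ∀ a b, Commute (i₂ a) (i₃ b)) (hρ : IsFoxPairing ρ) (v p : A) :
    toConv (Lin.mk' (K := K) (f := fun h => foxCore i₁ i₂ i₃ ρ v (antipode K h * p)) (by fun_prop)) =
      sw K p fun p₁ p' => sw K p' fun p₂ p₃ =>
        cst (i₁ (antipode K p₁)) * (hv i₁ * (hvInv i₃ *
          (toConv (Lin.mk' (K := K) (f := fun h => foxTail i₂ i₃ (foxDiff ρ v p₃ h)) (by fun_prop)) *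
            cst (i₂ p₂)))) := by
  refine WithConv.ext (LinearMap.ext fun h => ?_)
  have ev : ∀ F : A → A → WithConv (A →ₗ[K] T), (sw K p F) h =
      sw K p fun a b => F a b h := fun F => by
    exact lin_sw (K := K) (g := fun f : WithConv (A →ₗ[K] T) => f h)
      ⟨fun _ _ => rfl, fun _ _ => rfl⟩ p
  have ev' : ∀ (p : A) (F : A → A → WithConv (A →ₗ[K] T)), (sw K p F) h =
      sw K p fun a b => F a b h := fun p F => by
    exact lin_sw (K := K) (g := fun f : WithConv (A →ₗ[K] T) => f h)
      ⟨fun _ _ => rfl, fun _ _ => rfl⟩ p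
  rw [ev]
  simp only [ev']
  change foxCore i₁ i₂ i₃ ρ v (antipode K h * p) = _
  rw [foxCore, sw3, sw_prod (by fun_prop) (by fun_prop), sw_anti (by fun_prop) (by fun_prop),
    sw_sw]
  refine congrArg (sw K _) (funext₂ fun p₁ p' => ?_)
  have e : ∀ a b : A, (sw K (antipode K b * p') fun r₂ r₃ =>
      i₁ (antipode K (antipode K a * p₁)) * (foxTail i₂ i₃ (ρ r₃ v) * i₂ r₂)) =
      sw K p' fun p₂ p₃ => i₁ (antipode K p₁) * (i₁ a * sw K b fun f g =>
        (foxTail i₂ i₃ (ρ (antipode K f * p₃) v) * i₂ (antipode K g)) * i₂ p₂) := by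
    intro a b
    rw [sw_prod (by fun_prop) (by fun_prop), sw_anti (by fun_prop) (by fun_prop), sw_sw]
    refine congrArg (sw K _) (funext₂ fun p₂ p₃ => ?_)
    rw [← sw_comm (by fun_prop) (by fun_prop), sw_mul_left, sw_mul_left]
    refine congrArg (sw K _) (funext₂ fun f g => ?_)
    simp only [antipode_mul_antidistrib, antipode_involutive _, map_mul, mul_assoc]
  simp only [e]
  rw [sw_sw]
  refine congrArg (sw K _) (funext₂ fun p₂ p₃ => ?_)
  -- The slot-2 factors of h cancel: pulling s(f) out of `foxTail` leaves h on the right of slot 2,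
  -- where it meets the s(g) coming from the middle leg of s(h) p.
  have key : toConv (Lin.mk' (K := K)
      (f := fun f => foxTail i₂ i₃ (ρ (antipode K f * p₃) v)) (by fun_prop)) * hvInv i₂ =
      hvInv i₃ * toConv (Lin.mk' (K := K)
        (f := fun h => foxTail i₂ i₃ (foxDiff ρ v p₃ h)) (by fun_prop)) := by
    have : toConv (Lin.mk' (K := K) (f := fun f => foxTail i₂ i₃ (ρ (antipode K f * p₃) v))
        (by fun_prop)) = hvInv i₃ * (toConv (Lin.mk' (K := K)
        (f := fun h => foxTail i₂ i₃ (foxDiff ρ v p₃ h)) (by fun_prop)) * hv i₂) := by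
      refine WithConv.ext (LinearMap.ext fun f => ?_)
      refine Eq.trans ?_ (conv_apply _ _ _).symm
      change foxTail i₂ i₃ (ρ (antipode K f * p₃) v) = _
      simp only [conv_apply]
      rw [hρ.antipode_mul_left, lin_sw (lin_foxTail i₂ i₃)]
      simp only [foxTail_antipode_mul c23, sw_mul_left]
      rw [sw_assoc (F := fun a b d => i₃ (antipode K a) * foxTail i₂ i₃ (foxDiff ρ v p₃ d) *
        i₂ b) (by fun_prop) (by fun_prop) (by fun_prop)]
      refine congrArg (sw K _) (funext₂ fun a e => ?_)
      rw [← sw_comm (by fun_prop) (by fun_prop)]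
      refine congrArg (sw K _) (funext₂ fun c d => ?_)
      simp only [mul_assoc]
      rfl
    rw [this]
    simp only [mul_assoc, hv_mul_hvInv, mul_one]
  have fin : (sw K h fun a b => i₁ (antipode K p₁) * (i₁ a * sw K b fun f g =>
      (foxTail i₂ i₃ (ρ (antipode K f * p₃) v) * i₂ (antipode K g)) * i₂ p₂)) =
      (cst (i₁ (antipode K p₁)) * (hv i₁ * ((toConv (Lin.mk' (K := K)
      (f := fun f => foxTail i₂ i₃ (ρ (antipode K f * p₃) v)) (by fun_prop)) * hvInv i₂) *
      cst (i₂ p₂))) : WithConv (A →ₗ[K] T)) h := by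
    rw [cst_mul_apply, conv_apply, sw_mul_left]
    refine congrArg (sw K _) (funext₂ fun a b => ?_)
    rw [mul_cst_apply, conv_apply, sw_mul_right]
    rfl
  rw [fin, key, mul_assoc]

/-- Multiplication by i₃(h') on the left and by i₁(s(h''')) on the right removes the outer factors
found in `foxCore_antipode_mul`. The two terms of `foxDiff` then give the two terms on the right. -/
theorem IsFoxPairing.sw_foxCore_antipode_mul (c12 : ∀ a b, Commute (i₁ a) (i₂ b))
    (c13 : ∀ a b, Commute (i₁ a) (i₃ b)) (c23 : ∀ a b, Commute (i₂ a) (i₃ b)) (hρ : IsFoxPairing ρ) (v p h : A) :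
    (sw K h fun h₁ h₂ => i₃ h₁ * sw K h₂ fun a b =>
      foxCore i₁ i₂ i₃ ρ v (antipode K a * p) * i₁ (antipode K b)) =
    counit (R := K) h • foxCore i₁ i₂ i₃ ρ v p - foxCorner i₁ i₂ i₃ (ρ h v) p := by
  have e : (sw K h fun h₁ h₂ => i₃ h₁ * sw K h₂ fun a b =>
      foxCore i₁ i₂ i₃ ρ v (antipode K a * p) * i₁ (antipode K b)) =
      (hv i₃ * (toConv (Lin.mk' (K := K)
        (f := fun h => foxCore i₁ i₂ i₃ ρ v (antipode K h * p)) (by fun_prop)) * hvInv i₁) :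
        WithConv (A →ₗ[K] T)) h := by
    rw [conv_apply]
    refine congrArg (sw K _) (funext₂ fun a b => ?_)
    rw [conv_apply]
    rfl
  rw [e, hρ.foxCore_antipode_mul c23]
  simp only [sw_mul_left, sw_mul_right]
  have step : ∀ p₁ p₂ p₃ : A, hv i₃ * (cst (i₁ (antipode K p₁)) *
      (hv i₁ * (hvInv i₃ * (toConv (Lin.mk' (K := K)
        (f := fun h => foxTail i₂ i₃ (foxDiff ρ v p₃ h)) (by fun_prop)) * cst (i₂ p₂)))) *
        hvInv i₁) = cst (i₁ (antipode K p₁)) * (toConv (Lin.mk' (K := K)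
        (f := fun h => foxTail i₂ i₃ (foxDiff ρ v p₃ h)) (by fun_prop)) * cst (i₂ p₂)) := by
    intro p₁ p₂ p₃
    set W := toConv (Lin.mk' (K := K) (f := fun h => foxTail i₂ i₃ (foxDiff ρ v p₃ h)) (by fun_prop))
    have c1 : Commute (hv i₃) (cst (i₁ (antipode K p₁))) :=
      (commute_cst fun c => c13 _ _).symm
    have c2 : Commute (hv i₁) (hvInv i₃) :=
      conv_commute fun a b => c13 _ _
    have c3 : Commute (hv i₁) W :=
      conv_commute fun a b => commute_foxTail c12 c13 _ _
    have c4 : Commute (hv i₁) (cst (i₂ p₂)) :=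
      (commute_cst fun c => (c12 _ _).symm).symm
    -- The factor i₁(h) can travel to the far right, where it meets i₁(s(h)).
    have c5 : hv i₁ * (hvInv i₃ * (W * cst (i₂ p₂))) =
        hvInv i₃ * (W * cst (i₂ p₂)) * hv i₁ :=
      (c2.mul_right (c3.mul_right c4)).eq
    rw [c5]
    simp only [mul_assoc, hv_mul_hvInv, mul_one]
    rw [← mul_assoc, c1.eq, mul_assoc, hv_mul_hvInv_assoc]
  simp only [step]
  have ev : ∀ (p : A) (F : A → A → WithConv (A →ₗ[K] T)), (sw K p F) h =
      sw K p fun a b => F a b h := fun p F => by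
    exact lin_sw (K := K) (g := fun f : WithConv (A →ₗ[K] T) => f h)
      ⟨fun _ _ => rfl, fun _ _ => rfl⟩ p
  simp only [ev, cst_mul_apply, mul_cst_apply]
  have e2 : ∀ (h p₃ : A), (toConv (Lin.mk' (K := K) (f := fun h => foxTail i₂ i₃ (foxDiff ρ v p₃ h))
      (by fun_prop))).ofConv h =
      counit (R := K) h • foxTail i₂ i₃ (ρ p₃ v) - counit (R := K) p₃ • foxTail i₂ i₃ (ρ h v) := by
    intro h p₃
    change foxTail i₂ i₃ (foxDiff ρ v p₃ h) = _
    rw [foxDiff, sub_eq_add_neg, (lin_foxTail i₂ i₃).add, ← neg_smul, (lin_foxTail i₂ i₃).smul, (lin_foxTail i₂ i₃).smul,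
      neg_smul, sub_eq_add_neg]
  simp only [e2, sub_mul, mul_sub, smul_mul_assoc, mul_smul_comm, sw_sub, ← sw_smul]
  congr 1
  refine congrArg (sw K _) (funext₂ fun p₁ p' => ?_)
  exact sw_counit_right (F := fun b => i₁ (antipode K p₁) * (foxTail i₂ i₃ (ρ h v) *
    i₂ b)) (by fun_prop) p'

/-- The expression `x'₃ N(ρ(s(x'''), e)) s(x'')₁`, in terms of `foxCorner i₁ i₂ i₃`. -/
theorem IsFoxPairing.sw_foxCore_antipode (c12 : ∀ a b, Commute (i₁ a) (i₂ b))
    (c13 : ∀ a b, Commute (i₁ a) (i₃ b)) (c23 : ∀ a b, Commute (i₂ a) (i₃ b)) (hρ : IsFoxPairing ρ) (x e v : A) :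
    (sw K x fun x' x'' => i₃ x' * sw K (antipode K x'') fun u u' =>
      foxCore i₁ i₂ i₃ ρ v (ρ u' e) * i₁ u) =
    (sw K x fun x' x'' => foxCorner i₁ i₂ i₃ (ρ x' v) (ρ x'' e)) -
      sw K (ρ x e) fun p₁ p₂ => foxCorner i₁ i₂ i₃ (ρ p₂ v) p₁ := by
  -- Expanding ρ(s(x''), e) by `antipode_left` produces arguments s(c) ρ(d, e), the shape treated by
  -- `sw_foxCore_antipode_mul`.
  have h1 : ∀ x'' : A, (sw K (antipode K x'') fun u u' => foxCore i₁ i₂ i₃ ρ v (ρ u' e) * i₁ u) =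
      -sw K x'' fun f d => sw K f fun c a =>
        foxCore i₁ i₂ i₃ ρ v (antipode K c * ρ d e) * i₁ (antipode K a) := by
    intro y
    rw [sw_anti (by fun_prop) (by fun_prop)]
    have : ∀ a b : A, foxCore i₁ i₂ i₃ ρ v (ρ (antipode K b) e) * i₁ (antipode K a) =
        -sw K b fun c d => foxCore i₁ i₂ i₃ ρ v (antipode K c * ρ d e) * i₁ (antipode K a) := by
      intro a b
      rw [hρ.antipode_left, lin_sw (g := fun z => foxCore i₁ i₂ i₃ ρ v (-z) * i₁ (antipode K a))
        (by fun_prop), ← sw_neg]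
      refine congrArg (sw K _) (funext₂ fun c d => ?_)
      rw [(lin_foxCore_right i₁ i₂ i₃ ρ v).map_neg, neg_mul]
    simp only [this, sw_neg]
    rw [← sw_assoc (by fun_prop) (by fun_prop) (by fun_prop)]
    refine congrArg (fun z => -z) (congrArg (sw K _) (funext₂ fun f d => ?_))
    exact sw_comm (F := fun c a => foxCore i₁ i₂ i₃ ρ v (antipode K c * ρ d e) *
      i₁ (antipode K a)) (by fun_prop) (by fun_prop) f
  simp only [h1, mul_neg, sw_neg]
  have h2 : ∀ x' x'' : A, (i₃ x' * sw K x'' fun f d => sw K f fun c a =>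
      foxCore i₁ i₂ i₃ ρ v (antipode K c * ρ d e) * i₁ (antipode K a)) =
      sw K x'' fun f d => i₃ x' * sw K f fun c a =>
        foxCore i₁ i₂ i₃ ρ v (antipode K c * ρ d e) * i₁ (antipode K a) :=
    fun _ _ => sw_mul_left _ _ _
  simp only [h2]
  -- Regroup the legs of x so that `sw_foxCore_antipode_mul` applies with p = ρ(d, e), where d is
  -- the last leg, and with the remaining legs as h.
  rw [← sw_assoc (F := fun x' f d => i₃ x' * sw K f fun c a =>
    foxCore i₁ i₂ i₃ ρ v (antipode K c * ρ d e) * i₁ (antipode K a)) (by fun_prop) (by fun_prop)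
    (by fun_prop)]
  simp only [hρ.sw_foxCore_antipode_mul c12 c13 c23, sw_sub]
  rw [sw_counit_left (F := fun d => foxCore i₁ i₂ i₃ ρ v (ρ d e)) (by fun_prop), foxCore_eq]
  abel

end FoxTensor

end RepAlg

namespace RepAlg

set_option linter.unusedSectionVars false

/-! ### Cancelling the outer factors of the tritensor map -/

section FoxStrip

variable {K A T : Type*} [CommRing K] [Ring A] [HopfAlgebra K A] [Ring T] [Algebra K T]
  (i₁ i₂ i₃ : A →ₐ[K] T)

/-- The expression `∑ x'₃ y'₁ z'₂ F(s(x''), s(y''), s(z''))`. -/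
noncomputable def foxStrip (F : A → A → A → T) (x y z : A) : T :=
  sw K x fun x' x'' => i₃ x' * sw K y fun y' y'' => i₁ y' * sw K z fun z' z'' =>
    i₂ z' * F (antipode K x'') (antipode K y'') (antipode K z'')

variable {i₁ i₂ i₃}

/-- The placement of x, y, z in slots 3, 1, 2 is respected by the cyclic permutation, so the
permuted copies of ϝ in T_ρ reduce to the strip of ϝ itself. -/
theorem map_foxStrip (c13 : ∀ a b, Commute (i₁ a) (i₃ b))
    (c23 : ∀ a b, Commute (i₂ a) (i₃ b)) (P : T →ₐ[K] T) (h1 : ∀ a, P (i₁ a) = i₂ a)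
    (h2 : ∀ a, P (i₂ a) = i₃ a) (h3 : ∀ a, P (i₃ a) = i₁ a) (F : A → A → A → T) (x y z : A) :
    P (foxStrip i₁ i₂ i₃ F y z x) =
      foxStrip i₁ i₂ i₃ (fun x y z => P (F y z x)) x y z := by
  simp only [foxStrip, map_sw, map_mul, h1, h2, h3, sw_mul_left]
  refine Eq.trans ?_ (sw_sw y x _)
  refine congrArg (sw K y) (funext₂ fun y' y'' => ?_)
  refine Eq.trans ?_ (sw_sw z x _)
  refine congrArg (sw K z) (funext₂ fun z' z'' => ?_)
  refine congrArg (sw K x) (funext₂ fun x' x'' => ?_)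
  rw [← mul_assoc (i₂ z'), (c23 z' x').eq, mul_assoc, ← mul_assoc (i₁ y'), (c13 y' x').eq,
    mul_assoc]

variable [IsCocomm K A]

/-- The prefactor z' cancels against the first leg of s(z''): this is i * i⁻¹ = 1 in the convolution
algebra. -/
theorem sw_mul_sw_antipode (i : A →ₐ[K] T) {F : A → T} (hF : Lin K F) (z : A) :
    (sw K z fun z' z'' => i z' * sw K (antipode K z'') fun u u' => i u * F u') =
      F (antipode K z) := by
  have h : (hv i * (hvInv i * toConv (Lin.mk' (f := fun z => F (antipode K z))
      (by fun_prop))) : WithConv (A →ₗ[K] T)) z = F (antipode K z) := by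
    rw [hv_mul_hvInv_assoc]
    rfl
  rw [← h, conv_apply]
  refine congrArg (sw K _) (funext₂ fun a b => ?_)
  rw [conv_apply, sw_anti (by fun_prop) (by fun_prop)]
  rfl

/-- The strip of `ϝ`. -/
noncomputable def foxStripped (i₁ i₂ i₃ : A →ₐ[K] T) (ρ : A →ₗ[K] A →ₗ[K] A) (x y z : A) : T :=
  (sw K x fun x' x'' => foxCorner i₁ i₂ i₃ (ρ x' (antipode K z)) (ρ x'' (antipode K y))) -
    sw K (ρ x (antipode K y)) fun p₁ p₂ => foxCorner i₁ i₂ i₃ (ρ p₂ (antipode K z)) p₁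

/-- The prefactors of y in slot 1 and of z in slot 2 cancel directly. The factors of x stand in slot
3 on the left and slot 1 on the right, so they cancel only after passing through ρ, which is the
content of `sw_foxCore_antipode`. -/
theorem IsFoxPairing.foxStrip_eq (c12 : ∀ a b, Commute (i₁ a) (i₂ b))
    (c13 : ∀ a b, Commute (i₁ a) (i₃ b)) (c23 : ∀ a b, Commute (i₂ a) (i₃ b))
    {ρ : A →ₗ[K] A →ₗ[K] A} (hρ : IsFoxPairing ρ) (x y z : A) :
    foxStrip i₁ i₂ i₃ (fun x y z => sw K z fun z' z'' => i₂ z' * sw K y fun y' y'' =>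
      i₁ y' * sw K x fun x' x'' => foxCore i₁ i₂ i₃ ρ z'' (ρ x'' y'') * i₁ x') x y z =
      foxStripped i₁ i₂ i₃ ρ x y z := by
  rw [foxStripped, ← hρ.sw_foxCore_antipode c12 c13 c23]
  refine congrArg (sw K _) (funext₂ fun x' x'' => ?_)
  refine congrArg (i₃ x' * ·) ?_
  have : ∀ y'' : A, _ := fun y'' => sw_mul_sw_antipode i₂ (F := fun z'' =>
    sw K (antipode K y'') fun y' y'' => i₁ y' * sw K (antipode K x'') fun x' x'' =>
      foxCore i₁ i₂ i₃ ρ z'' (ρ x'' y'') * i₁ x') (by fun_prop) z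
  simp only [this]
  exact sw_mul_sw_antipode i₁ (F := fun y'' => sw K (antipode K x'') fun x' x'' =>
      foxCore i₁ i₂ i₃ ρ (antipode K z) (ρ x'' y'') * i₁ x') (by fun_prop) y

end FoxStrip

/-! ### Evaluating tritensors by an invariant trilinear map -/

section FoxConcrete

variable {K A P : Type*} [CommRing K] [Ring A] [HopfAlgebra K A] [AddCommGroup P] [Module K P]

variable (K A) in
/-- `a ↦ a ⊗ 1 ⊗ 1`. -/
noncomputable def inj1 : A →ₐ[K] A ⊗[K] A ⊗[K] A :=
  Algebra.TensorProduct.includeLeft.comp Algebra.TensorProduct.includeLeft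

variable (K A) in
/-- `a ↦ 1 ⊗ a ⊗ 1`. -/
noncomputable def inj2 : A →ₐ[K] A ⊗[K] A ⊗[K] A :=
  Algebra.TensorProduct.includeLeft.comp Algebra.TensorProduct.includeRight

variable (K A) in
/-- `a ↦ 1 ⊗ 1 ⊗ a`. -/
noncomputable def inj3 : A →ₐ[K] A ⊗[K] A ⊗[K] A :=
  Algebra.TensorProduct.includeRight

theorem inj1_apply (a : A) : inj1 K A a = a ⊗ₜ 1 ⊗ₜ 1 := rfl

theorem inj2_apply (a : A) : inj2 K A a = 1 ⊗ₜ a ⊗ₜ 1 := rfl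

theorem inj3_apply (a : A) : inj3 K A a = 1 ⊗ₜ a := rfl

theorem commute_inj12 (a b : A) : Commute (inj1 K A a) (inj2 K A b) := by
  simp [inj1_apply, inj2_apply, Commute, SemiconjBy]

theorem commute_inj13 (a b : A) : Commute (inj1 K A a) (inj3 K A b) := by
  simp [inj1_apply, inj3_apply, Commute, SemiconjBy]

theorem commute_inj23 (a b : A) : Commute (inj2 K A a) (inj3 K A b) := by
  simp [inj2_apply, inj3_apply, Commute, SemiconjBy]

theorem digamma_eq (ρ : A →ₗ[K] A →ₗ[K] A) (x y z : A) :
    digamma ρ x y z = sw K z fun z' z'' => inj2 K A z' * sw K y fun y' y'' =>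
      inj1 K A y' * sw K x fun x' x'' => foxCore (inj1 K A) (inj2 K A) (inj3 K A) ρ z'' (ρ x'' y'') * inj1 K A x' := by
  refine (sw_sw x y _).trans ?_
  refine (congrArg (sw K y) (funext₂ fun _ _ => sw_sw x z _)).trans ?_
  refine (sw_sw y z _).trans ?_
  refine congrArg (sw K z) (funext₂ fun z' z'' => ?_)
  rw [sw_mul_left]
  refine congrArg (sw K y) (funext₂ fun y' y'' => ?_)
  rw [sw_mul_left, sw_mul_left]
  refine congrArg (sw K x) (funext₂ fun x' x'' => ?_)
  simp only [foxCore, sw3, foxTail, sw_mul_left, sw_mul_right]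
  refine congrArg (sw K _) (funext₂ fun r₁ e => ?_)
  refine congrArg (sw K _) (funext₂ fun r₂ r₃ => ?_)
  refine congrArg (sw K _) (funext₂ fun q₁ q₂ => ?_)
  simp [inj1_apply, inj2_apply, inj3_apply, mul_assoc]

variable (K A) in
/-- The permutation `x₁ ⊗ x₂ ⊗ x₃ ↦ x₃ ⊗ x₁ ⊗ x₂` as an algebra homomorphism. -/
noncomputable def permHom : A ⊗[K] A ⊗[K] A →ₐ[K] A ⊗[K] A ⊗[K] A :=
  (Algebra.TensorProduct.assoc K K K A A A).symm.toAlgHom.comp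
    (Algebra.TensorProduct.comm K (A ⊗[K] A) A).toAlgHom

theorem permHom_tmul (a b c : A) : permHom K A (a ⊗ₜ b ⊗ₜ c) = c ⊗ₜ a ⊗ₜ b := rfl

/-- `l₁ ⊗ l₂ ⊗ l₃ ↦ ε(l₂) Φ(1, l₁, s(l₃))`. -/
noncomputable def cornerFun (Φ : A →ₗ[K] A →ₗ[K] A →ₗ[K] P) : A ⊗[K] A ⊗[K] A →ₗ[K] P :=
  TensorProduct.lift (TensorProduct.lift (Lin.mk₂
    (f := fun a b => counit (R := K) b • (Φ 1 a ∘ₗ antipode K))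
    (fun b => by
      refine ⟨fun x y => ?_, fun k x => ?_⟩
      · rw [map_add, LinearMap.add_comp, smul_add]
      · rw [map_smul, LinearMap.smul_comp, smul_comm])
    (fun a => by fun_prop)))

theorem cornerFun_tmul (Φ : A →ₗ[K] A →ₗ[K] A →ₗ[K] P) (a b c : A) :
    cornerFun Φ (a ⊗ₜ b ⊗ₜ c) = counit (R := K) b • Φ 1 a (antipode K c) := rfl

/-- The contribution of `ϝ` to the Jacobi identity. -/
noncomputable def foxCyc (Φ : A → A → A → P) (ρ : A →ₗ[K] A →ₗ[K] A) (x y z : A) : P :=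
  (sw K x fun x' x'' => Φ 1 (antipode K (ρ x'' (antipode K y))) (antipode K (ρ x' (antipode K z))))
    - sw K (ρ x (antipode K y)) fun p₁ p₂ => Φ 1 (antipode K p₁)
      (antipode K (ρ p₂ (antipode K z)))

/-- The counit on the middle factor s(w') p'' collapses both comultiplications. -/
theorem cornerFun_foxCorner (Φ : A →ₗ[K] A →ₗ[K] A →ₗ[K] P) (w p : A) :
    cornerFun Φ (foxCorner (inj1 K A) (inj2 K A) (inj3 K A) w p) =
      Φ 1 (antipode K p) (antipode K w) := by
  have h : ∀ a b c d : A, cornerFun Φ (inj1 K A a * (inj2 K A b * inj3 K A c * inj2 K A d)) =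
      counit (R := K) d • counit (R := K) b • Φ 1 a (antipode K c) := fun a b c d => by
    simp [inj1_apply, inj2_apply, inj3_apply, cornerFun_tmul, smul_smul, mul_comm]
  simp only [foxCorner, foxTail, sw_mul_left, sw_mul_right, map_sw, h, counit_antipode, ← sw_smul]
  rw [sw_counit_right (F := fun p => sw K w fun a b => counit (R := K) a •
    Φ 1 (antipode K p) (antipode K b)) (by fun_prop),
    sw_counit_left (F := fun b => Φ 1 (antipode K p) (antipode K b)) (by fun_prop)]

variable [IsCocomm K A]

/-- After one permutation the middle factor is s(p'), and Φ(1, w'', s(p) w') remains; invariance of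
Φ moves w into the first argument. -/
theorem cornerFun_perm_foxCorner (Φ : A →ₗ[K] A →ₗ[K] A →ₗ[K] P)
    (hΦ : ∀ h b c, sw K h (fun h₁ h₂ => Φ 1 (b * h₁) (c * h₂)) = Φ (antipode K h) b c) (w p : A) :
    cornerFun Φ (permHom K A (foxCorner (inj1 K A) (inj2 K A) (inj3 K A) w p)) =
      Φ (antipode K w) 1 (antipode K p) := by
  have h : ∀ a b c d : A, cornerFun Φ (permHom K A
      (inj1 K A a * (inj2 K A b * inj3 K A c * inj2 K A d))) =
      counit (R := K) a • Φ 1 c (antipode K (b * d)) := fun a b c d => by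
    simp [inj1_apply, inj2_apply, inj3_apply, cornerFun_tmul, permHom_tmul]
  simp only [foxCorner, foxTail, sw_mul_left, sw_mul_right, map_sw, h, counit_antipode, ← sw_smul,
    antipode_mul_antidistrib, antipode_involutive _]
  rw [sw_counit_left (F := fun p => sw K w fun a b => Φ 1 b (antipode K p * a)) (by fun_prop),
    sw_comm (F := fun b a => Φ 1 b (antipode K p * a)) (by fun_prop) (by fun_prop), ← hΦ]
  simp only [one_mul]

/-- After two permutations the middle factor is w'', and Φ(1, s(w) p'', p') remains; invariance of Φ
moves p into the first argument. -/
theorem cornerFun_perm_perm_foxCorner (Φ : A →ₗ[K] A →ₗ[K] A →ₗ[K] P)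
    (hΦ : ∀ h b c, sw K h (fun h₁ h₂ => Φ 1 (b * h₁) (c * h₂)) = Φ (antipode K h) b c) (w p : A) :
    cornerFun Φ (permHom K A (permHom K A
      (foxCorner (inj1 K A) (inj2 K A) (inj3 K A) w p))) =
      Φ (antipode K p) (antipode K w) 1 := by
  have h : ∀ a b c d : A, cornerFun Φ (permHom K A (permHom K A
      (inj1 K A a * (inj2 K A b * inj3 K A c * inj2 K A d)))) =
      counit (R := K) c • Φ 1 (b * d) (antipode K a) := fun a b c d => by
    simp [inj1_apply, inj2_apply, inj3_apply, cornerFun_tmul, permHom_tmul]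
  simp only [foxCorner, foxTail, sw_mul_left, sw_mul_right, map_sw, h, antipode_involutive _]
  have : ∀ a b : A, (sw K w fun c d => counit (R := K) d • Φ 1 (antipode K c * b) a) =
      Φ 1 (antipode K w * b) a := fun a b =>
    sw_counit_right (F := fun c => Φ 1 (antipode K c * b) a) (by fun_prop) w
  simp only [this]
  rw [sw_comm (F := fun b a => Φ 1 (antipode K w * b) a) (by fun_prop) (by fun_prop), ← hΦ]
  simp only [one_mul]

theorem cornerFun_foxStrip_tmul (Φ : A →ₗ[K] A →ₗ[K] A →ₗ[K] P) (f g h : A → A → A → A)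
    (x y z : A) :
    cornerFun Φ (foxStrip (inj1 K A) (inj2 K A) (inj3 K A)
      (fun x y z => f x y z ⊗ₜ[K] g x y z ⊗ₜ[K] h x y z) x y z) =
    sw K x fun x' x'' => sw K y fun y' y'' => sw K z fun z' z'' =>
      counit (R := K) z' • counit (R := K) (g (antipode K x'') (antipode K y'') (antipode K z'')) •
        Φ 1 (y' * f (antipode K x'') (antipode K y'') (antipode K z''))
          (antipode K (h (antipode K x'') (antipode K y'') (antipode K z'')) * antipode K x') := by
  simp only [foxStrip, sw_mul_left, map_sw]
  refine congrArg (sw K _) (funext₂ fun x' x'' => ?_)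
  refine congrArg (sw K _) (funext₂ fun y' y'' => ?_)
  refine congrArg (sw K _) (funext₂ fun z' z'' => ?_)
  simp [inj1_apply, inj2_apply, inj3_apply, cornerFun_tmul, mul_smul, antipode_mul_antidistrib]

end FoxConcrete

end RepAlg

namespace RepAlg

set_option linter.unusedSectionVars false

/-! ### The quasi-Poisson identity in trilinear form -/

section FoxIdentity

variable {K A P : Type*} [CommRing K] [Ring A] [HopfAlgebra K A] [AddCommGroup P] [Module K P]
  [IsCocomm K A]

section Generic

variable {T : Type*} [Ring T] [Algebra K T] (i₁ i₂ i₃ : A →ₐ[K] T) (g : T →ₗ[K] P)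

/-- A linear form evaluated on `foxStrip`. -/
noncomputable def stripEval (x y z : A) (F : A → A → A → T) : P :=
  g (foxStrip i₁ i₂ i₃ F x y z)

theorem stripEval_add (F G : A → A → A → T) (x y z : A) :
    stripEval i₁ i₂ i₃ g x y z (fun x y z => F x y z + G x y z) =
      stripEval i₁ i₂ i₃ g x y z F + stripEval i₁ i₂ i₃ g x y z G := by
  simp only [stripEval, foxStrip, mul_add, sw_add, map_add]

theorem stripEval_sub (F G : A → A → A → T) (x y z : A) :
    stripEval i₁ i₂ i₃ g x y z (fun x y z => F x y z - G x y z) =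
      stripEval i₁ i₂ i₃ g x y z F - stripEval i₁ i₂ i₃ g x y z G := by
  simp only [stripEval, foxStrip, mul_sub, sw_sub, map_sub]

theorem stripEval_tritensor_rhs (F₁ F₂ F₃ F₄ F₅ F₆ F₇ F₈ : A → A → A → T) (x y z : A) :
    stripEval i₁ i₂ i₃ g x y z (fun x y z =>
        F₁ x y z + F₂ x y z + F₃ x y z + F₄ x y z - F₅ x y z - F₆ x y z - F₇ x y z - F₈ x y z) =
      stripEval i₁ i₂ i₃ g x y z F₁ + stripEval i₁ i₂ i₃ g x y z F₂ +
      stripEval i₁ i₂ i₃ g x y z F₃ + stripEval i₁ i₂ i₃ g x y z F₄ -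
      stripEval i₁ i₂ i₃ g x y z F₅ - stripEval i₁ i₂ i₃ g x y z F₆ -
      stripEval i₁ i₂ i₃ g x y z F₇ - stripEval i₁ i₂ i₃ g x y z F₈ := by
  simp only [stripEval_add, stripEval_sub]

theorem stripEval_tritensor_lhs (F₁ F₂ F₃ : A → A → A → T) (x y z : A) :
    stripEval i₁ i₂ i₃ g x y z (fun x y z => F₁ x y z + F₂ x y z + F₃ x y z) =
      stripEval i₁ i₂ i₃ g x y z F₁ + stripEval i₁ i₂ i₃ g x y z F₂ +
      stripEval i₁ i₂ i₃ g x y z F₃ := by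
  simp only [stripEval_add]

variable {i₁ i₂ i₃}

theorem stripEval_perm (c13 : ∀ a b, Commute (i₁ a) (i₃ b))
    (c23 : ∀ a b, Commute (i₂ a) (i₃ b)) (p : T →ₐ[K] T) (h1 : ∀ a, p (i₁ a) = i₂ a)
    (h2 : ∀ a, p (i₂ a) = i₃ a) (h3 : ∀ a, p (i₃ a) = i₁ a) (F : A → A → A → T) (x y z : A) :
    stripEval i₁ i₂ i₃ g x y z (fun x y z => p (F y z x)) =
      stripEval i₁ i₂ i₃ (g ∘ₗ p.toLinearMap) y z x F :=
  (congrArg g (map_foxStrip c13 c23 p h1 h2 h3 F x y z)).symm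

theorem stripEval_perm_perm (c13 : ∀ a b, Commute (i₁ a) (i₃ b))
    (c23 : ∀ a b, Commute (i₂ a) (i₃ b)) (p : T →ₐ[K] T) (h1 : ∀ a, p (i₁ a) = i₂ a)
    (h2 : ∀ a, p (i₂ a) = i₃ a) (h3 : ∀ a, p (i₃ a) = i₁ a) (F : A → A → A → T) (x y z : A) :
    stripEval i₁ i₂ i₃ g x y z (fun x y z => p (p (F z x y))) =
      stripEval i₁ i₂ i₃ ((g ∘ₗ p.toLinearMap) ∘ₗ p.toLinearMap) z x y F :=
  (stripEval_perm g c13 c23 p h1 h2 h3 (fun x y z => p (F y z x)) x y z).trans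
    (stripEval_perm _ c13 c23 p h1 h2 h3 F y z x)

theorem stripEval_core (c12 : ∀ a b, Commute (i₁ a) (i₂ b)) (c13 : ∀ a b, Commute (i₁ a) (i₃ b))
    (c23 : ∀ a b, Commute (i₂ a) (i₃ b)) {ρ : A →ₗ[K] A →ₗ[K] A} (hρ : IsFoxPairing ρ)
    {F : A → A → A → T} (hF : ∀ x y z, F x y z = sw K z fun z' z'' => i₂ z' *
      sw K y fun y' y'' => i₁ y' * sw K x fun x' x'' => foxCore i₁ i₂ i₃ ρ z'' (ρ x'' y'') * i₁ x')
    {Φ : A → A → A → P} (hΦ : ∀ w p, g (foxCorner i₁ i₂ i₃ w p) =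
      Φ 1 (antipode K p) (antipode K w)) (x y z : A) :
    stripEval i₁ i₂ i₃ g x y z F = foxCyc Φ ρ x y z := by
  have hF' := funext₃ hF
  rw [hF', stripEval, hρ.foxStrip_eq c12 c13 c23, foxStripped, map_sub, map_sw, map_sw]
  simp only [hΦ]
  rfl

end Generic

theorem sw_mul_mul_antipode {Q : A → P} (hQ : Lin K Q) (c : A) (x : A) :
    (sw K x fun x' x'' => Q (c * x' * antipode K x'')) = counit (R := K) x • Q c := by
  have := lin_sw (K := K) (F := fun b c => b * antipode K c) (g := fun u => Q (c * u))
    (by fun_prop) x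
  rw [sw_mul_antipode_eq, mul_smul_comm, mul_one, hQ.smul] at this
  simpa only [mul_assoc] using this.symm

/-- The consequence of the quasi-Poisson property of `ρ` used in the proof of the Jacobi
identity. -/
theorem IsQuasiPoissonFox.foxCyc_add {ρ : A →ₗ[K] A →ₗ[K] A} (hρ : IsQuasiPoissonFox ρ)
    (Φ : A →ₗ[K] A →ₗ[K] A →ₗ[K] P)
    (hΦ : ∀ h b c, sw K h (fun h₁ h₂ => Φ 1 (b * h₁) (c * h₂)) = Φ (antipode K h) b c)
    (x y z : A) :
    foxCyc (fun a b c => Φ a b c) ρ x y z + foxCyc (fun a b c => Φ c a b) ρ y z x +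
      foxCyc (fun a b c => Φ b c a) ρ z x y =
    counit (R := K) x • Φ 1 y z + counit (R := K) y • Φ x 1 z + counit (R := K) z • Φ x y 1 +
      counit (R := K) x • counit (R := K) y • counit (R := K) z • Φ 1 1 1 -
      counit (R := K) x • counit (R := K) z • Φ 1 y 1 -
      counit (R := K) x • counit (R := K) y • Φ 1 1 z -
      counit (R := K) y • counit (R := K) z • Φ x 1 1 - Φ x y z := by
  -- The three cyclic copies of ϝ in T_ρ, each evaluated with Φ precomposed with the matching
  -- permutation.
  have e0 := stripEval_core (cornerFun Φ) commute_inj12 commute_inj13 commute_inj23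
    hρ.toIsFoxPairing (digamma_eq ρ) (Φ := fun a b c => Φ a b c) (cornerFun_foxCorner Φ) x y z
  have e1 := stripEval_core (cornerFun Φ ∘ₗ (permHom K A).toLinearMap) commute_inj12 commute_inj13
    commute_inj23 hρ.toIsFoxPairing (digamma_eq ρ) (Φ := fun a b c => Φ c a b)
    (cornerFun_perm_foxCorner Φ hΦ) y z x
  have e2 := stripEval_core ((cornerFun Φ ∘ₗ (permHom K A).toLinearMap) ∘ₗ
    (permHom K A).toLinearMap) commute_inj12 commute_inj13
    commute_inj23 hρ.toIsFoxPairing (digamma_eq ρ) (Φ := fun a b c => Φ b c a)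
    (cornerFun_perm_perm_foxCorner Φ hΦ) z x y
  rw [← e0, ← e1, ← e2]
  refine Eq.trans (congrArg₂ (· + ·) (congrArg₂ (· + ·) rfl
    (stripEval_perm (cornerFun Φ) commute_inj13 commute_inj23 (permHom K A) (fun _ => rfl)
      (fun _ => rfl) (fun _ => rfl) (digamma ρ) x y z).symm)
    (stripEval_perm_perm (cornerFun Φ) commute_inj13 commute_inj23 (permHom K A) (fun _ => rfl)
      (fun _ => rfl) (fun _ => rfl) (digamma ρ) x y z).symm) ?_
  refine (stripEval_tritensor_lhs _ _ _ _ _ _ _ _ _ _).symm.trans ?_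
  refine (congrArg (stripEval (inj1 K A) (inj2 K A) (inj3 K A) (cornerFun Φ) x y z)
    (funext₃ hρ.tritensor_eq)).trans ?_
  refine (stripEval_tritensor_rhs _ _ _ _ _ _ _ _ _ _ _ _ _ _ _).trans ?_
  -- Invariance of Φ at s(x): the form in which the leftover legs of x are absorbed into the first
  -- argument.
  have inv : ∀ (b c : A), sw K x (fun x' x'' => Φ 1 (b * antipode K x'') (c * antipode K x')) =
      Φ x b c := by
    intro b c
    have h := hΦ (antipode K x) b c
    rw [sw_anti (by fun_prop) (by fun_prop), antipode_involutive] at h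
    rw [← h]
    exact sw_comm (F := fun x' x'' => Φ 1 (b * antipode K x') (c * antipode K x''))
      (by fun_prop) (by fun_prop) x
  have cx : ∀ (F : A → P) (_ : Lin K F) (c : A),
      (sw K x fun x' x'' => F (c * x'' * antipode K x')) = counit (R := K) x • F c := by
    intro F hF c
    rw [← sw_mul_mul_antipode hF]
    exact sw_comm (F := fun x' x'' => F (c * x' * antipode K x'')) (by fun_prop) (by fun_prop) x
  have cy : ∀ (F : A → P) (_ : Lin K F),
      (sw K y fun x' x'' => F (x' * antipode K x'')) = counit (R := K) y • F 1 := by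
    intro F hF
    rw [← sw_mul_mul_antipode hF]
    simp only [one_mul]
  -- The prefactor z' sits in the middle slot, where the counit removes it; only the sums over x and
  -- y survive.
  have simpl : ∀ (f g h : A → A → A → A)
      (_ : ∀ X Y c d, Lin K fun z => counit (R := K) (g X Y z) •
        Φ 1 (c * f X Y z) (antipode K (h X Y z) * d)),
      stripEval (inj1 K A) (inj2 K A) (inj3 K A) (cornerFun Φ) x y z
        (fun x y z => f x y z ⊗ₜ[K] g x y z ⊗ₜ[K] h x y z) =
      sw K x fun x' x'' => sw K y fun y' y'' =>
        counit (R := K) (g (antipode K x'') (antipode K y'') (antipode K z)) •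
        Φ 1 (y' * f (antipode K x'') (antipode K y'') (antipode K z))
          (antipode K (h (antipode K x'') (antipode K y'') (antipode K z)) * antipode K x') := by
    intro f g h H
    refine (cornerFun_foxStrip_tmul Φ f g h x y z).trans ?_
    refine congrArg (sw K _) (funext₂ fun x' x'' => ?_)
    refine congrArg (sw K _) (funext₂ fun y' y'' => ?_)
    exact sw_counit_left ((H (antipode K x'') (antipode K y'') y' (antipode K x')).comp
      (Lin.coe (antipode K))) z
  -- `t1` to `t8` are the eight monomials on the right of the quasi-Poisson identity, in order; the
  -- first four enter with sign plus, the others with sign minus.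
  have t1 := simpl (fun _ _ _ => 1) (fun _ y _ => y) (fun x _ z => x * z) (by fun_prop)
  have t2 := simpl (fun x y _ => y * x) (fun _ _ _ => 1) (fun _ _ z => z)
    (by simp only [Bialgebra.counit_one]; fun_prop)
  have t3 := simpl (fun x _ _ => x) (fun _ y z => z * y) (fun _ _ _ => 1)
    (by simp only [Bialgebra.counit_mul]; fun_prop)
  have t4 := simpl (fun _ y _ => y) (fun _ _ z => z) (fun x _ _ => x) (by fun_prop)
  have t5 := simpl (fun _ _ _ => 1) (fun _ y z => z * y) (fun x _ _ => x)
    (by simp only [Bialgebra.counit_mul]; fun_prop)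
  have t6 := simpl (fun _ y _ => y) (fun _ _ _ => 1) (fun x _ z => x * z) (by fun_prop)
  have t7 := simpl (fun x y _ => y * x) (fun _ _ z => z) (fun _ _ _ => 1) (by fun_prop)
  have t8 := simpl (fun x _ _ => x) (fun _ y _ => y) (fun _ _ z => z) (by fun_prop)
  simp only [counit_antipode, antipode_mul_antidistrib, antipode_involutive _, mul_one,
    Bialgebra.counit_mul, Bialgebra.counit_one, one_smul, antipode_one, one_mul]
    at t1 t2 t3 t4 t5 t6 t7 t8
  have y1 : ∀ a b : A, (sw K y fun y' y'' => counit (R := K) y'' • Φ 1 (y' * a) b) =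
      Φ 1 (y * a) b := fun a b =>
    sw_counit_right (F := fun y => Φ 1 (y * a) b) (by fun_prop) y
  have y2 : ∀ b : A, (sw K y fun y' y'' => counit (R := K) y'' • Φ 1 y' b) =
      Φ 1 y b := fun b =>
    sw_counit_right (F := fun y => Φ 1 y b) (by fun_prop) y
  have y3 : ∀ a b : A, (sw K y fun y' y'' => Φ 1 (y' * (antipode K y'' * a)) b) =
      counit (R := K) y • Φ 1 a b := fun a b => by
    have := cy (fun u => Φ 1 (u * a) b) (by fun_prop)
    simpa only [mul_assoc, one_mul] using this
  have y4 : ∀ b : A, (sw K y fun y' y'' => Φ 1 (y' * antipode K y'') b) =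
      counit (R := K) y • Φ 1 1 b := fun b => cy (fun u => Φ 1 u b) (by fun_prop)
  have x1 : ∀ a c : A, (sw K x fun x' x'' => Φ 1 a (c * x'' * antipode K x')) =
      counit (R := K) x • Φ 1 a c := fun a c => cx (fun u => Φ 1 a u) (by fun_prop) c
  have x2 : ∀ a : A, (sw K x fun x' x'' => Φ 1 a (x'' * antipode K x')) =
      counit (R := K) x • Φ 1 a 1 := fun a => by simpa only [one_mul] using x1 a 1
  have x3 : ∀ c : A, (sw K x fun x' x'' => Φ 1 (antipode K x'') (c * antipode K x')) =
      Φ x 1 c := fun c => by simpa only [one_mul] using inv 1 c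
  have x4 : (sw K x fun x' x'' => Φ 1 (antipode K x'') (antipode K x')) = Φ x 1 1 := by
    simpa only [one_mul] using inv 1 1
  have x5 : (sw K x fun x' x'' => Φ 1 (y * antipode K x'') (antipode K x')) = Φ x y 1 := by
    simpa only [one_mul] using inv y 1
  simp only [mul_smul, ← sw_smul, y1, y2, y3, y4, x1, x2, x3, x4, x5, inv]
    at t1 t2 t3 t4 t5 t6 t7 t8
  refine (congrArg₂ (· - ·) (congrArg₂ (· - ·) (congrArg₂ (· - ·) (congrArg₂ (· - ·)
    (congrArg₂ (· + ·) (congrArg₂ (· + ·) (congrArg₂ (· + ·) t1 t2) t3) t4) t5) t6) t7) t8).trans ?_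
  module

end FoxIdentity

end RepAlg

namespace RepAlg

set_option linter.unusedSectionVars false

/-! ### The adjoint action -/

section Adjoint

variable {K A E : Type*} [CommRing K] [Ring A] [HopfAlgebra K A] [IsCocomm K A]
  [Ring E] [Algebra K E]

/-- `a ↦ (e ↦ e X(s(a)))`. -/
noncomputable def adRight (X : A →ₐ[K] E) : A →ₐ[K] Module.End K E :=
  AlgHom.ofLinearMap ((LinearMap.mul K E).flip ∘ₗ X.toLinearMap ∘ₗ antipode K)
    (by ext e; simp) (fun a b => by ext e; simp [antipode_mul_antidistrib, mul_assoc])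

/-- The adjoint action `Ad(a) e = X(a') e X(s(a''))`. -/
noncomputable def ad (X : A →ₐ[K] E) : A →ₐ[K] Module.End K E :=
  convHom ((Algebra.lmul K E).comp X) (adRight X) (fun a b => by
    refine LinearMap.ext fun e => ?_
    change X a * (e * X (antipode K b)) = X a * e * X (antipode K b)
    rw [mul_assoc])

theorem ad_apply (X : A →ₐ[K] E) (a : A) (e : E) :
    ad X a e = sw K a fun a' a'' => X a' * e * X (antipode K a'') := by
  have h := congrArg (fun f : WithConv (A →ₗ[K] Module.End K E) => f a) (hv_convHom
    ((Algebra.lmul K E).comp X) (adRight X) (fun a b => by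
      refine LinearMap.ext fun e => ?_
      change X a * (e * X (antipode K b)) = X a * e * X (antipode K b)
      rw [mul_assoc]))
  rw [conv_apply] at h
  refine (congrArg (fun f : Module.End K E => f e) h).trans ?_
  rw [lin_sw (g := fun f : Module.End K E => f e) ⟨fun _ _ => rfl, fun _ _ => rfl⟩]
  simp only [mul_assoc]
  rfl

@[fun_prop] theorem lin_ad_left {M : Type*} [AddCommGroup M] [Module K M] (X : A →ₐ[K] E)
    {f : M → A} (hf : Lin K f) (e : E) :
    Lin K fun m => ad X (f m) e :=
  ⟨fun x y => by rw [hf.add, map_add]; rfl, fun k x => by rw [hf.smul, map_smul]; rfl⟩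

@[fun_prop] theorem lin_ad_right {M : Type*} [AddCommGroup M] [Module K M] (X : A →ₐ[K] E) (a : A)
    {f : M → E} (hf : Lin K f) : Lin K fun m => ad X a (f m) :=
  ⟨fun x y => by rw [hf.add, map_add], fun k x => by rw [hf.smul, map_smul]⟩

/-- Cocommutativity exchanges the last two legs of a, so that X(a') and X(s(a''')) become adjacent
legs surrounding the value of F. -/
theorem conj_apply (X : A →ₐ[K] E) (F : WithConv (A →ₗ[K] E)) (a : A) :
    (hv X * F * hvInv X) a = sw K a fun a' a'' => ad X a' (F a'') := by
  have h1 : (hv X * F * hvInv X) a = sw K a fun e d => sw K e fun a b =>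
      X a * F b * X (antipode K d) := by
    simp only [conv_apply, sw_mul_right]
    rfl
  rw [h1, sw_swap (by fun_prop) (by fun_prop) (by fun_prop)]
  simp only [ad_apply]

theorem hv_cst_hvInv_apply (X : A →ₐ[K] E) (e : E) (a : A) :
    (hv X * cst e * hvInv X : WithConv (A →ₗ[K] E)) a = ad X a e := by
  rw [conj_apply]
  simp only [cst_apply, map_smul]
  exact sw_counit_right (F := fun a => ad X a e) (by fun_prop) a

/-- `a ↦ Ad(a) e`, in the convolution algebra. -/
noncomputable def adConv (X : A →ₐ[K] E) (e : E) : WithConv (A →ₗ[K] E) :=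
  hv X * cst e * hvInv X

theorem adConv_apply (X : A →ₐ[K] E) (e : E) (a : A) : adConv X e a = ad X a e :=
  hv_cst_hvInv_apply X e a

theorem ad_mul (X : A →ₐ[K] E) (a : A) (e f : E) :
    ad X a (e * f) = sw K a fun a' a'' => ad X a' e * ad X a'' f := by
  have h : adConv X (e * f) = adConv X e * adConv X f := by
    simp only [adConv, cst_mul, mul_assoc, hvInv_mul_hv_assoc]
  rw [← adConv_apply, h, conv_apply]
  simp only [adConv_apply]

theorem mul_eq_sw_ad (X : A →ₐ[K] E) (a : A) (e : E) :
    X a * e = sw K a fun a' a'' => ad X a' e * X a'' := by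
  have h : hv X * cst e = adConv X e * hv X := by
    simp only [adConv, mul_assoc, hvInv_mul_hv, mul_one]
  have : (hv X * cst e : WithConv (A →ₗ[K] E)) a = (adConv X e * hv X) a := by rw [h]
  rw [mul_cst_apply, conv_apply] at this
  simp only [adConv_apply] at this
  exact this

theorem ad_of_commute (X : A →ₐ[K] E) {e : E} (h : ∀ a, Commute (X a) e) (a : A) :
    ad X a e = counit (R := K) a • e := by
  have c : Commute (cst e) (hv X) := commute_cst fun a => (h a).symm
  rw [← adConv_apply, adConv, ← c.eq, mul_assoc, hv_mul_hvInv, mul_one, cst_apply]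

theorem ad_mul_of_commute_right (X : A →ₐ[K] E) (e : E) {f : E} (h : ∀ a, Commute (X a) f)
    (a : A) : ad X a (e * f) = ad X a e * f := by
  rw [ad_mul]
  simp only [ad_of_commute X h, mul_smul_comm]
  exact sw_counit_right (F := fun a => ad X a e * f) (by fun_prop) a

theorem ad_mul_of_commute_left (X : A →ₐ[K] E) {e : E} (f : E) (h : ∀ a, Commute (X a) e)
    (a : A) : ad X a (e * f) = e * ad X a f := by
  rw [ad_mul]
  simp only [ad_of_commute X h, smul_mul_assoc]
  exact sw_counit_left (F := fun a => e * ad X a f) (by fun_prop) a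

theorem commute_ad {X : A →ₐ[K] E} {e f : E} (hX : ∀ a, Commute (X a) f) (he : Commute e f)
    (a : A) : Commute (ad X a e) f := by
  rw [ad_apply, Commute, SemiconjBy, sw_mul_left, sw_mul_right]
  refine congrArg (sw K _) (funext₂ fun a' a'' => ?_)
  exact (((hX a').mul_left he).mul_left (hX _)).eq

theorem ad_ad_comm {X Y : A →ₐ[K] E} (h : ∀ a b, Commute (X a) (Y b)) (a b : A) (e : E) :
    ad X a (ad Y b e) = ad Y b (ad X a e) := by
  simp only [ad_apply, sw_mul_left, sw_mul_right]
  rw [sw_sw]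
  refine congrArg (sw K _) (funext₂ fun b' b'' => ?_)
  refine congrArg (sw K _) (funext₂ fun a' a'' => ?_)
  rw [mul_assoc (X a'), mul_assoc _ _ (X _), ← (h (antipode K a'') (antipode K b'')).eq]
  simp only [← mul_assoc]
  rw [(h a' b').eq]

theorem hvInv_convHom (X Y : A →ₐ[K] E) (h : ∀ a b, Commute (X a) (Y b)) :
    hvInv (convHom X Y h) = hvInv Y * hvInv X := by
  refine left_inv_eq_right_inv (hvInv_mul_hv _) ?_
  rw [hv_convHom, mul_assoc, hv_mul_hvInv_assoc, hv_mul_hvInv]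

theorem ad_convHom (X Y : A →ₐ[K] E) (h : ∀ a b, Commute (X a) (Y b)) (a : A) (e : E) :
    ad (convHom X Y h) a e = sw K a fun a' a'' => ad X a' (ad Y a'' e) := by
  have : adConv (convHom X Y h) e = hv X * adConv Y e * hvInv X := by
    simp only [adConv, hv_convHom, hvInv_convHom, mul_assoc]
  rw [← adConv_apply, this, conj_apply]
  simp only [adConv_apply]

theorem convHom_apply (X Y : A →ₐ[K] E) (h : ∀ a b, Commute (X a) (Y b)) (a : A) :
    convHom X Y h a = sw K a fun a' a'' => X a' * Y a'' := by
  rw [← hv_apply, hv_convHom, conv_apply]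
  rfl

/-- Convolution inversion for the action Ad: apply Ad(s(a')) to the hypothesis at a'' and cancel
s(b') b''. -/
theorem eq_ad_antipode {X : A →ₐ[K] E} {G : A → E} (hG : Lin K G) {e : E}
    (h : ∀ a, sw K a (fun a' a'' => ad X a' (G a'')) = counit (R := K) a • e) (a : A) :
    G a = ad X (antipode K a) e := by
  have h1 : sw K a (fun b c => ad X (antipode K b) (counit (R := K) c • e)) =
      ad X (antipode K a) e := by
    simp only [map_smul]
    exact sw_counit_right (F := fun a => ad X (antipode K a) e) (by fun_prop) a
  simp only [← h, lin_sw (g := fun e => ad X (antipode K _) e) (lin_ad_right X _ Lin.id)] at h1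
  rw [← h1, ← sw_assoc (F := fun b c d => ad X (antipode K b) (ad X c (G d))) (by fun_prop)
    (by fun_prop) (by fun_prop)]
  have h2 : ∀ c d : A, sw K c (fun a b => ad X (antipode K a) (ad X b (G d))) =
      counit (R := K) c • G d := by
    intro c d
    have := lin_sw (K := K) (F := fun b c => antipode K b * c) (g := fun u => ad X u (G d))
      (by fun_prop) c
    rw [sw_antipode_mul_eq, map_smul, map_one] at this
    refine Eq.trans ?_ this.symm
    refine congrArg (sw K _) (funext₂ fun a b => ?_)
    rw [map_mul]
    rfl
  simp only [h2]
  exact (sw_counit_left hG a).symm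

/-- Invariance of `e` under `X(a') Y(a'')` expresses the adjoint action of `Y` through that
of `X`. -/
theorem ad_eq_ad_antipode {X Y : A →ₐ[K] E} (hXY : ∀ a b, Commute (X a) (Y b)) {e : E}
    (h : ∀ a, Commute (sw K a fun a' a'' => X a' * Y a'') e) (a : A) :
    ad Y a e = ad X (antipode K a) e := by
  refine eq_ad_antipode (G := fun a => ad Y a e) (by fun_prop) (fun a => ?_) a
  rw [← ad_convHom X Y hXY]
  exact ad_of_commute _ (fun a => by rw [convHom_apply]; exact h a) a

end Adjoint

/-! ### Slots -/

section Slots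

variable {K A E : Type*} [CommRing K] [Ring A] [HopfAlgebra K A] [IsCocomm K A]
  [Ring E] [Algebra K E]

/-- Three commuting copies of `A` in an algebra `E`, and three invariant tensors. -/
structure IsSlotSystem (X₁ X₂ X₃ : A →ₐ[K] E) (Ω₁₂ Ω₂₃ Ω₃₁ : E) : Prop where
  c12 : ∀ a b, Commute (X₁ a) (X₂ b)
  c23 : ∀ a b, Commute (X₂ a) (X₃ b)
  c31 : ∀ a b, Commute (X₃ a) (X₁ b)
  o12 : ∀ a, Commute (X₃ a) Ω₁₂
  o23 : ∀ a, Commute (X₁ a) Ω₂₃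
  o31 : ∀ a, Commute (X₂ a) Ω₃₁
  i12 : ∀ a, Commute (sw K a fun a' a'' => X₁ a' * X₂ a'') Ω₁₂
  i23 : ∀ a, Commute (sw K a fun a' a'' => X₂ a' * X₃ a'') Ω₂₃
  i31 : ∀ a, Commute (sw K a fun a' a'' => X₃ a' * X₁ a'') Ω₃₁
  -- Together `f1` and `f2` are infinitesimal braid relations, such as [Ω₁₂, Ω₂₃ + Ω₃₁] = 0: the
  -- three cyclic commutators coincide.
  f1 : Ω₁₂ * Ω₂₃ - Ω₂₃ * Ω₁₂ = Ω₂₃ * Ω₃₁ - Ω₃₁ * Ω₂₃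
  f2 : Ω₁₂ * Ω₂₃ - Ω₂₃ * Ω₁₂ = Ω₃₁ * Ω₁₂ - Ω₁₂ * Ω₃₁

namespace IsSlotSystem

variable {X₁ X₂ X₃ : A →ₐ[K] E} {Ω₁₂ Ω₂₃ Ω₃₁ : E}

theorem rotate (h : IsSlotSystem X₁ X₂ X₃ Ω₁₂ Ω₂₃ Ω₃₁) : IsSlotSystem X₂ X₃ X₁ Ω₂₃ Ω₃₁ Ω₁₂ where
  c12 := h.c23
  c23 := h.c31
  c31 := h.c12
  o12 := h.o23
  o23 := h.o31
  o31 := h.o12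
  i12 := h.i23
  i23 := h.i31
  i31 := h.i12
  f1 := h.f1.symm.trans h.f2
  f2 := h.f1.symm

/-- Each conjugation passes over the tensor that does not involve its slot: X₁ commutes with X₃ and
Ω₂₃, and X₃ commutes with Ω₁₂. -/
theorem commutator_ad (h : IsSlotSystem X₁ X₂ X₃ Ω₁₂ Ω₂₃ Ω₃₁) (p q : A) :
    ad X₁ p Ω₁₂ * ad X₃ q Ω₂₃ - ad X₃ q Ω₂₃ * ad X₁ p Ω₁₂ =
      ad X₁ p (ad X₃ q (Ω₁₂ * Ω₂₃ - Ω₂₃ * Ω₁₂)) := by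
  have hc : ∀ a, Commute (X₁ a) (ad X₃ q Ω₂₃) := fun a =>
    (commute_ad (fun b => h.c31 b a) (h.o23 a).symm q).symm
  rw [map_sub, map_sub, ad_mul_of_commute_left X₃ Ω₂₃ h.o12,
    ad_mul_of_commute_right X₃ Ω₂₃ h.o12, ad_mul_of_commute_left X₁ _ hc,
    ad_mul_of_commute_right X₁ _ hc]

theorem c21 (h : IsSlotSystem X₁ X₂ X₃ Ω₁₂ Ω₂₃ Ω₃₁) (a b : A) : Commute (X₂ a) (X₁ b) :=
  (h.c12 b a).symm

theorem c32 (h : IsSlotSystem X₁ X₂ X₃ Ω₁₂ Ω₂₃ Ω₃₁) (a b : A) : Commute (X₃ a) (X₂ b) :=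
  (h.c23 b a).symm

theorem c13 (h : IsSlotSystem X₁ X₂ X₃ Ω₁₂ Ω₂₃ Ω₃₁) (a b : A) : Commute (X₁ a) (X₃ b) :=
  (h.c31 b a).symm

/-- The element `[Ω₁₂, Ω₂₃]`, conjugated in the three slots. -/
noncomputable def conj3 (X₁ X₂ X₃ : A →ₐ[K] E) (φ : E) : A →ₗ[K] A →ₗ[K] A →ₗ[K] E where
  toFun a := Lin.mk₂ (f := fun b c => ad X₁ a (ad X₂ b (ad X₃ c φ))) (by fun_prop) (by fun_prop)
  map_add' a b := by ext; simp
  map_smul' k a := by ext; simp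

theorem conj3_apply (X₁ X₂ X₃ : A →ₐ[K] E) (φ : E) (a b c : A) :
    conj3 X₁ X₂ X₃ φ a b c = ad X₁ a (ad X₂ b (ad X₃ c φ)) := rfl

/-- Grouped as X₁(X₂X₃) the total product commutes with Ω₂₃, and grouped as (X₁X₂)X₃ it commutes
with Ω₁₂. -/
theorem commute_total (h : IsSlotSystem X₁ X₂ X₃ Ω₁₂ Ω₂₃ Ω₃₁) (a : A) :
    Commute (sw K a fun a' a'' => X₁ a' * convHom X₂ X₃ h.c23 a'')
      (Ω₁₂ * Ω₂₃ - Ω₂₃ * Ω₁₂) := by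
  have e1 : (sw K a fun a' a'' => X₁ a' * convHom X₂ X₃ h.c23 a'') =
      (hv X₁ * (hv X₂ * hv X₃)) a := by
    rw [conv_apply]
    simp only [convHom_apply, conv_apply]
    rfl
  have c1 : Commute (sw K a fun a' a'' => X₁ a' * convHom X₂ X₃ h.c23 a'') Ω₂₃ := by
    rw [Commute, SemiconjBy, sw_mul_left, sw_mul_right]
    refine congrArg (sw K _) (funext₂ fun a' a'' => ?_)
    rw [convHom_apply]
    exact ((h.o23 a').mul_left (h.i23 a'')).eq
  have c2 : Commute (sw K a fun a' a'' => X₁ a' * convHom X₂ X₃ h.c23 a'') Ω₁₂ := by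
    rw [e1, ← mul_assoc, conv_apply, Commute, SemiconjBy, sw_mul_left, sw_mul_right]
    refine congrArg (sw K _) (funext₂ fun a' a'' => ?_)
    rw [conv_apply]
    exact ((h.i12 a').mul_left (h.o12 a'')).eq
  exact (c2.mul_right c1).sub_right (c1.mul_right c2)

/-- This is the invariance required of Φ in `foxCyc_add`. Since [Ω₁₂, Ω₂₃] commutes with the total
action, conjugating it jointly in slots 2 and 3 by a is conjugating it in slot 1 by s(a). -/
theorem conj3_invariant (h : IsSlotSystem X₁ X₂ X₃ Ω₁₂ Ω₂₃ Ω₃₁) (a b c : A) :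
    sw K a (fun a' a'' => conj3 X₁ X₂ X₃ (Ω₁₂ * Ω₂₃ - Ω₂₃ * Ω₁₂) 1 (b * a') (c * a'')) =
      conj3 X₁ X₂ X₃ (Ω₁₂ * Ω₂₃ - Ω₂₃ * Ω₁₂) (antipode K a) b c := by
  set φ := Ω₁₂ * Ω₂₃ - Ω₂₃ * Ω₁₂
  have hc : ∀ a b, Commute (X₁ a) (convHom X₂ X₃ h.c23 b) := fun a b => by
    rw [convHom_apply, Commute, SemiconjBy, sw_mul_left, sw_mul_right]
    refine congrArg (sw K _) (funext₂ fun a' a'' => ?_)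
    exact ((h.c12 a a').mul_right (h.c13 a a'')).eq
  have key := ad_eq_ad_antipode hc h.commute_total a
  rw [ad_convHom] at key
  simp only [conj3_apply, map_one, map_mul, Module.End.one_apply, Module.End.mul_apply]
  rw [ad_ad_comm h.c12, ad_ad_comm h.c13, ← key, lin_sw (g := fun e => ad X₂ b (ad X₃ c e))
    (by fun_prop)]
  refine congrArg (sw K _) (funext₂ fun a' a'' => ?_)
  rw [ad_ad_comm h.c23]

end IsSlotSystem

end Slots

end RepAlg

namespace RepAlg

set_option linter.unusedSectionVars false

/-! ### The pairing κ(x, y) = -ρ(x, s(y)) -/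

section Kap

variable {K A : Type*} [CommRing K] [Ring A] [HopfAlgebra K A]

/-- The pairing `-ρ(x, s(y))`. -/
noncomputable def kap (ρ : A →ₗ[K] A →ₗ[K] A) : A →ₗ[K] A →ₗ[K] A :=
  -(ρ.compl₂ (antipode K))

theorem kap_apply (ρ : A →ₗ[K] A →ₗ[K] A) (x y : A) : kap ρ x y = -ρ x (antipode K y) := rfl

variable [IsCocomm K A]

/-- Antisymmetry at (x, s(y)), where s² = id turns the transpose into s⁻¹ρ(y, s(x)). -/
theorem IsQuasiPoissonFox.antipode_kap {ρ : A →ₗ[K] A →ₗ[K] A} (hρ : IsQuasiPoissonFox ρ)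
    (x y : A) : antipode K (kap ρ x y) = -kap ρ y x := by
  have h := congr($(hρ.antisymm) x (antipode K y))
  rw [foxTranspose_apply, LinearEquiv.symm_apply_eq] at h
  change _ = antipode K (-ρ x (antipode K y)) at h
  rw [antipode_involutive] at h
  rw [kap_apply, kap_apply, neg_neg, ← h]

theorem IsFoxPairing.kap_mul_right {ρ : A →ₗ[K] A →ₗ[K] A} (hρ : IsFoxPairing ρ) (x y z : A) :
    kap ρ x (y * z) = kap ρ x z * antipode K y + counit (R := K) z • kap ρ x y := by
  simp only [kap_apply, antipode_mul_antidistrib, hρ.map_mul_right, counit_antipode]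
  simp only [neg_add, neg_mul, smul_neg]

end Kap

/-! ### Double brackets in a slot system -/

section Jacobi

variable {K A E : Type*} [CommRing K] [Ring A] [HopfAlgebra K A] [IsCocomm K A]
  [Ring E] [Algebra K E]

/-- The elementary bracket `Ad_X(κ(x, y)) Ω`. -/
noncomputable def vel (ρ : A →ₗ[K] A →ₗ[K] A) (X : A →ₐ[K] E) (Ω : E) (x y : A) : E :=
  ad X (kap ρ x y) Ω

@[fun_prop] theorem lin_vel_left {M : Type*} [AddCommGroup M] [Module K M]
    (ρ : A →ₗ[K] A →ₗ[K] A) (X : A →ₐ[K] E) (Ω : E) (y : A) {f : M → A} (hf : Lin K f) :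
    Lin K fun m => vel ρ X Ω (f m) y := by
  unfold vel; fun_prop

@[fun_prop] theorem lin_vel_right {M : Type*} [AddCommGroup M] [Module K M]
    (ρ : A →ₗ[K] A →ₗ[K] A) (X : A →ₐ[K] E) (Ω : E) (x : A) {f : M → A} (hf : Lin K f) :
    Lin K fun m => vel ρ X Ω x (f m) := by
  unfold vel; fun_prop

/-- The Leibniz rule is demanded only on a subalgebra S, because in the application it holds only
for functions that do not depend on the first variable. -/
theorem deriv_conv {C : Type*} [AddCommGroup C] [Module K C] [Coalgebra K C] (D : E →ₗ[K] E)
    (S : Subalgebra K E) (hD : ∀ f ∈ S, ∀ g ∈ S, D (f * g) = D f * g + f * D g)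
    {F G : WithConv (C →ₗ[K] E)} (hF : ∀ c, F c ∈ S) (hG : ∀ c, G c ∈ S) :
    (toConv (D ∘ₗ (F * G).ofConv) : WithConv (C →ₗ[K] E)) =
      toConv (D ∘ₗ F.ofConv) * G + F * toConv (D ∘ₗ G.ofConv) := by
  refine WithConv.ext (LinearMap.ext fun c => ?_)
  change D ((F * G) c) = (toConv (D ∘ₗ F.ofConv) * G : WithConv (C →ₗ[K] E)) c +
    (F * toConv (D ∘ₗ G.ofConv) : WithConv (C →ₗ[K] E)) c
  rw [conv_apply, conv_apply, conv_apply, map_sw, ← sw_add]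
  exact congrArg (sw K _) (funext₂ fun a b => hD _ (hF a) _ (hG b))

/-- On the convolution element X the derivation acts as left multiplication by v, hence on X⁻¹ as
right multiplication by -v. On X Ω X⁻¹ it is therefore the commutator with v. -/
theorem deriv_adConv (D : E →ₗ[K] E)
    (S : Subalgebra K E) (hD : ∀ f ∈ S, ∀ g ∈ S, D (f * g) = D f * g + f * D g)
    {X : A →ₐ[K] E} (hX : ∀ a, X a ∈ S) {Ω : E} (hΩ : Ω ∈ S) (hDΩ : D Ω = 0)
    {v : A → E} (hv' : Lin K v) (hDX : ∀ a, D (X a) = sw K a fun a' a'' => v a' * X a'') (r : A) :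
    D (ad X r Ω) = sw K r fun r' r'' => v r' * ad X r'' Ω - ad X r' Ω * v r'' := by
  let V : WithConv (A →ₗ[K] E) := toConv hv'.mk'
  have mF : ∀ a, hv X a ∈ S := hX
  have mG : ∀ a, hvInv X a ∈ S := fun a => hX _
  have mΩ : ∀ a : A, (cst Ω : WithConv (A →ₗ[K] E)) a ∈ S := fun a => S.smul_mem hΩ _
  have sw_mem : ∀ (a : A) (f : A → A → E), (∀ a b, f a b ∈ S) → sw K a f ∈ S := fun a f hf =>
    S.sum_mem fun i _ => hf _ _
  have mFΩ : ∀ a, (hv X * cst Ω : WithConv (A →ₗ[K] E)) a ∈ S := fun a => by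
    rw [conv_apply]
    exact sw_mem _ _ fun a b => S.mul_mem (mF a) (mΩ b)
  have dF : (toConv (D ∘ₗ (hv X).ofConv) : WithConv (A →ₗ[K] E)) = V * hv X := by
    refine WithConv.ext (LinearMap.ext fun c => ?_)
    refine (hDX c).trans (conv_apply V (hv X) c).symm
  have d1 : D 1 = 0 := by simpa using hD 1 S.one_mem 1 S.one_mem
  have dΩ : (toConv (D ∘ₗ (cst Ω : WithConv (A →ₗ[K] E)).ofConv) : WithConv (A →ₗ[K] E)) = 0 := by
    refine WithConv.ext (LinearMap.ext fun c => ?_)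
    change D (counit (R := K) c • Ω) = 0
    rw [map_smul, hDΩ, smul_zero]
  -- Differentiate X * X⁻¹ = 1.
  have dG : (toConv (D ∘ₗ (hvInv X).ofConv) : WithConv (A →ₗ[K] E)) = -(hvInv X * V) := by
    have h := deriv_conv D S hD mF mG
    rw [hv_mul_hvInv, dF, mul_assoc, hv_mul_hvInv, mul_one] at h
    have h0 : (toConv (D ∘ₗ (1 : WithConv (A →ₗ[K] E)).ofConv) : WithConv (A →ₗ[K] E)) = 0 := by
      refine WithConv.ext (LinearMap.ext fun c => ?_)
      change D (algebraMap K E (counit (R := K) c)) = 0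
      rw [Algebra.algebraMap_eq_smul_one, map_smul, d1, smul_zero]
    rw [h0] at h
    have h' := congrArg (hvInv X * ·) h
    simp only [mul_zero, mul_add, hvInv_mul_hv_assoc] at h'
    exact (neg_eq_of_add_eq_zero_right h'.symm).symm
  have key : (toConv (D ∘ₗ (adConv X Ω).ofConv) : WithConv (A →ₗ[K] E)) =
      V * adConv X Ω - adConv X Ω * V := by
    rw [adConv, deriv_conv D S hD mFΩ mG, deriv_conv D S hD mF mΩ, dF, dΩ, dG]
    simp only [mul_zero, add_zero, mul_neg, mul_assoc]
    abel
  have e := congrArg (fun f : WithConv (A →ₗ[K] E) => f r) key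
  rw [← adConv_apply]
  refine e.trans ?_
  rw [sw_sub]
  change (V * adConv X Ω : WithConv (A →ₗ[K] E)) r - (adConv X Ω * V : WithConv (A →ₗ[K] E)) r = _
  rw [conv_apply, conv_apply]
  simp only [adConv_apply]
  rfl

/-- The iterated bracket of generators, up to multiplication by generators. -/
noncomputable def jac (ρ : A →ₗ[K] A →ₗ[K] A) (X₁ X₂ X₃ : A →ₐ[K] E) (Ω₁₂ Ω₂₃ Ω₃₁ : E)
    (x y z : A) : E :=
  (sw K (kap ρ y z) fun r' r'' =>
      vel ρ X₁ Ω₁₂ x r' * ad X₂ r'' Ω₂₃ - ad X₂ r' Ω₂₃ * vel ρ X₁ Ω₁₂ x r'') +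
    (sw K y fun y' y'' => vel ρ X₂ Ω₂₃ y' z * vel ρ X₁ Ω₁₂ x y'') -
    sw K z fun z' z'' => vel ρ X₂ Ω₂₃ y z' * vel ρ X₃ Ω₃₁ z'' x

namespace IsSlotSystem

variable {X₁ X₂ X₃ : A →ₐ[K] E} {Ω₁₂ Ω₂₃ Ω₃₁ : E}

/-- There are three contributions: D of the conjugated tensor (by `deriv_adConv`), of X₂(y'') and of
X₃(z''). In each the factors X₂ and X₃ can be collected on the right, and what stands before them is
`jac`. -/
theorem deriv_bracket (h : IsSlotSystem X₁ X₂ X₃ Ω₁₂ Ω₂₃ Ω₃₁) (ρ : A →ₗ[K] A →ₗ[K] A) (x : A)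
    (D : E →ₗ[K] E) (S : Subalgebra K E) (hD : ∀ f ∈ S, ∀ g ∈ S, D (f * g) = D f * g + f * D g)
    (hS₂ : ∀ a, X₂ a ∈ S) (hS₃ : ∀ a, X₃ a ∈ S) (hΩ : Ω₂₃ ∈ S) (hDΩ : D Ω₂₃ = 0)
    (hD₂ : ∀ y, D (X₂ y) = sw K y fun y' y'' => vel ρ X₁ Ω₁₂ x y' * X₂ y'')
    (hD₃ : ∀ z, D (X₃ z) = -sw K z fun z' z'' => vel ρ X₃ Ω₃₁ z' x * X₃ z'') (y z : A) :
    D (sw K y fun y' y'' => sw K z fun z' z'' => vel ρ X₂ Ω₂₃ y' z' * X₂ y'' * X₃ z'') =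
      sw K y fun y' y'' => sw K z fun z' z'' =>
        jac ρ X₁ X₂ X₃ Ω₁₂ Ω₂₃ Ω₃₁ x y' z' * X₂ y'' * X₃ z'' := by
  have sw_mem : ∀ (a : A) (f : A → A → E), (∀ a b, f a b ∈ S) → sw K a f ∈ S := fun a f hf =>
    S.sum_mem fun i _ => hf _ _
  have mW : ∀ r, ad X₂ r Ω₂₃ ∈ S := fun r => by
    rw [ad_apply]
    exact sw_mem _ _ fun a b => S.mul_mem (S.mul_mem (hS₂ a) hΩ) (hS₂ _)
  have dW : ∀ y z, D (vel ρ X₂ Ω₂₃ y z) = _ := fun y z =>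
    deriv_adConv D S hD hS₂ hΩ hDΩ (lin_vel_right ρ X₁ Ω₁₂ x Lin.id) hD₂ (kap ρ y z)
  have c : ∀ a z, Commute (X₂ a) (vel ρ X₃ Ω₃₁ z x) := fun a z =>
    (commute_ad (fun b => h.c32 b a) (h.o31 a).symm _).symm
  -- In the last contribution the conjugate of Ω₃₁ is moved to the left of X₂(y''), with which it
  -- commutes.
  have step : ∀ y' y'' z' z'', D (vel ρ X₂ Ω₂₃ y' z' * X₂ y'' * X₃ z'') =
      D (vel ρ X₂ Ω₂₃ y' z') * X₂ y'' * X₃ z'' +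
        (sw K y'' fun a b => vel ρ X₂ Ω₂₃ y' z' * vel ρ X₁ Ω₁₂ x a * X₂ b * X₃ z'') -
        sw K z'' fun a b => vel ρ X₂ Ω₂₃ y' z' * vel ρ X₃ Ω₃₁ a x * X₂ y'' * X₃ b := by
    intro y' y'' z' z''
    rw [hD (vel ρ X₂ Ω₂₃ y' z' * X₂ y'') (S.mul_mem (mW _) (hS₂ _)) _ (hS₃ _),
      hD (vel ρ X₂ Ω₂₃ y' z') (mW _) _ (hS₂ _), hD₂, hD₃, add_mul,
      mul_neg, sw_mul_left, sw_mul_left, sw_mul_right, sub_eq_add_neg]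
    congr 1
    · congr 1
      simp only [mul_assoc]
    · refine congrArg Neg.neg (congrArg (sw K _) (funext₂ fun a b => ?_))
      rw [mul_assoc _ (X₂ y''), ← mul_assoc (X₂ y''), (c y'' a).eq]
      simp only [mul_assoc]
  simp only [map_sw, step, jac, add_mul, sub_mul, sw_mul_right, sw_add, sw_sub]
  congr 1
  · congr 1
    · simp only [dW, sw_sub, sub_mul, sw_mul_right]
    · have e2 : ∀ y' y'', (sw K z fun z' z'' => sw K y'' fun a b =>
          vel ρ X₂ Ω₂₃ y' z' * vel ρ X₁ Ω₁₂ x a * X₂ b * X₃ z'') = sw K y'' fun a b =>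
          sw K z fun z' z'' => vel ρ X₂ Ω₂₃ y' z' * vel ρ X₁ Ω₁₂ x a * X₂ b * X₃ z'' :=
        fun y' y'' => sw_sw _ _ _
      have e3 : ∀ y' y'', (sw K z fun z' z'' => sw K y' fun a b =>
          vel ρ X₂ Ω₂₃ a z' * vel ρ X₁ Ω₁₂ x b * X₂ y'' * X₃ z'') = sw K y' fun a b =>
          sw K z fun z' z'' => vel ρ X₂ Ω₂₃ a z' * vel ρ X₁ Ω₁₂ x b * X₂ y'' * X₃ z'' :=
        fun y' y'' => sw_sw _ _ _
      simp only [e2, e3]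
      exact (sw_assoc (F := fun a b d => sw K z fun z' z'' =>
        vel ρ X₂ Ω₂₃ a z' * vel ρ X₁ Ω₁₂ x b * X₂ d * X₃ z'') (by fun_prop) (by fun_prop)
        (by fun_prop) y).symm
  · refine congrArg (sw K _) (funext₂ fun y' y'' => ?_)
    exact (sw_assoc (F := fun a b d => vel ρ X₂ Ω₂₃ y' a * vel ρ X₃ Ω₃₁ b x * X₂ y'' * X₃ d)
      (by fun_prop) (by fun_prop) (by fun_prop) z).symm

theorem ad_two_eq (h : IsSlotSystem X₁ X₂ X₃ Ω₁₂ Ω₂₃ Ω₃₁) (a : A) :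
    ad X₂ (antipode K a) Ω₁₂ = ad X₁ a Ω₁₂ := by
  rw [ad_eq_ad_antipode h.c12 h.i12, antipode_involutive]

/-- The tensors Ω₃₁ and Ω₁₂ share slot 1. Moving the conjugation of Ω₁₂ from slot 1 to slot 2 makes
the two conjugations act in the two slots that are not shared, and `commutator_ad` applies. -/
theorem vel_commutator (h : IsSlotSystem X₁ X₂ X₃ Ω₁₂ Ω₂₃ Ω₃₁) (p q : A) :
    ad X₃ q Ω₃₁ * ad X₁ p Ω₁₂ - ad X₁ p Ω₁₂ * ad X₃ q Ω₃₁ =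
      conj3 X₁ X₂ X₃ (Ω₁₂ * Ω₂₃ - Ω₂₃ * Ω₁₂) 1 (antipode K p) q := by
  rw [← h.ad_two_eq, h.rotate.rotate.commutator_ad, conj3_apply, map_one, ad_ad_comm h.c32, ← h.f2]
  rfl

/-- The left side collects the terms with Ω₃₁ and Ω₁₂ in the cyclic sum of `jac`: the first two sums
come from the summand of (z, x, y), the third from that of (y, z, x). By cocommutativity they pair
into commutators, which `vel_commutator` evaluates. -/
theorem cyc_eq (h : IsSlotSystem X₁ X₂ X₃ Ω₁₂ Ω₂₃ Ω₃₁) {ρ : A →ₗ[K] A →ₗ[K] A}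
    (hρ : IsQuasiPoissonFox ρ) (x y z : A) :
    (sw K (kap ρ x y) fun r' r'' =>
        vel ρ X₃ Ω₃₁ z r' * ad X₁ r'' Ω₁₂ - ad X₁ r' Ω₁₂ * vel ρ X₃ Ω₃₁ z r'') +
      (sw K x fun x' x'' => vel ρ X₁ Ω₁₂ x' y * vel ρ X₃ Ω₃₁ z x'') -
      (sw K x fun x' x'' => vel ρ X₃ Ω₃₁ z x' * vel ρ X₁ Ω₁₂ x'' y) =
    foxCyc (fun a b c => conj3 X₁ X₂ X₃ (Ω₁₂ * Ω₂₃ - Ω₂₃ * Ω₁₂) a b c) ρ x y z := by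
  set Φ := conj3 X₁ X₂ X₃ (Ω₁₂ * Ω₂₃ - Ω₂₃ * Ω₁₂)
  have comm1 : ∀ q p, vel ρ X₃ Ω₃₁ z q * ad X₁ p Ω₁₂ - ad X₁ p Ω₁₂ * vel ρ X₃ Ω₃₁ z q =
      Φ 1 (antipode K p) (kap ρ z q) := fun q p => h.vel_commutator p _
  have e1 : (sw K (kap ρ x y) fun r' r'' =>
      vel ρ X₃ Ω₃₁ z r' * ad X₁ r'' Ω₁₂ - ad X₁ r' Ω₁₂ * vel ρ X₃ Ω₃₁ z r'') =
      sw K (kap ρ x y) fun r' r'' => Φ 1 (antipode K r') (kap ρ z r'') := by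
    simp only [← comm1, sw_sub]
    rw [← sw_comm (F := fun r' r'' => vel ρ X₃ Ω₃₁ z r' * ad X₁ r'' Ω₁₂) (by fun_prop)
      (by fun_prop)]
  have e2 : (sw K x fun x' x'' => vel ρ X₁ Ω₁₂ x' y * vel ρ X₃ Ω₃₁ z x'') -
      (sw K x fun x' x'' => vel ρ X₃ Ω₃₁ z x' * vel ρ X₁ Ω₁₂ x'' y) =
      -sw K x fun x' x'' => Φ 1 (antipode K (kap ρ x'' y)) (kap ρ z x') := by
    rw [← sw_comm (F := fun x' x'' => vel ρ X₁ Ω₁₂ x' y * vel ρ X₃ Ω₃₁ z x'') (by fun_prop)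
      (by fun_prop), ← sw_sub, ← sw_neg]
    refine congrArg (sw K _) (funext₂ fun x' x'' => ?_)
    rw [← comm1, neg_sub]
    rfl
  have e3 : ∀ p q, antipode K (ρ p (antipode K q)) = kap ρ q p := fun p q => by
    rw [← neg_neg (ρ p _), ← kap_apply, map_neg, hρ.antipode_kap, neg_neg]
  rw [add_sub_assoc, e1, e2, foxCyc]
  simp only [e3]
  have l : Lin K fun u => sw K u fun r' r'' => Φ 1 (antipode K r') (kap ρ z r'') := by
    fun_prop
  rw [kap_apply ρ x y, l.map_neg]
  simp only [hρ.antipode_kap, map_neg, LinearMap.neg_apply, sw_neg]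
  abel

/-- The Jacobi sum of three generators in distinct slots. -/
theorem jac_cyclic (h : IsSlotSystem X₁ X₂ X₃ Ω₁₂ Ω₂₃ Ω₃₁) {ρ : A →ₗ[K] A →ₗ[K] A}
    (hρ : IsQuasiPoissonFox ρ) (x y z : A) {Φ : A →ₗ[K] A →ₗ[K] A →ₗ[K] E}
    (hΦ : Φ = conj3 X₁ X₂ X₃ (Ω₁₂ * Ω₂₃ - Ω₂₃ * Ω₁₂)) :
    jac ρ X₁ X₂ X₃ Ω₁₂ Ω₂₃ Ω₃₁ x y z + jac ρ X₂ X₃ X₁ Ω₂₃ Ω₃₁ Ω₁₂ y z x +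
      jac ρ X₃ X₁ X₂ Ω₃₁ Ω₁₂ Ω₂₃ z x y =
    counit (R := K) x • Φ 1 y z + counit (R := K) y • Φ x 1 z + counit (R := K) z • Φ x y 1 +
      counit (R := K) x • counit (R := K) y • counit (R := K) z • Φ 1 1 1 -
      counit (R := K) x • counit (R := K) z • Φ 1 y 1 -
      counit (R := K) x • counit (R := K) y • Φ 1 1 z -
      counit (R := K) y • counit (R := K) z • Φ x 1 1 - Φ x y z := by
  -- Since the three commutators coincide, the rotated slot systems give the same Φ with its
  -- arguments permuted.
  have r1 : (fun a b c => conj3 X₂ X₃ X₁ (Ω₂₃ * Ω₃₁ - Ω₃₁ * Ω₂₃) a b c) =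
      fun a b c => Φ c a b := by
    funext a b c
    rw [hΦ, conj3_apply, conj3_apply, ← h.f1, ad_ad_comm h.c31, ad_ad_comm h.c21]
  have r2 : (fun a b c => conj3 X₃ X₁ X₂ (Ω₃₁ * Ω₁₂ - Ω₁₂ * Ω₃₁) a b c) =
      fun a b c => Φ b c a := by
    funext a b c
    rw [hΦ, conj3_apply, conj3_apply, ← h.f2, ad_ad_comm h.c31, ad_ad_comm h.c32]
  have t0 := h.cyc_eq hρ x y z
  have t1 := h.rotate.cyc_eq hρ y z x
  have t2 := h.rotate.rotate.cyc_eq hρ z x y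
  rw [r1] at t1
  rw [r2] at t2
  rw [← hΦ] at t0
  rw [← hρ.foxCyc_add Φ (fun a b c => by rw [hΦ]; exact h.conj3_invariant a b c), ← t0, ← t1, ← t2]
  simp only [jac]
  abel

end IsSlotSystem

end Jacobi

end RepAlg

namespace RepAlg

set_option linter.unusedSectionVars false

/-! ### Derivations along the counit -/

section CounitDerivation

variable {K B M : Type*} [CommRing K] [CommRing B] [HopfAlgebra K B] [AddCommGroup M] [Module K M]

/-- Module-valued derivations along the counit. -/
structure IsCounitDer (K : Type*) {B M : Type*} [CommRing K] [CommRing B] [HopfAlgebra K B]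
    [AddCommGroup M] [Module K M] (μ : B → M) : Prop where
  lin : Lin K μ
  map_mul : ∀ b c, μ (b * c) = counit (R := K) b • μ c + counit (R := K) c • μ b

namespace IsCounitDer

theorem map_one {μ : B → M} (h : IsCounitDer K μ) : μ 1 = 0 := by
  simpa using h.map_mul 1 1

theorem map_eq_zero {μ : B → M} (h : IsCounitDer K μ) {b : B} (hb : b ∈ augIdeal K B ^ 2) :
    μ b = 0 := by
  rw [pow_two] at hb
  induction hb using Submodule.mul_induction_on' with
  | mem_mul_mem b hb c hc =>
    have h1 : counit (R := K) b = 0 := hb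
    have h2 : counit (R := K) c = 0 := hc
    rw [h.map_mul, h1, h2, zero_smul, zero_smul, add_zero]
  | add b _ c _ hb hc => rw [h.lin.add, hb, hc, add_zero]

/-- Such a map vanishes on 1 and on I², hence depends only on p(b). -/
theorem congr {μ : B → M} (h : IsCounitDer K μ) {b c : B} (hbc : augProj K b = augProj K c) :
    μ b = μ c := by
  have h1 : augProj K (b - c) = 0 := by rw [map_sub, hbc, sub_self]
  have h2 := h.map_eq_zero ((Ideal.toCotangent_eq_zero _ _).1 h1)
  rw [h.lin.map_sub, Algebra.algebraMap_eq_smul_one, h.lin.smul, h.map_one, smul_zero, sub_zero,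
    h.lin.map_sub, sub_eq_zero] at h2
  exact h2

theorem map_antipode {μ : B → M} (h : IsCounitDer K μ) (b : B) : μ (antipode K b) = -μ b := by
  have h1 : μ (sw K b fun b' b'' => antipode K b' * b'') = 0 := by
    rw [sw_antipode_mul_eq, h.lin.smul, h.map_one, smul_zero]
  rw [lin_sw h.lin] at h1
  simp only [h.map_mul, counit_antipode, sw_add] at h1
  rw [sw_counit_left h.lin, sw_counit_right (h.lin.comp (Lin.coe _))] at h1
  exact (neg_eq_of_add_eq_zero_right h1).symm

end IsCounitDer

end CounitDerivation

/-! ### The bilinear form of a trace-like element -/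

section Form

variable {K B M P : Type*} [CommRing K] [CommRing B] [HopfAlgebra K B] [AddCommGroup M] [Module K M]
  [AddCommGroup P] [Module K P]

namespace IsTraceLike

variable {t : B}

theorem isCounitDer_form (ht : IsTraceLike K t) (b : B) : IsCounitDer K fun c => ht.form b c :=
  ⟨Lin.coe _, fun c d => ((LinearEquiv.ofBijective (infMap K t) ht.nonsingular).symm
    (augProj K b)).2 c d⟩

theorem augProj_form (ht : IsTraceLike K t) (b : B) : augProj K (sw K t fun t' t'' => ht.form b t' • t'') =
    augProj K b := by
  rw [map_sw]
  simp only [map_smul]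
  exact (LinearEquiv.ofBijective (infMap K t) ht.nonsingular).apply_symm_apply (augProj K b)

/-- The reproducing formula: p(b) = (b • t') p(t'') by the definition of •, and μ factors through p.
Symmetry, invariance and the commutator formula for • all rest on it. -/
theorem eq_sw_form (ht : IsTraceLike K t) {μ : B → M} (h : IsCounitDer K μ) (b : B) :
    μ b = sw K t fun t' t'' => ht.form b t' • μ t'' := by
  rw [← h.congr (ht.augProj_form b), lin_sw h.lin]
  simp only [h.lin.smul]

theorem sw_flip (ht : IsTraceLike K t) {F : B → B → P} (h₁ : ∀ b, Lin K fun a => F a b) (h₂ : ∀ a, Lin K (F a)) :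
    sw K t (fun t' t'' => F t'' t') = sw K t F := by
  refine (sweedler_eq_lift (comul t) (Lin.mk₂ h₁ h₂).flip).trans
    (Eq.trans ?_ (sweedler_eq_lift (comul t) (Lin.mk₂ h₁ h₂)).symm)
  conv_rhs => rw [← ht.cosymmetric]
  generalize comul (R := K) t = z
  induction z with
  | zero => simp
  | tmul a b => simp
  | add p q hp hq => simp only [map_add, hp, hq]

/-- By the reproducing formula the two sides are (c • t')(b • t'') and (b • t')(c • t''), which
agree by cosymmetry. -/
theorem form_comm (ht : IsTraceLike K t) (b c : B) : ht.form b c = ht.form c b := by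
  rw [ht.eq_sw_form (ht.isCounitDer_form b) c, ht.eq_sw_form (ht.isCounitDer_form c) b,
    ← ht.sw_flip (by fun_prop) (by fun_prop)]
  simp only [smul_eq_mul, mul_comm]

theorem isCounitDer_form' (ht : IsTraceLike K t) (c : B) : IsCounitDer K fun b => ht.form b c := by
  simp only [ht.form_comm _ c]
  exact ht.isCounitDer_form c

/-- By coassociativity, cosymmetry of t makes its iterated comultiplications cyclically symmetric.
-/
theorem sw3_rotate (ht : IsTraceLike K t) {F : B → B → B → P} (h₁ : ∀ b c, Lin K fun a => F a b c)
    (h₂ : ∀ a c, Lin K fun b => F a b c) (h₃ : ∀ a b, Lin K fun c => F a b c) :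
    sw3 K t (fun a b c => F b c a) = sw3 K t F := by
  unfold sw3
  refine Eq.trans ?_ (sw_assoc h₁ h₂ h₃ t)
  exact (ht.sw_flip (F := fun d a => sw K d fun b c => F b c a) (by fun_prop) (by fun_prop))

/-- The trilinear form `(b • t') (c • t'') (d • t''')`. -/
noncomputable def form3 (ht : IsTraceLike K t) (b c d : B) : K :=
  sw3 K t fun t₁ t₂ t₃ => ht.form b t₁ * ht.form c t₂ * ht.form d t₃

theorem form3_rotate (ht : IsTraceLike K t) (b c d : B) : ht.form3 b c d = ht.form3 c d b := by
  rw [form3, form3, ← ht.sw3_rotate (F := fun t₁ t₂ t₃ => ht.form c t₁ * ht.form d t₂ *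
    ht.form b t₃) (by fun_prop) (by fun_prop) (by fun_prop)]
  refine congrArg (sw3 K t) (funext₃ fun t₁ t₂ t₃ => ?_)
  ring

/-- This is the Lie bracket on 𝔤: in the expansion of the commutator at bc, the mixed products
μ(c)ν(b) and μ(b)ν(c) cancel. -/
theorem isCounitDer_commutator {μ ν : B → K} (hμ : IsCounitDer K μ) (hν : IsCounitDer K ν) :
    IsCounitDer K fun b => sw K b fun b' b'' => μ b' * ν b'' - μ b'' * ν b' := by
  have lμ := hμ.lin
  have lν := hν.lin
  refine ⟨by fun_prop, fun b c => ?_⟩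
  have key : ∀ F : B → B → K, (∀ b, Lin K fun a => F a b) → (∀ a, Lin K (F a)) →
      sw K (b * c) F = sw K b fun b' b'' => sw K c fun c' c'' => F (b' * c') (b'' * c'') :=
    fun F h₁ h₂ => sw_prod h₁ h₂ b c
  rw [key _ (by fun_prop) (by fun_prop)]
  have e : ∀ b' b'' c' c'' : B, μ (b' * c') * ν (b'' * c'') - μ (b'' * c'') * ν (b' * c') =
      counit (R := K) b' • (counit (R := K) b'' • (μ c' * ν c'' - μ c'' * ν c')) +
      counit (R := K) b' • (counit (R := K) c'' • (μ c' * ν b'')) -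
      counit (R := K) b'' • (counit (R := K) c' • (μ c'' * ν b')) +
      (counit (R := K) c' • (counit (R := K) b'' • (μ b' * ν c'')) -
      counit (R := K) c'' • (counit (R := K) b' • (μ b'' * ν c'))) +
      counit (R := K) c' • (counit (R := K) c'' • (μ b' * ν b'' - μ b'' * ν b')) := by
    intro b' b'' c' c''
    simp only [hμ.map_mul, hν.map_mul, smul_eq_mul]
    ring
  have t1 : sw K b (fun b' b'' => sw K c fun c' c'' => counit (R := K) b' •
      counit (R := K) b'' • (μ c' * ν c'' - μ c'' * ν c')) = counit (R := K) b •
      sw K c fun c' c'' => μ c' * ν c'' - μ c'' * ν c' := by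
    simp only [← sw_smul]
    exact sw_counit_left (F := fun b => counit (R := K) b • sw K c fun c' c'' =>
      μ c' * ν c'' - μ c'' * ν c') (by fun_prop) b
  have t2 : sw K b (fun b' b'' => sw K c fun c' c'' => counit (R := K) b' •
      counit (R := K) c'' • (μ c' * ν b'')) = μ c * ν b := by
    have q : ∀ b, sw K c (fun c' c'' => counit (R := K) c'' • (μ c' * ν b)) = μ c * ν b :=
      fun b => sw_counit_right (F := fun c => μ c * ν b) (by fun_prop) c
    simp only [← sw_smul, q]
    exact sw_counit_left (F := fun b => μ c * ν b) (by fun_prop) b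
  have t3 : sw K b (fun b' b'' => sw K c fun c' c'' => counit (R := K) b'' •
      counit (R := K) c' • (μ c'' * ν b')) = μ c * ν b := by
    have q : ∀ b, sw K c (fun c' c'' => counit (R := K) c' • (μ c'' * ν b)) = μ c * ν b :=
      fun b => sw_counit_left (F := fun c => μ c * ν b) (by fun_prop) c
    simp only [← sw_smul, q]
    exact sw_counit_right (F := fun b => μ c * ν b) (by fun_prop) b
  have t4 : sw K b (fun b' b'' => sw K c fun c' c'' => counit (R := K) c' •
      counit (R := K) b'' • (μ b' * ν c'')) = μ b * ν c := by
    have q : ∀ b' b'' : B, sw K c (fun c' c'' => counit (R := K) c' • counit (R := K) b'' •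
        (μ b' * ν c'')) = counit (R := K) b'' • (μ b' * ν c) := fun b' b'' =>
      sw_counit_left (F := fun c => counit (R := K) b'' • (μ b' * ν c))
        ((lν.const_mul _).const_smul _) c
    simp only [q]
    exact sw_counit_right (F := fun b => μ b * ν c) (by fun_prop) b
  have t5 : sw K b (fun b' b'' => sw K c fun c' c'' => counit (R := K) c'' •
      counit (R := K) b' • (μ b'' * ν c')) = μ b * ν c := by
    have q : ∀ b' b'' : B, sw K c (fun c' c'' => counit (R := K) c'' • counit (R := K) b' •
        (μ b'' * ν c')) = counit (R := K) b' • (μ b'' * ν c) := fun b' b'' =>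
      sw_counit_right (F := fun c => counit (R := K) b' • (μ b'' * ν c))
        ((lν.const_mul _).const_smul _) c
    simp only [q]
    exact sw_counit_left (F := fun b => μ b * ν c) (by fun_prop) b
  have t6 : sw K b (fun b' b'' => sw K c fun c' c'' => counit (R := K) c' •
      counit (R := K) c'' • (μ b' * ν b'' - μ b'' * ν b')) = counit (R := K) c •
      sw K b fun b' b'' => μ b' * ν b'' - μ b'' * ν b' := by
    have q : ∀ k : K, sw K c (fun c' c'' => counit (R := K) c' • counit (R := K) c'' • k) =
        counit (R := K) c • k := fun k =>
      sw_counit_left (F := fun c => counit (R := K) c • k) (by fun_prop) c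
    simp only [q, sw_smul]
  rw [← t1, ← t6]
  simp only [e, sw_add, sw_sub, t2, t3, t4, t5]
  ring

/-- The commutator of two derivations given by the form. -/
theorem sw_form_sub (ht : IsTraceLike K t) (b c d : B) :
    sw K c (fun c' c'' => ht.form b c' * ht.form d c'' - ht.form b c'' * ht.form d c') =
      ht.form3 c b d - ht.form3 c d b := by
  rw [ht.eq_sw_form (isCounitDer_commutator (ht.isCounitDer_form b) (ht.isCounitDer_form d)) c,
    form3, form3, sw3, sw3, ← sw_sub]
  refine congrArg (sw K t) (funext₂ fun t₁ e => ?_)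
  rw [← sw_sub, sw_smul]
  refine congrArg (sw K e) (funext₂ fun t₂ t₃ => ?_)
  simp only [smul_eq_mul]
  ring

theorem sw4_rotate (ht : IsTraceLike K t) {F : B → B → B → B → P}
    (h₁ : ∀ b c d, Lin K fun a => F a b c d) (h₂ : ∀ a c d, Lin K fun b => F a b c d)
    (h₃ : ∀ a b d, Lin K fun c => F a b c d) (h₄ : ∀ a b c, Lin K fun d => F a b c d) :
    sw4 K t (fun a b c d => F b c d a) = sw4 K t F := by
  unfold sw4 sw3
  refine (ht.sw_flip (F := fun e a => sw K e fun b f => sw K f fun c d => F b c d a) (by fun_prop)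
    (by fun_prop)).trans ?_
  rw [sw_assoc (F := fun b f a => sw K f fun c d => F b c d a) (by fun_prop) (by fun_prop)
    (by fun_prop)]
  refine congrArg (sw K t) (funext₂ fun b e => ?_)
  exact sw_assoc (h₂ b) (h₃ b) (h₄ b) e

/-- `b ↦ f(b') μ(b'') g(b''')`, with values in `B`. -/
noncomputable def conjDer (f g : WithConv (B →ₗ[K] B)) {μ : B → K} (hμ : Lin K μ) :
    WithConv (B →ₗ[K] B) :=
  f * (toConv (Algebra.linearMap K B ∘ₗ hμ.mk') * g)

theorem conjDer_apply (f g : WithConv (B →ₗ[K] B)) {μ : B → K} (hμ : Lin K μ) (b : B) :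
    conjDer f g hμ b = sw3 K b fun b₁ b₂ b₃ => μ b₂ • (f b₁ * g b₃) := by
  rw [conjDer, conv_apply]
  refine congrArg (sw K b) (funext₂ fun b₁ d => ?_)
  rw [conv_apply, sw_mul_left]
  refine congrArg (sw K d) (funext₂ fun b₂ b₃ => ?_)
  change f b₁ * (algebraMap K B (μ b₂) * g b₃) = _
  rw [Algebra.algebraMap_eq_smul_one, smul_mul_assoc, one_mul, mul_smul_comm]

/-- In each term of the product rule one factor has μ replaced by ε, and there the conjugation
collapses to the counit because f * g = 1. Commutativity of B separates the two factors. -/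
theorem isCounitDer_conjDer {f g : WithConv (B →ₗ[K] B)} (hf : ∀ a b, f (a * b) = f a * f b)
    (hg : ∀ a b, g (a * b) = g a * g b) (hfg : f * g = 1) {μ : B → K} (hμ : IsCounitDer K μ) :
    IsCounitDer K fun b => conjDer f g hμ.lin b := by
  refine ⟨Lin.coe _, fun b c => ?_⟩
  have hl := hμ.lin
  have lf : Lin K fun b => f b := Lin.coe f.ofConv
  have lg : Lin K fun b => g b := Lin.coe g.ofConv
  have key : ∀ P Q : B → B → B → B, (sw K b fun b₁ b' => sw K c fun c₁ c' =>
      sw K b' fun b₂ b₃ => sw K c' fun c₂ c₃ => P b₁ b₂ b₃ * Q c₁ c₂ c₃) =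
      sw3 K b P * sw3 K c Q := fun P Q => by
    simp only [← sw_mul_left, ← sw_mul_right]
    rfl
  have hfg' : ∀ b, (sw3 K b fun b₁ b₂ b₃ => counit (R := K) b₂ • (f b₁ * g b₃)) =
      counit (R := K) b • (1 : B) := fun b => by
    have := congrArg (fun u : WithConv (B →ₗ[K] B) => u b) hfg
    rw [conv_apply] at this
    refine Eq.trans ?_ (this.trans (Algebra.algebraMap_eq_smul_one _))
    refine congrArg (sw K b) (funext₂ fun b₁ d => ?_)
    exact sw_counit_left (lg.const_mul _) d
  simp only [conjDer_apply]
  have h1 := key (fun b₁ b₂ b₃ => counit (R := K) b₂ • (f b₁ * g b₃))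
    (fun b₁ b₂ b₃ => μ b₂ • (f b₁ * g b₃))
  have h2 := key (fun b₁ b₂ b₃ => μ b₂ • (f b₁ * g b₃))
    (fun b₁ b₂ b₃ => counit (R := K) b₂ • (f b₁ * g b₃))
  rw [hfg', smul_mul_assoc, one_mul] at h1
  rw [hfg', mul_smul_comm, mul_one] at h2
  rw [← h1, ← h2]
  unfold sw3
  rw [sw_prod (by fun_prop) (by fun_prop)]
  have inner : ∀ b₁ b' c₁ c' : B, sw K (b' * c') (fun d₂ d₃ => μ d₂ • (f (b₁ * c₁) * g d₃)) =
      sw K b' fun b₂ b₃ => sw K c' fun c₂ c₃ => μ (b₂ * c₂) • (f (b₁ * c₁) * g (b₃ * c₃)) :=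
    fun b₁ b' c₁ c' => sw_prod (by fun_prop) (by fun_prop) b' c'
  simp only [inner]
  simp only [hμ.map_mul, hf, hg, ← sw_add]
  refine congrArg (sw K b) (funext₂ fun b₁ b' => congrArg (sw K c) (funext₂ fun c₁ c' =>
    congrArg (sw K b') (funext₂ fun b₂ b₃ => congrArg (sw K c') (funext₂ fun c₂ c₃ => ?_))))
  simp only [Algebra.smul_def, map_add, map_mul, Algebra.algebraMap_self, RingHom.id_apply]
  ring

/-- The left side is a derivation along the counit in b, the right side one in c. The reproducing
formula writes both through the four-fold comultiplication of t, and the two expressions differ by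
two cyclic rotations. -/
theorem conjDer_form (ht : IsTraceLike K t) (b c : B) :
    conjDer (toConv LinearMap.id) (toConv (antipode K)) (ht.isCounitDer_form' c).lin b =
      conjDer (toConv (antipode K)) (toConv LinearMap.id) (ht.isCounitDer_form b).lin c := by
  rw [ht.eq_sw_form (isCounitDer_conjDer (fun _ _ => rfl) antipode_mul_distrib
    LinearMap.id_mul_antipode (ht.isCounitDer_form' c)) b,
    ht.eq_sw_form (isCounitDer_conjDer antipode_mul_distrib (fun _ _ => rfl)
    LinearMap.antipode_mul_id (ht.isCounitDer_form b)) c]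
  simp only [conjDer_apply]
  let F : B → B → B → B → B := fun t₁ t₂ t₃ t₄ =>
    ht.form b t₁ • ht.form t₃ c • (t₂ * antipode K t₄)
  have e1 : (sw K t fun t' t'' => ht.form b t' • sw3 K t'' fun b₁ b₂ b₃ => ht.form b₂ c •
      ((toConv LinearMap.id : WithConv (B →ₗ[K] B)) b₁ *
        (toConv (antipode K) : WithConv (B →ₗ[K] B)) b₃)) = sw4 K t F := by
    simp only [sw4, sw3, sw_smul]
    rfl
  have e2 : (sw K t fun t' t'' => ht.form c t' • sw3 K t'' fun b₁ b₂ b₃ => ht.form b b₂ •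
      ((toConv (antipode K) : WithConv (B →ₗ[K] B)) b₁ *
        (toConv LinearMap.id : WithConv (B →ₗ[K] B)) b₃)) =
      sw4 K t fun t₁ t₂ t₃ t₄ => F t₃ t₄ t₁ t₂ := by
    simp only [sw4, sw3, sw_smul]
    refine congrArg (sw K t) (funext₂ fun t₁ d => congrArg (sw K d) (funext₂ fun t₂ e =>
      congrArg (sw K e) (funext₂ fun t₃ t₄ => ?_)))
    change ht.form c t₁ • ht.form b t₃ • (antipode K t₂ * t₄) =
      ht.form b t₃ • ht.form t₁ c • (t₄ * antipode K t₂)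
    rw [ht.form_comm c, smul_comm, mul_comm]
  refine e1.trans (Eq.trans ?_ e2.symm)
  rw [← ht.sw4_rotate (F := F) (by fun_prop) (by fun_prop) (by fun_prop) (by fun_prop),
    ← ht.sw4_rotate (F := fun a b c d => F b c d a) (by fun_prop) (by fun_prop) (by fun_prop)
    (by fun_prop)]

/-- Invariance of the form. -/
theorem form_invariant (ht : IsTraceLike K t) (b c : B) :
    (sw K b fun b' b'' => sw K c fun c' c'' => ht.form b'' c'' • (b' * c')) =
      sw K b fun b' b'' => sw K c fun c' c'' => ht.form b' c' • (b'' * c'') := by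
  -- Inserting s(b''') b'''' after the factor b'' • c displays the conjugated derivation, to which
  -- `conjDer_form` applies.
  have h1 : ∀ b c : B, (sw K b fun b' b'' => ht.form b'' c • b') = sw K b fun b' b'' =>
      conjDer (toConv LinearMap.id) (toConv (antipode K)) (ht.isCounitDer_form' c).lin b' * b'' := by
    intro b c
    have := conv_apply (conjDer (toConv LinearMap.id) (toConv (antipode K))
      (ht.isCounitDer_form' c).lin) (toConv LinearMap.id) b
    rw [conjDer, mul_assoc, mul_assoc, LinearMap.antipode_mul_id, mul_one, conv_apply] at this
    refine Eq.trans ?_ this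
    refine congrArg (sw K b) (funext₂ fun b' b'' => ?_)
    exact (Algebra.smul_def _ _).trans (mul_comm _ _)
  have h2 : ∀ b c : B, (sw K c fun c' c'' => ht.form b c' • c'') = sw K c fun c' c'' =>
      c' * conjDer (toConv (antipode K)) (toConv LinearMap.id) (ht.isCounitDer_form b).lin c'' := by
    intro b c
    have := conv_apply (toConv LinearMap.id) (conjDer (toConv (antipode K)) (toConv LinearMap.id)
      (ht.isCounitDer_form b).lin) c
    rw [conjDer, ← mul_assoc, LinearMap.id_mul_antipode, one_mul, conv_apply] at this
    refine Eq.trans ?_ this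
    refine congrArg (sw K c) (funext₂ fun c' c'' => ?_)
    exact Algebra.smul_def _ _
  have e1 : ∀ c' c'' : B, (sw K b fun b' b'' => ht.form b'' c'' • (b' * c')) =
      (sw K b fun b' b'' => ht.form b'' c'' • b') * c' := fun c' c'' => by
    simp only [sw_mul_right, smul_mul_assoc]
  have e2 : ∀ b' b'' : B, (sw K c fun c' c'' => ht.form b' c' • (b'' * c'')) =
      b'' * (sw K c fun c' c'' => ht.form b' c' • c'') := fun c' c'' => by
    simp only [sw_mul_left, mul_smul_comm]
  rw [sw_sw]
  simp only [e1, e2, h1, h2, sw_mul_left, sw_mul_right]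
  rw [sw_sw]
  refine congrArg (sw K b) (funext₂ fun b' b'' => congrArg (sw K c) (funext₂ fun c' c'' => ?_))
  rw [ht.conjDer_form]
  ring

end IsTraceLike

end Form

end RepAlg

namespace RepAlg

set_option linter.unusedSectionVars false

/-! ### Functions of three variables in `B` -/

section Slot

variable {K B S T : Type*} [CommRing K] [CommRing B] [HopfAlgebra K B] [Ring S] [Algebra K S]
  [Ring T] [Algebra K T]

variable (K B S) in
/-- The convolution algebra of linear maps `B ⊗ B ⊗ B → S`. -/
abbrev Slot : Type _ := WithConv (B ⊗[K] (B ⊗[K] B) →ₗ[K] S)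

theorem sw_tmul {C D P : Type*} [AddCommGroup C] [Module K C] [Coalgebra K C] [AddCommGroup D]
    [Module K D] [Coalgebra K D] [AddCommGroup P] [Module K P] {F : C ⊗[K] D → C ⊗[K] D → P}
    (h₁ : ∀ b, Lin K fun a => F a b) (h₂ : ∀ a, Lin K (F a)) (c : C) (d : D) :
    sw K (c ⊗ₜ[K] d) F = sw K c fun c' c'' => sw K d fun d' d'' => F (c' ⊗ₜ d') (c'' ⊗ₜ d'') := by
  refine (sw_eq_lift (Lin.mk₂ h₁ h₂) _).trans ?_
  rw [TensorProduct.comul_tmul]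
  conv_lhs => rw [(TensorProduct.exists_finset (R := K) (comul (R := K) c)).choose_spec,
    (TensorProduct.exists_finset (R := K) (comul (R := K) d)).choose_spec]
  simp [sw, sweedler, TensorProduct.sum_tmul, TensorProduct.tmul_sum]
  rw [Finset.sum_comm]

namespace Slot

theorem ext {F G : Slot K B S} (h : ∀ b c d, F (b ⊗ₜ (c ⊗ₜ d)) = G (b ⊗ₜ (c ⊗ₜ d))) : F = G := by
  refine WithConv.ext (TensorProduct.ext' fun b z => ?_)
  induction z with
  | zero => simp
  | tmul c d => exact h b c d
  | add u v hu hv => rw [TensorProduct.tmul_add, map_add, map_add, hu, hv]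

theorem mul_apply (F G : Slot K B S) (b c d : B) :
    (F * G) (b ⊗ₜ (c ⊗ₜ d)) = sw K b fun b' b'' => sw K c fun c' c'' => sw K d fun d' d'' =>
      F (b' ⊗ₜ (c' ⊗ₜ d')) * G (b'' ⊗ₜ (c'' ⊗ₜ d'')) := by
  rw [conv_apply, sw_tmul (F := fun u v => F u * G v) (by fun_prop) (by fun_prop)]
  refine congrArg (sw K b) (funext₂ fun b' b'' => ?_)
  exact sw_tmul (F := fun u v => F (b' ⊗ₜ u) * G (b'' ⊗ₜ v)) (by fun_prop) (by fun_prop) c d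

theorem one_apply (b c d : B) : (1 : Slot K B S) (b ⊗ₜ (c ⊗ₜ d)) =
    (counit (R := K) b * (counit (R := K) c * counit (R := K) d)) • (1 : S) := by
  change algebraMap K S (counit (b ⊗ₜ[K] (c ⊗ₜ[K] d))) = _
  rw [Algebra.algebraMap_eq_smul_one, TensorProduct.counit_tmul, TensorProduct.counit_tmul]
  simp only [smul_eq_mul]
  congr 1
  ring

/-- The element of `Slot K B S` with given values. -/
noncomputable def tri (f : B → B → B → S) (h₁ : ∀ c d, Lin K fun b => f b c d)
    (h₂ : ∀ b d, Lin K fun c => f b c d) (h₃ : ∀ b c, Lin K fun d => f b c d) : Slot K B S :=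
  toConv (TensorProduct.lift (Lin.mk₂ (f := fun b z => TensorProduct.lift
    (Lin.mk₂ (h₂ b) (h₃ b)) z) (fun z => by
      induction z with
      | zero => simp only [map_zero]; fun_prop
      | tmul c d => exact h₁ c d
      | add p q hp hq => simp only [map_add]; fun_prop) (fun a => Lin.coe _)))

theorem tri_apply (f : B → B → B → S) (h₁ : ∀ c d, Lin K fun b => f b c d)
    (h₂ : ∀ b d, Lin K fun c => f b c d) (h₃ : ∀ b c, Lin K fun d => f b c d) (b c d : B) :
    tri f h₁ h₂ h₃ (b ⊗ₜ (c ⊗ₜ d)) = f b c d := by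
  simp [tri]

theorem add_apply (F G : Slot K B S) (z : B ⊗[K] (B ⊗[K] B)) : (F + G) z = F z + G z := rfl

theorem smul_apply (k : K) (F : Slot K B S) (z : B ⊗[K] (B ⊗[K] B)) : (k • F) z = k • F z := rfl

/-- The cyclic permutation of the slots, as a linear map. -/
noncomputable def rotLin : Slot K B S →ₗ[K] Slot K B S :=
  Lin.mk' (f := fun F : Slot K B S => tri (fun b c d => F (c ⊗ₜ (d ⊗ₜ b))) (by fun_prop)
      (by fun_prop) (by fun_prop))
    ⟨fun F G => ext fun b c d => by simp only [add_apply, tri_apply],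
      fun k F => ext fun b c d => by simp only [smul_apply, tri_apply]⟩

theorem rotLin_apply (F : Slot K B S) (b c d : B) :
    rotLin F (b ⊗ₜ (c ⊗ₜ d)) = F (c ⊗ₜ (d ⊗ₜ b)) := by
  rw [rotLin, Lin.mk'_apply, tri_apply]

/-- The cyclic permutation of the slots. -/
noncomputable def rot : Slot K B S →ₐ[K] Slot K B S :=
  AlgHom.ofLinearMap rotLin
    (ext fun b c d => by
      rw [rotLin_apply, one_apply, one_apply]
      congr 1
      ring)
    (fun F G => ext fun b c d => by
      simp only [rotLin_apply, mul_apply]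
      refine Eq.trans ?_ (sw_sw c b _)
      exact congrArg (sw K c) (funext₂ fun c' c'' => sw_sw d b _))

theorem rot_apply (F : Slot K B S) (b c d : B) :
    rot F (b ⊗ₜ (c ⊗ₜ d)) = F (c ⊗ₜ (d ⊗ₜ b)) :=
  rotLin_apply F b c d

/-- The exchange of the first two slots, as a linear map. -/
noncomputable def swapLin : Slot K B S →ₗ[K] Slot K B S :=
  Lin.mk' (f := fun F : Slot K B S => tri (fun b c d => F (c ⊗ₜ (b ⊗ₜ d))) (by fun_prop)
      (by fun_prop) (by fun_prop))
    ⟨fun F G => ext fun b c d => by simp only [add_apply, tri_apply],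
      fun k F => ext fun b c d => by simp only [smul_apply, tri_apply]⟩

theorem swapLin_apply (F : Slot K B S) (b c d : B) :
    swapLin F (b ⊗ₜ (c ⊗ₜ d)) = F (c ⊗ₜ (b ⊗ₜ d)) := by
  rw [swapLin, Lin.mk'_apply, tri_apply]

/-- The exchange of the first two slots. -/
noncomputable def swap : Slot K B S →ₐ[K] Slot K B S :=
  AlgHom.ofLinearMap swapLin
    (ext fun b c d => by
      rw [swapLin_apply, one_apply, one_apply]
      congr 1
      ring)
    (fun F G => ext fun b c d => by
      simp only [swapLin_apply, mul_apply]
      exact sw_sw c b _)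

theorem swap_apply (F : Slot K B S) (b c d : B) :
    swap F (b ⊗ₜ (c ⊗ₜ d)) = F (c ⊗ₜ (b ⊗ₜ d)) :=
  swapLin_apply F b c d

theorem rot_rot_rot (F : Slot K B S) : rot (rot (rot F)) = F :=
  ext fun b c d => by simp only [rot_apply]

theorem slot1_aux (f : WithConv (B →ₗ[K] S)) (F : Slot K B S) (b c d : B) :
    (sw K b fun b' b'' => sw K c fun c' c'' => sw K d fun d' d'' =>
      ((counit (R := K) c' * counit (R := K) d') • f b') * F (b'' ⊗ₜ (c'' ⊗ₜ d''))) =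
    sw K b fun b' b'' => f b' * F (b'' ⊗ₜ (c ⊗ₜ d)) := by
  refine congrArg (sw K b) (funext₂ fun b' b'' => ?_)
  have q : ∀ c', sw K d (fun d' d'' => counit (R := K) d' • (f b' * F (b'' ⊗ₜ (c' ⊗ₜ d'')))) =
      f b' * F (b'' ⊗ₜ (c' ⊗ₜ d)) := fun c' =>
    sw_counit_left (F := fun d => f b' * F (b'' ⊗ₜ (c' ⊗ₜ d))) (by fun_prop) d
  simp only [mul_smul, smul_mul_assoc, ← sw_smul, q]
  exact sw_counit_left (F := fun c => f b' * F (b'' ⊗ₜ (c ⊗ₜ d))) (by fun_prop) c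

theorem slot1_aux' (f : WithConv (B →ₗ[K] S)) (F : Slot K B S) (b c d : B) :
    (sw K b fun b' b'' => sw K c fun c' c'' => sw K d fun d' d'' =>
      F (b' ⊗ₜ (c' ⊗ₜ d')) * ((counit (R := K) c'' * counit (R := K) d'') • f b'')) =
    sw K b fun b' b'' => F (b' ⊗ₜ (c ⊗ₜ d)) * f b'' := by
  refine congrArg (sw K b) (funext₂ fun b' b'' => ?_)
  have q : ∀ c', sw K d (fun d' d'' => counit (R := K) d'' • (F (b' ⊗ₜ (c' ⊗ₜ d')) * f b'')) =
      F (b' ⊗ₜ (c' ⊗ₜ d)) * f b'' := fun c' =>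
    sw_counit_right (F := fun d => F (b' ⊗ₜ (c' ⊗ₜ d)) * f b'') (by fun_prop) d
  simp only [mul_smul, mul_smul_comm, ← sw_smul, q]
  exact sw_counit_right (F := fun c => F (b' ⊗ₜ (c ⊗ₜ d)) * f b'') (by fun_prop) c

/-- A function of the first variable, as a linear map. -/
noncomputable def slot1Lin : WithConv (B →ₗ[K] S) →ₗ[K] Slot K B S :=
  Lin.mk' (f := fun f : WithConv (B →ₗ[K] S) => tri (fun b c d =>
      (counit (R := K) c * counit (R := K) d) • f b) (by fun_prop) (by fun_prop) (by fun_prop))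
    ⟨fun F G => ext fun b c d => by
        simp only [add_apply, tri_apply, ← smul_add]; rfl,
      fun k F => ext fun b c d => by
        simp only [smul_apply, tri_apply]
        rw [smul_comm k]; rfl⟩

theorem slot1Lin_apply (f : WithConv (B →ₗ[K] S)) (b c d : B) :
    slot1Lin f (b ⊗ₜ (c ⊗ₜ d)) = (counit (R := K) c * counit (R := K) d) • f b := by
  rw [slot1Lin, Lin.mk'_apply, tri_apply]

/-- A function of the first variable. -/
noncomputable def slot1 : WithConv (B →ₗ[K] S) →ₐ[K] Slot K B S :=
  AlgHom.ofLinearMap slot1Lin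
    (ext fun b c d => by
      rw [slot1Lin_apply, one_apply]
      change _ • algebraMap K S _ = _
      rw [Algebra.algebraMap_eq_smul_one, smul_smul, mul_comm])
    (fun F G => ext fun b c d => by
      have := slot1_aux F (slot1Lin G) b c d
      simp only [slot1Lin_apply, mul_apply] at this ⊢
      rw [this, conv_apply, sw_smul]
      simp only [mul_smul_comm])

theorem slot1_apply (f : WithConv (B →ₗ[K] S)) (b c d : B) :
    slot1 f (b ⊗ₜ (c ⊗ₜ d)) = (counit (R := K) c * counit (R := K) d) • f b :=
  slot1Lin_apply f b c d

theorem slot1_mul_apply (f : WithConv (B →ₗ[K] S)) (F : Slot K B S) (b c d : B) :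
    (slot1 f * F) (b ⊗ₜ (c ⊗ₜ d)) = sw K b fun b' b'' => f b' * F (b'' ⊗ₜ (c ⊗ₜ d)) := by
  rw [mul_apply, ← slot1_aux]
  simp only [slot1_apply]

theorem mul_slot1_apply (f : WithConv (B →ₗ[K] S)) (F : Slot K B S) (b c d : B) :
    (F * slot1 f) (b ⊗ₜ (c ⊗ₜ d)) = sw K b fun b' b'' => F (b' ⊗ₜ (c ⊗ₜ d)) * f b'' := by
  rw [mul_apply, ← slot1_aux']
  simp only [slot1_apply]

/-- A function of the second variable. -/
noncomputable def slot2 : WithConv (B →ₗ[K] S) →ₐ[K] Slot K B S := rot.comp slot1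

/-- A function of the third variable. -/
noncomputable def slot3 : WithConv (B →ₗ[K] S) →ₐ[K] Slot K B S := rot.comp slot2

theorem rot_slot1 (f : WithConv (B →ₗ[K] S)) : rot (slot1 f) = slot2 f := rfl

theorem rot_slot2 (f : WithConv (B →ₗ[K] S)) : rot (slot2 f) = slot3 f := rfl

theorem rot_slot3 (f : WithConv (B →ₗ[K] S)) : rot (slot3 f) = slot1 f := rot_rot_rot _

theorem swap_slot1 (f : WithConv (B →ₗ[K] S)) : swap (slot1 f) = slot2 f :=
  ext fun b c d => by
    rw [← rot_slot1, rot_apply, swap_apply, slot1_apply, slot1_apply, mul_comm]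

theorem swap_slot2 (f : WithConv (B →ₗ[K] S)) : swap (slot2 f) = slot1 f :=
  ext fun b c d => by
    rw [← rot_slot1, swap_apply, rot_apply, slot1_apply, slot1_apply, mul_comm]

theorem slot2_mul_apply (f : WithConv (B →ₗ[K] S)) (F : Slot K B S) (b c d : B) :
    (slot2 f * F) (b ⊗ₜ (c ⊗ₜ d)) = sw K c fun c' c'' => f c' * F (b ⊗ₜ (c'' ⊗ₜ d)) := by
  rw [← rot_rot_rot F, ← rot_slot1, ← map_mul, rot_apply, slot1_mul_apply]
  simp only [rot_apply]

theorem mul_slot2_apply (f : WithConv (B →ₗ[K] S)) (F : Slot K B S) (b c d : B) :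
    (F * slot2 f) (b ⊗ₜ (c ⊗ₜ d)) = sw K c fun c' c'' => F (b ⊗ₜ (c' ⊗ₜ d)) * f c'' := by
  rw [← rot_rot_rot F, ← rot_slot1, ← map_mul, rot_apply, mul_slot1_apply]
  simp only [rot_apply]

theorem slot3_mul_apply (f : WithConv (B →ₗ[K] S)) (F : Slot K B S) (b c d : B) :
    (slot3 f * F) (b ⊗ₜ (c ⊗ₜ d)) = sw K d fun d' d'' => f d' * F (b ⊗ₜ (c ⊗ₜ d'')) := by
  rw [← rot_rot_rot F, ← rot_slot2, ← map_mul, rot_apply, slot2_mul_apply]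
  simp only [rot_apply]

theorem mul_slot3_apply (f : WithConv (B →ₗ[K] S)) (F : Slot K B S) (b c d : B) :
    (F * slot3 f) (b ⊗ₜ (c ⊗ₜ d)) = sw K d fun d' d'' => F (b ⊗ₜ (c ⊗ₜ d')) * f d'' := by
  rw [← rot_rot_rot F, ← rot_slot2, ← map_mul, rot_apply, mul_slot2_apply]
  simp only [rot_apply]

theorem slot2_apply (f : WithConv (B →ₗ[K] S)) (b c d : B) :
    slot2 f (b ⊗ₜ (c ⊗ₜ d)) = (counit (R := K) b * counit (R := K) d) • f c := by
  rw [← rot_slot1, rot_apply, slot1_apply, mul_comm]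

theorem slot3_apply (f : WithConv (B →ₗ[K] S)) (b c d : B) :
    slot3 f (b ⊗ₜ (c ⊗ₜ d)) = (counit (R := K) b * counit (R := K) c) • f d := by
  rw [← rot_slot2, rot_apply, slot2_apply, mul_comm]

theorem commute_slot12 {f g : WithConv (B →ₗ[K] S)} (h : ∀ a b, Commute (f a) (g b)) :
    Commute (slot1 f) (slot2 g) :=
  ext fun b c d => by
    rw [slot1_mul_apply, mul_slot1_apply]
    simp only [slot2_apply, mul_smul, smul_mul_assoc, mul_smul_comm]
    rw [sw_counit_right (F := fun b => counit (R := K) d • (f b * g c)) (by fun_prop),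
      sw_counit_left (F := fun b => counit (R := K) d • (g c * f b)) (by fun_prop), (h b c).eq]

theorem commute_slot23 {f g : WithConv (B →ₗ[K] S)} (h : ∀ a b, Commute (f a) (g b)) :
    Commute (slot2 f) (slot3 g) :=
  (commute_slot12 h).map rot

theorem commute_slot31 {f g : WithConv (B →ₗ[K] S)} (h : ∀ a b, Commute (f a) (g b)) :
    Commute (slot3 f) (slot1 g) := by
  have := (commute_slot23 h).map (rot (K := K) (B := B) (S := S))
  rwa [rot_slot2, rot_slot3] at this

variable (S) in
/-- The scalar function `ω(b, c)` of the first two variables. -/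
noncomputable def form12 (ω : B →ₗ[K] B →ₗ[K] K) : Slot K B S :=
  tri (fun b c d => (ω b c * counit (R := K) d) • (1 : S)) (by fun_prop) (by fun_prop) (by fun_prop)

variable (S) in
/-- The scalar function `ω(c, d)` of the last two variables. -/
noncomputable def form23 (ω : B →ₗ[K] B →ₗ[K] K) : Slot K B S := rot (form12 S ω)

variable (S) in
/-- The scalar function `ω(d, b)` of the outer variables. -/
noncomputable def form31 (ω : B →ₗ[K] B →ₗ[K] K) : Slot K B S := rot (form23 S ω)

theorem form12_apply (ω : B →ₗ[K] B →ₗ[K] K) (b c d : B) :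
    form12 S ω (b ⊗ₜ (c ⊗ₜ d)) = (ω b c * counit (R := K) d) • (1 : S) :=
  tri_apply _ _ _ _ b c d

theorem form23_apply (ω : B →ₗ[K] B →ₗ[K] K) (b c d : B) :
    form23 S ω (b ⊗ₜ (c ⊗ₜ d)) = (ω c d * counit (R := K) b) • (1 : S) := by
  rw [form23, rot_apply, form12_apply]

theorem rot_form31 (ω : B →ₗ[K] B →ₗ[K] K) : rot (form31 S ω) = form12 S ω := rot_rot_rot _

theorem swap_form12 {ω : B →ₗ[K] B →ₗ[K] K} (h : ∀ b c, ω b c = ω c b) :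
    swap (form12 S ω) = form12 S ω :=
  ext fun b c d => by rw [swap_apply, form12_apply, form12_apply, h]

theorem commute_slot3_form12 (f : WithConv (B →ₗ[K] S)) (ω : B →ₗ[K] B →ₗ[K] K) :
    Commute (slot3 f) (form12 S ω) :=
  ext fun b c d => by
    rw [slot3_mul_apply, mul_slot3_apply]
    simp only [form12_apply, mul_comm (ω b c), mul_smul, smul_mul_assoc, mul_smul_comm, one_mul, mul_one]
    rw [sw_counit_right (F := fun d => ω b c • f d) (by fun_prop),
      sw_counit_left (F := fun d => ω b c • f d) (by fun_prop)]

theorem form12_mul_apply (ω : B →ₗ[K] B →ₗ[K] K) (F : Slot K B S) (b c d : B) :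
    (form12 S ω * F) (b ⊗ₜ (c ⊗ₜ d)) = sw K b fun b' b'' => sw K c fun c' c'' =>
      ω b' c' • F (b'' ⊗ₜ (c'' ⊗ₜ d)) := by
  rw [mul_apply]
  refine congrArg (sw K b) (funext₂ fun b' b'' => congrArg (sw K c) (funext₂ fun c' c'' => ?_))
  simp only [form12_apply, mul_comm (ω b' c'), mul_smul, smul_mul_assoc, one_mul]
  exact sw_counit_left (F := fun d => ω b' c' • F (b'' ⊗ₜ (c'' ⊗ₜ d))) (by fun_prop) d

theorem mul_form12_apply (ω : B →ₗ[K] B →ₗ[K] K) (F : Slot K B S) (b c d : B) :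
    (F * form12 S ω) (b ⊗ₜ (c ⊗ₜ d)) = sw K b fun b' b'' => sw K c fun c' c'' =>
      ω b'' c'' • F (b' ⊗ₜ (c' ⊗ₜ d)) := by
  rw [mul_apply]
  refine congrArg (sw K b) (funext₂ fun b' b'' => congrArg (sw K c) (funext₂ fun c' c'' => ?_))
  simp only [form12_apply, mul_comm (ω b'' c''), mul_smul, mul_smul_comm, mul_one]
  exact sw_counit_right (F := fun d => ω b'' c'' • F (b' ⊗ₜ (c' ⊗ₜ d))) (by fun_prop) d

end Slot

end Slot

end RepAlg

namespace RepAlg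

set_option linter.unusedSectionVars false

/-! ### Brackets of generators -/

section Brak

variable {K A E E' : Type*} [CommRing K] [Ring A] [HopfAlgebra K A] [IsCocomm K A]
  [Ring E] [Algebra K E] [Ring E'] [Algebra K E']

theorem map_ad (h : E →ₐ[K] E') (X : A →ₐ[K] E) (a : A) (e : E) :
    h (ad X a e) = ad (h.comp X) a (h e) := by
  simp only [ad_apply, map_sw, map_mul]
  rfl

/-- The bracket of the generators of two slots. -/
noncomputable def brak (ρ : A →ₗ[K] A →ₗ[K] A) (X₁ X₂ : A →ₐ[K] E) (Ω : E) (x y : A) : E :=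
  sw K x fun x' x'' => sw K y fun y' y'' => vel ρ X₁ Ω x' y' * X₁ x'' * X₂ y''

theorem map_brak (h : E →ₐ[K] E') (ρ : A →ₗ[K] A →ₗ[K] A) (X₁ X₂ : A →ₐ[K] E) (Ω : E) (x y : A) :
    h (brak ρ X₁ X₂ Ω x y) = brak ρ (h.comp X₁) (h.comp X₂) (h Ω) x y := by
  simp only [brak, map_sw, map_mul, vel, map_ad]
  rfl

/-- Apply ρ(x, -) to y' s(y'') = ε(y) 1. This is the passage from κ back to ρ used in `brak_eq`. -/
theorem IsFoxPairing.kap_eq {ρ : A →ₗ[K] A →ₗ[K] A} (hρ : IsFoxPairing ρ) (x y : A) :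
    kap ρ x y = sw K y fun y' y'' => ρ x y' * antipode K y'' := by
  have h : ρ x (sw K y fun y' y'' => y' * antipode K y'') = 0 := by
    rw [sw_mul_antipode_eq, map_smul, hρ.one_right, smul_zero]
  rw [map_sw] at h
  simp only [hρ.map_mul_right, sw_add] at h
  rw [sw_counit_left (F := fun y => ρ x (antipode K y)) (by fun_prop)] at h
  rw [kap_apply]
  exact neg_eq_of_add_eq_zero_left h

namespace IsSlotSystem

variable {X₁ X₂ X₃ : A →ₐ[K] E} {Ω₁₂ Ω₂₃ Ω₃₁ : E}

/-- Conjugation moves from slot 1 to slot 2 at the price of an antipode, and s(κ(x, y)) = -κ(y, x).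
-/
theorem vel_swap (h : IsSlotSystem X₁ X₂ X₃ Ω₁₂ Ω₂₃ Ω₃₁) {ρ : A →ₗ[K] A →ₗ[K] A}
    (hρ : IsQuasiPoissonFox ρ) (x y : A) : vel ρ X₁ Ω₁₂ x y = -vel ρ X₂ Ω₁₂ y x := by
  rw [vel, vel, ← h.ad_two_eq, hρ.antipode_kap, map_neg]
  rfl

theorem brak_antisymm (h : IsSlotSystem X₁ X₂ X₃ Ω₁₂ Ω₂₃ Ω₃₁) {ρ : A →ₗ[K] A →ₗ[K] A}
    (hρ : IsQuasiPoissonFox ρ) (x y : A) :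
    brak ρ X₁ X₂ Ω₁₂ x y = -brak ρ X₂ X₁ Ω₁₂ y x := by
  simp only [brak, h.vel_swap hρ, mul_assoc, neg_mul, sw_neg, (h.c12 _ _).eq]
  rw [sw_sw]

/-- By invariance of Ω₁₂ the factor s(y) in κ(x, z) s(y) becomes conjugation by y in slot 2, which
is what moving X₂(y) to the right past the tensor produces. The Fox rule thus turns into the Leibniz
rule. -/
theorem brak_mul_right (h : IsSlotSystem X₁ X₂ X₃ Ω₁₂ Ω₂₃ Ω₃₁) {ρ : A →ₗ[K] A →ₗ[K] A}
    (hρ : IsFoxPairing ρ) (x y z : A) :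
    brak ρ X₁ X₂ Ω₁₂ x (y * z) = brak ρ X₁ X₂ Ω₁₂ x y * X₂ z + X₂ y * brak ρ X₁ X₂ Ω₁₂ x z := by
  have hv : ∀ x y z, vel ρ X₁ Ω₁₂ x (y * z) =
      ad X₂ y (vel ρ X₁ Ω₁₂ x z) + counit (R := K) z • vel ρ X₁ Ω₁₂ x y := fun x y z => by
    simp only [vel]
    rw [hρ.kap_mul_right, map_add, map_mul, map_smul, ad_ad_comm h.c21,
      ad_eq_ad_antipode h.c12 h.i12]
    rfl
  have e1 : brak ρ X₁ X₂ Ω₁₂ x y * X₂ z = sw K x fun x' x'' => sw K y fun y' y'' =>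
      sw K z fun z' z'' => (counit (R := K) z' • vel ρ X₁ Ω₁₂ x' y') * X₁ x'' * X₂ (y'' * z'') := by
    simp only [brak, sw_mul_right]
    refine congrArg (sw K x) (funext₂ fun x' x'' => congrArg (sw K y) (funext₂ fun y' y'' => ?_))
    simp only [smul_mul_assoc]
    rw [sw_counit_left (F := fun z => vel ρ X₁ Ω₁₂ x' y' * X₁ x'' * X₂ (y'' * z)) (by fun_prop),
      map_mul]
    simp only [mul_assoc]
  have e2 : X₂ y * brak ρ X₁ X₂ Ω₁₂ x z = sw K x fun x' x'' => sw K y fun y' y'' =>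
      sw K z fun z' z'' => ad X₂ y' (vel ρ X₁ Ω₁₂ x' z') * X₁ x'' * X₂ (y'' * z'') := by
    have q : ∀ x' x'' z' z'', (sw K y fun y' y'' => ad X₂ y' (vel ρ X₁ Ω₁₂ x' z') * X₁ x'' *
        X₂ (y'' * z'')) = X₂ y * (vel ρ X₁ Ω₁₂ x' z' * X₁ x'' * X₂ z'') := by
      intro x' x'' z' z''
      simp only [← mul_assoc]
      rw [mul_eq_sw_ad X₂ y]
      simp only [sw_mul_right]
      refine congrArg (sw K y) (funext₂ fun y' y'' => ?_)
      rw [map_mul, mul_assoc _ (X₂ y''), ← (h.c12 x'' y'').eq]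
      simp only [mul_assoc]
    simp only [brak, sw_mul_left]
    refine congrArg (sw K x) (funext₂ fun x' x'' => ?_)
    rw [sw_sw]
    simp only [q]
  rw [e1, e2, brak]
  simp only [← sw_add]
  refine congrArg (sw K x) (funext₂ fun x' x'' => ?_)
  rw [sw_prod (by fun_prop) (by fun_prop)]
  refine congrArg (sw K y) (funext₂ fun y' y'' => congrArg (sw K z) (funext₂ fun z' z'' => ?_))
  rw [hv, add_mul, add_mul, add_comm]

/-- Substituting κ(x, y) = ρ(x, y') s(y''), the factor s(y'') becomes conjugation by y'' in slot 2,
and this is absorbed by moving X₂ to the left of the tensor. Evaluation at elements of B then gives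
the formula of the theorem. -/
theorem brak_eq (h : IsSlotSystem X₁ X₂ X₃ Ω₁₂ Ω₂₃ Ω₃₁) {ρ : A →ₗ[K] A →ₗ[K] A}
    (hρ : IsFoxPairing ρ) (x y : A) :
    brak ρ X₁ X₂ Ω₁₂ x y = sw K x fun x' x'' => sw K y fun y' y'' =>
      X₂ y'' * (ad X₁ (ρ x' y') Ω₁₂ * X₁ x'') := by
  have hv : ∀ x y, vel ρ X₁ Ω₁₂ x y = sw K y fun y' y'' => ad X₂ y'' (ad X₁ (ρ x y') Ω₁₂) := by
    intro x y
    rw [vel, hρ.kap_eq, lin_sw (g := fun a => ad X₁ a Ω₁₂) (by fun_prop)]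
    refine congrArg (sw K y) (funext₂ fun y' y'' => ?_)
    rw [map_mul, ad_ad_comm h.c21, ad_eq_ad_antipode h.c12 h.i12]
    rfl
  rw [brak]
  refine congrArg (sw K x) (funext₂ fun x' x'' => ?_)
  simp only [hv, sw_mul_right, mul_assoc, (h.c12 _ _).eq]
  rw [sw_assoc (F := fun a b d => ad X₂ b (ad X₁ (ρ x' a) Ω₁₂) * (X₂ d * X₁ x'')) (by fun_prop)
    (by fun_prop) (by fun_prop)]
  refine congrArg (sw K y) (funext₂ fun y' y'' => ?_)
  rw [← mul_assoc, mul_eq_sw_ad]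
  simp only [sw_mul_right, mul_assoc]

end IsSlotSystem

end Brak

/-! ### The slot system of the representation algebra -/

section RepSlots

variable {K A B S T : Type*} [CommRing K] [Ring A] [HopfAlgebra K A] [IsCocomm K A]
  [CommRing B] [HopfAlgebra K B] [CommRing S] [Algebra K S] [CommRing T] [Algebra K T]

open Slot

/-- The algebra homomorphism `x ↦ (b ↦ j(x_b))`. -/
noncomputable def genHom (j : RepAlgebra K A B →ₐ[K] S) : A →ₐ[K] WithConv (B →ₗ[K] S) :=
  AlgHom.ofLinearMap
    (Lin.mk' (f := fun x => genConv j x)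
      ⟨fun x y => WithConv.ext (LinearMap.ext fun b => by
          change j (gen K A B (x + y) b) = j (gen K A B x b) + j (gen K A B y b)
          rw [map_add, LinearMap.add_apply, map_add]),
        fun k x => WithConv.ext (LinearMap.ext fun b => by
          change j (gen K A B (k • x) b) = k • j (gen K A B x b)
          rw [map_smul, LinearMap.smul_apply, map_smul])⟩)
    (genConv_one j) (genConv_mul j)

/-- The generators in the three slots. -/
noncomputable def genSlot1 (j : RepAlgebra K A B →ₐ[K] S) : A →ₐ[K] Slot K B S :=
  slot1.comp (genHom j)

/-- The generators in the second slot. -/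
noncomputable def genSlot2 (j : RepAlgebra K A B →ₐ[K] S) : A →ₐ[K] Slot K B S :=
  slot2.comp (genHom j)

/-- The generators in the third slot. -/
noncomputable def genSlot3 (j : RepAlgebra K A B →ₐ[K] S) : A →ₐ[K] Slot K B S :=
  slot3.comp (genHom j)

/-- The relation a_{bc} = a'_b a''_c makes the value of X₁(a') X₂(a'') depend on the product bc, so
the claim is the image of `form_invariant` under b ↦ a_b. -/
theorem commute_gen_total (j : RepAlgebra K A B →ₐ[K] S) {t : B} (ht : IsTraceLike K t) (a : A) :
    Commute (sw K a fun a' a'' => genSlot1 j a' * genSlot2 j a'') (form12 S ht.form) := by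
  have e : ∀ b c d : B, (sw K a fun a' a'' => genSlot1 j a' * genSlot2 j a'') (b ⊗ₜ (c ⊗ₜ d)) =
      counit (R := K) d • j (gen K A B a (b * c)) := by
    intro b c d
    rw [lin_sw (g := fun F : Slot K B S => F (b ⊗ₜ (c ⊗ₜ d))) (by fun_prop), gen_mul_right,
      map_sw, sw_smul]
    refine congrArg (sw K a) (funext₂ fun a' a'' => ?_)
    change (slot1 (genHom j a') * slot2 (genHom j a'')) _ = _
    rw [slot1_mul_apply]
    simp only [slot2_apply, mul_smul, mul_smul_comm]
    rw [sw_counit_right (F := fun b => counit (R := K) d • (genHom j a' b * genHom j a'' c))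
      (by fun_prop), map_mul]
    rfl
  refine Slot.ext fun b c d => ?_
  rw [form12_mul_apply, mul_form12_apply]
  simp only [e]
  have h := congrArg (counit (R := K) d • (j.toLinearMap ∘ₗ gen K A B a)) (ht.form_invariant b c)
  simp only [map_sw, map_smul] at h
  exact h

/-- The two tensors share only the middle variable. Their commutator is that of the derivations b •
and d •, evaluated at c. -/
theorem commutator_form_apply {t : B} (ht : IsTraceLike K t) (b c d : B) :
    (form12 S ht.form * form23 S ht.form - form23 S ht.form * form12 S ht.form : Slot K B S)
      (b ⊗ₜ (c ⊗ₜ d)) = (ht.form3 c b d - ht.form3 c d b) • (1 : S) := by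
  rw [← ht.sw_form_sub]
  change (form12 S ht.form * form23 S ht.form : Slot K B S) (b ⊗ₜ (c ⊗ₜ d)) -
    (form23 S ht.form * form12 S ht.form : Slot K B S) (b ⊗ₜ (c ⊗ₜ d)) = _
  rw [form12_mul_apply, mul_form12_apply, sw_sw b c, sw_sw b c, ← sw_sub,
    lin_sw (g := fun k : K => k • (1 : S)) (by fun_prop)]
  refine congrArg (sw K c) (funext₂ fun c' c'' => ?_)
  simp only [form23_apply, mul_comm _ (counit (R := K) _), mul_smul, smul_comm (ht.form _ _)
    (counit (R := K) _)]
  rw [sw_counit_right (F := fun b => ht.form b c' • ht.form c'' d • (1 : S)) (by fun_prop),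
    sw_counit_left (F := fun b => ht.form b c'' • ht.form c' d • (1 : S)) (by fun_prop),
    ht.form_comm d, ht.form_comm d, sub_smul, mul_smul, mul_smul]

theorem rot_genSlot1 (j : RepAlgebra K A B →ₐ[K] S) (a : A) : rot (genSlot1 j a) = genSlot2 j a :=
  rfl

theorem rot_genSlot2 (j : RepAlgebra K A B →ₐ[K] S) (a : A) : rot (genSlot2 j a) = genSlot3 j a :=
  rfl

theorem rot_genSlot3 (j : RepAlgebra K A B →ₐ[K] S) (a : A) : rot (genSlot3 j a) = genSlot1 j a :=
  rot_slot3 _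

theorem rot_form12 (ω : B →ₗ[K] B →ₗ[K] K) : rot (form12 S ω) = form23 S ω := rfl

theorem rot_form23 (ω : B →ₗ[K] B →ₗ[K] K) : rot (form23 S ω) = form31 S ω := rfl

/-- The explicit value of the commutator is cyclically symmetric because `form3` is. -/
theorem commutator_form_rotate {t : B} (ht : IsTraceLike K t) :
    (form12 S ht.form * form23 S ht.form - form23 S ht.form * form12 S ht.form : Slot K B S) =
      form23 S ht.form * form31 S ht.form - form31 S ht.form * form23 S ht.form := by
  have : (form23 S ht.form * form31 S ht.form - form31 S ht.form * form23 S ht.form :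
      Slot K B S) = rot (form12 S ht.form * form23 S ht.form -
        form23 S ht.form * form12 S ht.form) := by
    rw [map_sub, map_mul, map_mul, rot_form12, rot_form23]
  rw [this]
  refine Slot.ext fun b c d => ?_
  rw [rot_apply, commutator_form_apply, commutator_form_apply, ht.form3_rotate d c b,
    ht.form3_rotate d b c, ht.form3_rotate b c d]

theorem commute_rot {F G : Slot K B S} (h : Commute F G) : Commute (rot F) (rot G) := h.map rot

theorem isSlotSystem (j : RepAlgebra K A B →ₐ[K] S) {t : B} (ht : IsTraceLike K t) :
    IsSlotSystem (genSlot1 j) (genSlot2 j) (genSlot3 j) (form12 S ht.form) (form23 S ht.form)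
      (form31 S ht.form) := by
  have i12 := fun a => commute_gen_total j ht a
  have i23 := fun a => commute_rot (i12 a)
  simp only [map_sw, map_mul, rot_genSlot1, rot_genSlot2, rot_form12] at i23
  have i31 := fun a => commute_rot (i23 a)
  simp only [map_sw, map_mul, rot_genSlot2, rot_genSlot3, rot_form23] at i31
  have o12 : ∀ a, Commute (genSlot3 j a) (form12 S ht.form) :=
    fun a => commute_slot3_form12 (genHom j a) ht.form
  have o23 := fun a => commute_rot (o12 a)
  simp only [rot_genSlot3, rot_form12] at o23
  have o31 := fun a => commute_rot (o23 a)
  simp only [rot_genSlot1, rot_form23] at o31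
  have f1 := commutator_form_rotate (S := S) ht
  have f2 := congrArg (fun F => rot F) f1
  simp only [map_sub, map_mul, rot_form12, rot_form23, rot_form31] at f2
  have c12 : ∀ a b, Commute (genSlot1 j a) (genSlot2 j b) :=
    fun a b => commute_slot12 fun _ _ => Commute.all _ _
  have c23 : ∀ a b, Commute (genSlot2 j a) (genSlot3 j b) :=
    fun a b => commute_slot23 fun _ _ => Commute.all _ _
  have c31 : ∀ a b, Commute (genSlot3 j a) (genSlot1 j b) :=
    fun a b => commute_slot31 fun _ _ => Commute.all _ _
  exact ⟨c12, c23, c31, o12, o23, o31, i12, i23, i31, f1, f1.trans f2⟩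

end RepSlots

end RepAlg

namespace RepAlg

set_option linter.unusedSectionVars false

/-! ### Derivations of the representation algebra -/

section Derivations

variable {K A B S : Type*} [CommRing K] [Ring A] [HopfAlgebra K A]
  [CommRing B] [HopfAlgebra K B] [CommRing S] [Algebra K S]

theorem repAlgebra_induction {P : RepAlgebra K A B → Prop} (hgen : ∀ x b, P (gen K A B x b))
    (halg : ∀ k, P (algebraMap K _ k)) (hadd : ∀ u v, P u → P v → P (u + v))
    (hmul : ∀ u v, P u → P v → P (u * v)) (m : RepAlgebra K A B) : P m := by
  obtain ⟨p, rfl⟩ : ∃ p, proj K A B p = m := Ideal.Quotient.mk_surjective m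
  induction p using MvPolynomial.induction_on with
  | C k =>
    rw [← MvPolynomial.algebraMap_eq, AlgHom.commutes]
    exact halg k
  | add p q hp hq => rw [map_add]; exact hadd _ _ hp hq
  | mul_X p n hp => rw [map_mul]; exact hmul _ _ hp (hgen n.1 n.2)

theorem der_algebraMap (φ : RepAlgebra K A B →ₐ[K] S) {f : RepAlgebra K A B → S}
    (lf : Lin K f) (hf : ∀ u v, f (u * v) = f u * φ v + φ u * f v) (k : K) :
    f (algebraMap K _ k) = 0 := by
  have h1 : f 1 = 0 := by simpa using hf 1 1
  rw [Algebra.algebraMap_eq_smul_one, lf.smul, h1, smul_zero]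

/-- Derivations along an algebra homomorphism are determined by their values on generators. -/
theorem der_ext (φ : RepAlgebra K A B →ₐ[K] S) {f g : RepAlgebra K A B → S}
    (lf : Lin K f) (lg : Lin K g)
    (hf : ∀ u v, f (u * v) = f u * φ v + φ u * f v)
    (hg : ∀ u v, g (u * v) = g u * φ v + φ u * g v)
    (h : ∀ x b, f (gen K A B x b) = g (gen K A B x b)) (m : RepAlgebra K A B) : f m = g m := by
  induction m using repAlgebra_induction with
  | hgen x b => exact h x b
  | halg k => rw [der_algebraMap φ lf hf, der_algebraMap φ lg hg]
  | hadd u v hu hv => rw [lf.add, lg.add, hu, hv]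
  | hmul u v hu hv => rw [hf, hg, hu, hv]

theorem fst_sw {R C M : Type*} [CommRing R] [Algebra K R] [AddCommGroup M] [Module R M]
    [AddCommGroup C] [Module K C] [Coalgebra K C] (c : C) (F : C → C → TrivSqZeroExt R M) :
    (sw K c F).fst = sw K c fun a b => (F a b).fst := TrivSqZeroExt.fst_sum _ _

theorem snd_sw {R C M : Type*} [CommRing R] [Algebra K R] [AddCommGroup M] [Module R M]
    [AddCommGroup C] [Module K C] [Coalgebra K C] (c : C) (F : C → C → TrivSqZeroExt R M) :
    (sw K c F).snd = sw K c fun a b => (F a b).snd := TrivSqZeroExt.snd_sum _ _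

theorem sw_apply {C M N : Type*} [AddCommGroup C] [Module K C] [Coalgebra K C] [AddCommGroup M]
    [Module K M] [AddCommGroup N] [Module K N] (c : C) (F : C → C → M →ₗ[K] N) (m : M) :
    sw K c F m = sw K c fun a b => F a b m := LinearMap.sum_apply _ _ _

/-- A derivation into M is a homomorphism x_b ↦ x_b + D(x, b) into the square-zero extension A_B ⊕
M. The universal property asks for the multiplicative relations, which are the hypotheses, and the
unit relations, which follow from them. -/
theorem exists_der {M : Type*} [AddCommGroup M] [Module K M] [Module (RepAlgebra K A B) M]
    [Module (RepAlgebra K A B)ᵐᵒᵖ M] [IsCentralScalar (RepAlgebra K A B) M]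
    [IsScalarTower K (RepAlgebra K A B) M] [IsScalarTower K (RepAlgebra K A B)ᵐᵒᵖ M]
    (D : A →ₗ[K] B →ₗ[K] M)
    (hmul : ∀ x y b, D (x * y) b = sw K b fun b' b'' =>
      gen K A B x b' • D y b'' + gen K A B y b'' • D x b')
    (hmul' : ∀ x b c, D x (b * c) = sw K x fun x' x'' =>
      gen K A B x' b • D x'' c + gen K A B x'' c • D x' b) :
    ∃ d : RepAlgebra K A B →ₗ[K] M, (∀ u v, d (u * v) = u • d v + v • d u) ∧
      ∀ x b, d (gen K A B x b) = D x b := by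
  have hone : ∀ b, D 1 b = 0 := fun b => by
    have h := hmul 1 1 b
    simp only [gen_one_left, algebraMap_smul, sw_add, mul_one] at h
    rw [sw_counit_left (Lin.coe (D 1)), sw_counit_right (Lin.coe (D 1))] at h
    exact left_eq_add.1 h
  have hone' : ∀ x, D x 1 = 0 := fun x => by
    have h := hmul' x 1 1
    simp only [gen_one_right, algebraMap_smul, sw_add, mul_one] at h
    rw [sw_counit_left (F := fun x => D x 1) (by fun_prop),
      sw_counit_right (F := fun x => D x 1) (by fun_prop)] at h
    exact left_eq_add.1 h
  let u : A →ₗ[K] B →ₗ[K] TrivSqZeroExt (RepAlgebra K A B) M := Lin.mk₂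
    (f := fun x b => TrivSqZeroExt.inl (gen K A B x b) + TrivSqZeroExt.inr (D x b))
    (fun b => ⟨fun x y => by ext <;> simp, fun k x => by ext <;> simp⟩)
    (fun x => ⟨fun b c => by ext <;> simp, fun k b => by ext <;> simp⟩)
  have fst_u : ∀ x b, (u x b).fst = gen K A B x b := fun x b => by simp [u]
  have snd_u : ∀ x b, (u x b).snd = D x b := fun x b => by simp [u]
  let f := liftRep u
    (fun x y b => by
      refine TrivSqZeroExt.ext ?_ ?_
      · simp only [fst_sw, TrivSqZeroExt.fst_mul, fst_u, gen_mul_left]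
      · simp only [snd_sw, TrivSqZeroExt.snd_mul, fst_u, snd_u, op_smul_eq_smul, hmul])
    (fun b => by
      refine TrivSqZeroExt.ext ?_ ?_
      · rw [fst_u, gen_one_left]; rfl
      · rw [snd_u, hone]; rfl)
    (fun x b c => by
      refine TrivSqZeroExt.ext ?_ ?_
      · simp only [fst_sw, TrivSqZeroExt.fst_mul, fst_u, gen_mul_right]
      · simp only [snd_sw, TrivSqZeroExt.snd_mul, fst_u, snd_u, op_smul_eq_smul, hmul'])
    (fun x => by
      refine TrivSqZeroExt.ext ?_ ?_
      · rw [fst_u, gen_one_right]; rfl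
      · rw [snd_u, hone']; rfl)
  have hfst : (TrivSqZeroExt.fstHom K (RepAlgebra K A B) M).comp f = AlgHom.id K _ :=
    repAlgebra_hom_ext fun x b => by
      change (f (gen K A B x b)).fst = gen K A B x b
      rw [liftRep_gen, fst_u]
  have hfst' : ∀ m, (f m).fst = m := fun m => congr($hfst m)
  refine ⟨(TrivSqZeroExt.sndHom (RepAlgebra K A B) M).restrictScalars K ∘ₗ f.toLinearMap,
    fun v w => ?_, fun x b => ?_⟩
  · change (f (v * w)).snd = v • (f w).snd + w • (f v).snd
    rw [map_mul, TrivSqZeroExt.snd_mul, hfst', hfst', op_smul_eq_smul]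
  · change (f (gen K A B x b)).snd = _
    rw [liftRep_gen, snd_u]

theorem IsBracket.induced_ext {br br' : RepAlgebra K A B →ₗ[K] RepAlgebra K A B →ₗ[K]
    RepAlgebra K A B} (h : IsBracket br) (h' : IsBracket br')
    (e : ∀ x b y c, br (gen K A B x b) (gen K A B y c) = br' (gen K A B x b) (gen K A B y c)) :
    br = br' := by
  refine LinearMap.ext fun u => LinearMap.ext fun v => ?_
  refine der_ext (AlgHom.id K _) (f := fun u => br u v) (g := fun u => br' u v) (by fun_prop)
    (by fun_prop) (fun u w => ?_) (fun u w => ?_) (fun x b => ?_) u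
  · rw [h.leibniz_left, add_comm]; rfl
  · rw [h'.leibniz_left, add_comm]; rfl
  · exact der_ext (AlgHom.id K _) (f := fun v => br (gen K A B x b) v)
      (g := fun v => br' (gen K A B x b) v) (by fun_prop) (by fun_prop)
      (fun u w => h.leibniz_right _ u w) (fun u w => h'.leibniz_right _ u w) (e x b) v

/-- A bracket with prescribed antisymmetric values on the generators. -/
theorem exists_bracket (β : A → B → A → B → RepAlgebra K A B)
    (l₁ : ∀ b y c, Lin K fun x => β x b y c) (l₂ : ∀ x y c, Lin K fun b => β x b y c)
    (anti : ∀ x b y c, β x b y c = -β y c x b)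
    (hmul : ∀ x b y z c, β x b (y * z) c = sw K c fun c' c'' =>
      gen K A B y c' * β x b z c'' + gen K A B z c'' * β x b y c')
    (hmul' : ∀ x b y c d, β x b y (c * d) = sw K y fun y' y'' =>
      gen K A B y' c * β x b y'' d + gen K A B y'' d * β x b y' c) :
    ∃ br : RepAlgebra K A B →ₗ[K] RepAlgebra K A B →ₗ[K] RepAlgebra K A B, IsBracket br ∧
      ∀ x b y c, br (gen K A B x b) (gen K A B y c) = β x b y c := by
  have l₃ : ∀ x b c, Lin K fun y => β x b y c := fun x b c => by
    simp only [anti x b]; fun_prop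
  have l₄ : ∀ x b y, Lin K fun c => β x b y c := fun x b y => by
    simp only [anti x b]; fun_prop
  -- First extension: for fixed x_b, the derivation {x_b, -}.
  have ex : ∀ x b, ∃ d : RepAlgebra K A B →ₗ[K] RepAlgebra K A B,
      (∀ u v, d (u * v) = u • d v + v • d u) ∧ ∀ y c, d (gen K A B y c) = β x b y c :=
    fun x b => exists_der (Lin.mk₂ (l₃ x b) (l₄ x b)) (hmul x b) (hmul' x b)
  choose d hd hgen using ex
  have hd' : ∀ x b u v, d x b (u * v) = d x b u * v + u * d x b v := fun x b u v => by
    rw [hd, smul_eq_mul, smul_eq_mul, add_comm, mul_comm v]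
  have dext : ∀ {f g : RepAlgebra K A B →ₗ[K] RepAlgebra K A B},
      (∀ u v, f (u * v) = f u * v + u * f v) → (∀ u v, g (u * v) = g u * v + u * g v) →
      (∀ y c, f (gen K A B y c) = g (gen K A B y c)) → f = g := fun {f g} hf hg h =>
    LinearMap.ext fun m => der_ext (AlgHom.id K _) (Lin.coe f) (Lin.coe g) hf hg h m
  let D : A →ₗ[K] B →ₗ[K] (RepAlgebra K A B →ₗ[K] RepAlgebra K A B) := Lin.mk₂ (f := d)
    (fun b => ⟨fun x y => dext (hd' _ _) (fun u v => by
        simp only [LinearMap.add_apply, hd']; ring) (fun z c => by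
        simp only [LinearMap.add_apply, hgen, (l₁ b z c).add]),
      fun k x => dext (hd' _ _) (fun u v => by
        simp only [LinearMap.smul_apply, hd', smul_add, smul_mul_assoc, mul_smul_comm])
        (fun z c => by simp only [LinearMap.smul_apply, hgen, (l₁ b z c).smul])⟩)
    (fun x => ⟨fun a b => dext (hd' _ _) (fun u v => by
        simp only [LinearMap.add_apply, hd']; ring) (fun z c => by
        simp only [LinearMap.add_apply, hgen, (l₂ x z c).add]),
      fun k b => dext (hd' _ _) (fun u v => by
        simp only [LinearMap.smul_apply, hd', smul_add, smul_mul_assoc, mul_smul_comm])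
        (fun z c => by simp only [LinearMap.smul_apply, hgen, (l₂ x z c).smul])⟩)
  have Dgen : ∀ x b y c, D x b (gen K A B y c) = β x b y c := hgen
  -- Second extension: x_b ↦ {x_b, -}, with values in endomorphisms. The relations to be checked are
  -- equalities of derivations, hence may be tested on generators, where antisymmetry turns them
  -- into those already assumed in the second argument.
  obtain ⟨br, hbr, hbg⟩ := exists_der D
    (fun x y b => dext (hd' _ _) (fun u v => by
        simp only [sw_apply, LinearMap.add_apply, LinearMap.smul_apply, smul_eq_mul, sw_mul_right,
          sw_mul_left, ← sw_add]
        refine congrArg (sw K b) (funext₂ fun b' b'' => ?_)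
        change _ * d y b'' (u * v) + _ * d x b' (u * v) = (_ * d y b'' u + _ * d x b' u) * v +
          u * (_ * d y b'' v + _ * d x b' v)
        rw [hd', hd']
        ring) (fun z c => by
        simp only [sw_apply, LinearMap.add_apply, LinearMap.smul_apply, smul_eq_mul]
        rw [Dgen, anti, hmul, ← sw_neg]
        refine congrArg (sw K b) (funext₂ fun b' b'' => ?_)
        change _ = _ * d y b'' (gen K A B z c) + _ * d x b' (gen K A B z c)
        rw [hgen, hgen, anti x, anti y]
        ring))
    (fun x b c => dext (hd' _ _) (fun u v => by
        simp only [sw_apply, LinearMap.add_apply, LinearMap.smul_apply, smul_eq_mul, sw_mul_right,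
          sw_mul_left, ← sw_add]
        refine congrArg (sw K x) (funext₂ fun x' x'' => ?_)
        change _ * d x'' c (u * v) + _ * d x' b (u * v) = (_ * d x'' c u + _ * d x' b u) * v +
          u * (_ * d x'' c v + _ * d x' b v)
        rw [hd', hd']
        ring) (fun z e => by
        simp only [sw_apply, LinearMap.add_apply, LinearMap.smul_apply, smul_eq_mul]
        rw [Dgen, anti, hmul', ← sw_neg]
        refine congrArg (sw K x) (funext₂ fun x' x'' => ?_)
        change _ = _ * d x'' c (gen K A B z e) + _ * d x' b (gen K A B z e)
        rw [hgen, hgen, anti x', anti x'']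
        ring))
  refine ⟨br, ⟨fun u v w => ?_, fun u v w => ?_⟩, fun x b y c => ?_⟩
  · induction u using repAlgebra_induction with
    | hgen x b =>
      rw [hbg]
      exact hd' x b v w
    | halg k =>
      have h1 : br 1 = 0 := by simpa using hbr 1 1
      rw [Algebra.algebraMap_eq_smul_one, map_smul, h1]
      simp
    | hadd u u' hu hu' =>
      simp only [map_add, LinearMap.add_apply, hu, hu']
      ring
    | hmul u u' hu hu' =>
      simp only [hbr, LinearMap.add_apply, LinearMap.smul_apply, smul_eq_mul, hu, hu']
      ring
  · rw [hbr, LinearMap.add_apply, LinearMap.smul_apply, LinearMap.smul_apply, smul_eq_mul,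
      smul_eq_mul, mul_comm v]
  · rw [hbg]
    exact hgen x b y c

end Derivations

end RepAlg

namespace RepAlg

set_option linter.unusedSectionVars false

/-! ### Existence of the induced bracket -/

section SlotDerivation

variable {K B S : Type*} [CommRing K] [CommRing B] [HopfAlgebra K B] [CommRing S] [Algebra K S]

open Slot

/-- Functions of three variables that are derivations along the counit in the second one. -/
def IsSlotDer (F : Slot K B S) : Prop := ∀ b d, IsCounitDer K fun c => F (b ⊗ₜ[K] (c ⊗ₜ[K] d))

theorem isCounitDer_sw {C : Type*} [AddCommGroup C] [Module K C] [Coalgebra K C] (a : C)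
    {F : C → C → B → S} (h : ∀ a b, IsCounitDer K (F a b)) :
    IsCounitDer K fun c => sw K a fun a' a'' => F a' a'' c :=
  ⟨Lin.sw_const (F := fun c a b => F a b c) a fun a b => (h a b).lin, fun b c => by
    simp only [(h _ _).map_mul, sw_add, sw_smul]⟩

theorem IsSlotDer.sw {C : Type*} [AddCommGroup C] [Module K C] [Coalgebra K C] (a : C)
    {F : C → C → Slot K B S} (h : ∀ a b, IsSlotDer (F a b)) : IsSlotDer (sw K a F) := fun b d => by
  have e : ∀ c, (RepAlg.sw K a F) (b ⊗ₜ[K] (c ⊗ₜ[K] d)) =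
      RepAlg.sw K a fun a' a'' => F a' a'' (b ⊗ₜ[K] (c ⊗ₜ[K] d)) := fun c =>
    lin_sw (g := fun G : Slot K B S => G (b ⊗ₜ (c ⊗ₜ d))) (by fun_prop) a
  simp only [e]
  exact isCounitDer_sw a fun a' a'' => h a' a'' b d

theorem IsSlotDer.slot1_mul (f : WithConv (B →ₗ[K] S)) {F : Slot K B S} (h : IsSlotDer F) :
    IsSlotDer (slot1 f * F) := fun b d => by
  simp only [slot1_mul_apply]
  refine isCounitDer_sw b fun b' b'' => ⟨(h b'' d).lin.const_mul _, fun c e => ?_⟩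
  rw [(h b'' d).map_mul, mul_add, mul_smul_comm, mul_smul_comm]

theorem IsSlotDer.mul_slot1 (f : WithConv (B →ₗ[K] S)) {F : Slot K B S} (h : IsSlotDer F) :
    IsSlotDer (F * slot1 f) := fun b d => by
  simp only [mul_slot1_apply]
  refine isCounitDer_sw b fun b' b'' => ⟨(h b' d).lin.mul_const _, fun c e => ?_⟩
  rw [(h b' d).map_mul, add_mul, smul_mul_assoc, smul_mul_assoc]

theorem isSlotDer_form12 {t : B} (ht : IsTraceLike K t) : IsSlotDer (form12 S ht.form) :=
  fun b d => by
    simp only [form12_apply]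
    refine ⟨by fun_prop, fun c e => ?_⟩
    rw [(ht.isCounitDer_form b).map_mul]
    simp only [smul_eq_mul, add_smul, add_mul, mul_smul]

end SlotDerivation

section Existence

variable {K A B S : Type*} [CommRing K] [Ring A] [HopfAlgebra K A] [IsCocomm K A]
  [CommRing B] [HopfAlgebra K B] [CommRing S] [Algebra K S]

open Slot

theorem genSlot1_mul_apply (j : RepAlgebra K A B →ₐ[K] S) (x : A) (F : Slot K B S) (b c d : B) :
    (genSlot1 j x * F) (b ⊗ₜ (c ⊗ₜ d)) = sw K b fun b' b'' =>
      j (gen K A B x b') * F (b'' ⊗ₜ (c ⊗ₜ d)) :=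
  slot1_mul_apply _ _ _ _ _

theorem mul_genSlot1_apply (j : RepAlgebra K A B →ₐ[K] S) (x : A) (F : Slot K B S) (b c d : B) :
    (F * genSlot1 j x) (b ⊗ₜ (c ⊗ₜ d)) = sw K b fun b' b'' =>
      F (b' ⊗ₜ (c ⊗ₜ d)) * j (gen K A B x b'') :=
  mul_slot1_apply _ _ _ _ _

theorem genSlot2_mul_apply (j : RepAlgebra K A B →ₐ[K] S) (x : A) (F : Slot K B S) (b c d : B) :
    (genSlot2 j x * F) (b ⊗ₜ (c ⊗ₜ d)) = sw K c fun c' c'' =>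
      j (gen K A B x c') * F (b ⊗ₜ (c'' ⊗ₜ d)) :=
  slot2_mul_apply _ _ _ _ _

theorem mul_genSlot2_apply (j : RepAlgebra K A B →ₐ[K] S) (x : A) (F : Slot K B S) (b c d : B) :
    (F * genSlot2 j x) (b ⊗ₜ (c ⊗ₜ d)) = sw K c fun c' c'' =>
      F (b ⊗ₜ (c' ⊗ₜ d)) * j (gen K A B x c'') :=
  mul_slot2_apply _ _ _ _ _

theorem isSlotDer_vel (j : RepAlgebra K A B →ₐ[K] S) {t : B} (ht : IsTraceLike K t)
    (ρ : A →ₗ[K] A →ₗ[K] A) (x y : A) : IsSlotDer (vel ρ (genSlot1 j) (form12 S ht.form) x y) := by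
  rw [vel, ad_apply]
  exact IsSlotDer.sw _ fun a b => ((isSlotDer_form12 ht).slot1_mul _).mul_slot1 _

/-- Compatibility of the bracket with y_{ce} = y'_c y''_e. The factor v is a derivation along the
counit, the factor y'' is expanded by the relation, and cocommutativity of A reorders the legs of y.
-/
theorem sw_der_mul {v : A → B → RepAlgebra K A B} (hv : ∀ b, Lin K fun y => v y b)
    (hd : ∀ y, IsCounitDer K (v y)) (y : A) (c e : B) :
    (sw K y fun y' y'' => sw K (c * e) fun c' c'' => v y' c' * gen K A B y'' c'') =
      sw K y fun y' y'' =>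
        gen K A B y' c * (sw K y'' fun a b => sw K e fun e' e'' => v a e' * gen K A B b e'') +
        gen K A B y'' e * (sw K y' fun a b => sw K c fun c' c'' => v a c' * gen K A B b c'') := by
  have lv : ∀ y, Lin K (v y) := fun y => (hd y).lin
  have key : ∀ y' y'' : A, (sw K (c * e) fun c' c'' => v y' c' * gen K A B y'' c'') =
      sw K y'' fun a b => (sw K e fun e' e'' => v y' e' * gen K A B a c * gen K A B b e'') +
        sw K c fun c' c'' => v y' c' * gen K A B a c'' * gen K A B b e := by
    intro y' y''
    have q1 : ∀ a b, (sw K c fun c' c'' => sw K e fun e' e'' => counit (R := K) c' • (v y' e' *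
        (gen K A B a c'' * gen K A B b e''))) = sw K e fun e' e'' => v y' e' * gen K A B a c *
          gen K A B b e'' := fun a b => by
      simp only [← sw_smul, ← mul_assoc]
      exact sw_counit_left (F := fun c => sw K e fun e' e'' => v y' e' * gen K A B a c *
          gen K A B b e'') (by fun_prop) c
    have q2 : ∀ a b, (sw K c fun c' c'' => sw K e fun e' e'' => counit (R := K) e' • (v y' c' *
        (gen K A B a c'' * gen K A B b e''))) = sw K c fun c' c'' => v y' c' * gen K A B a c'' *
          gen K A B b e := fun a b => by
      refine congrArg (sw K c) (funext₂ fun c' c'' => ?_)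
      simp only [← mul_assoc]
      exact sw_counit_left (F := fun e => v y' c' * gen K A B a c'' * gen K A B b e)
        (by fun_prop) e
    have q3 : ∀ c' c'' e' e'' : B, v y' (c' * e') * gen K A B y'' (c'' * e'') =
        sw K y'' fun a b => counit (R := K) c' • (v y' e' * (gen K A B a c'' * gen K A B b e'')) +
          counit (R := K) e' • (v y' c' * (gen K A B a c'' * gen K A B b e'')) := by
      intro c' c'' e' e''
      simp only [(hd y').map_mul, gen_mul_right, sw_mul_left, add_mul, smul_mul_assoc, sw_add]
    rw [sw_prod (F := fun c' c'' => v y' c' * gen K A B y'' c'') (by fun_prop) (by fun_prop)]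
    simp only [q3]
    refine ((congrArg (sw K c) (funext₂ fun c' c'' => sw_sw e y'' _)).trans
      (sw_sw c y'' _)).trans ?_
    refine congrArg (sw K y'') (funext₂ fun a b => ?_)
    rw [← q1, ← q2]
    simp only [sw_add]
  let T₁ : A → A → A → RepAlgebra K A B := fun y a b =>
    sw K e fun e' e'' => v y e' * gen K A B a c * gen K A B b e''
  let T₂ : A → A → A → RepAlgebra K A B := fun y a b =>
    sw K c fun c' c'' => v y c' * gen K A B a c'' * gen K A B b e
  have r1 : ∀ y' y'' : A, gen K A B y' c * (sw K y'' fun a b => sw K e fun e' e'' =>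
      v a e' * gen K A B b e'') = sw K y'' fun a b => T₁ a y' b := fun y' y'' => by
    simp only [sw_mul_left, T₁]
    refine congrArg (sw K _) (funext₂ fun a b => congrArg (sw K _) (funext₂ fun e' e'' => ?_))
    ring
  have r2 : ∀ y' y'' : A, gen K A B y'' e * (sw K y' fun a b => sw K c fun c' c'' =>
      v a c' * gen K A B b c'') = sw K y' fun a b => T₂ a b y'' := fun y' y'' => by
    simp only [sw_mul_left, T₂]
    refine congrArg (sw K _) (funext₂ fun a b => congrArg (sw K _) (funext₂ fun e' e'' => ?_))
    ring
  simp only [key, r1, r2, sw_add]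
  have s1 : (sw K y fun y' w => sw K w fun a b => T₁ y' a b) =
      sw K y fun y' w => sw K w fun a b => T₁ a y' b := by
    rw [← sw_assoc (F := T₁) (by fun_prop) (by fun_prop) (by fun_prop),
      ← sw_assoc (F := fun a b d => T₁ b a d) (by fun_prop) (by fun_prop) (by fun_prop)]
    refine congrArg (sw K y) (funext₂ fun w b => ?_)
    exact (sw_comm (F := fun p q => T₁ p q b) (by fun_prop) (by fun_prop) w).symm
  have s2 : (sw K y fun y' w => sw K w fun a b => T₂ y' a b) =
      sw K y fun w b => sw K w fun y' a => T₂ y' a b :=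
    (sw_assoc (F := T₂) (by fun_prop) (by fun_prop) (by fun_prop) y).symm
  exact congrArg₂ (· + ·) s1 s2

/-- The bracket of `x_b` and `y_c`. -/
noncomputable def genBracket {t : B} (ht : IsTraceLike K t) (ρ : A →ₗ[K] A →ₗ[K] A) (x : A) (b : B)
    (y : A) (c : B) : RepAlgebra K A B :=
  brak ρ (genSlot1 (AlgHom.id K _)) (genSlot2 (AlgHom.id K _)) (form12 _ ht.form) x y
    (b ⊗ₜ (c ⊗ₜ 1))

theorem swap_genSlot1 (j : RepAlgebra K A B →ₐ[K] S) (a : A) :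
    swap (genSlot1 j a) = genSlot2 j a := swap_slot1 _

theorem swap_genSlot2 (j : RepAlgebra K A B →ₐ[K] S) (a : A) :
    swap (genSlot2 j a) = genSlot1 j a := swap_slot2 _

/-- After `brak_antisymm`, exchanging the first two slots interchanges the generators and fixes Ω₁₂,
because • is symmetric. -/
theorem genBracket_antisymm {t : B} (ht : IsTraceLike K t) {ρ : A →ₗ[K] A →ₗ[K] A}
    (hρ : IsQuasiPoissonFox ρ) (x : A) (b : B) (y : A) (c : B) :
    genBracket ht ρ x b y c = -genBracket ht ρ y c x b := by
  have h1 : swap.comp (genSlot1 (AlgHom.id K (RepAlgebra K A B))) = genSlot2 (AlgHom.id K _) :=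
    AlgHom.ext fun a => swap_genSlot1 _ a
  have h2 : swap.comp (genSlot2 (AlgHom.id K (RepAlgebra K A B))) = genSlot1 (AlgHom.id K _) :=
    AlgHom.ext fun a => swap_genSlot2 _ a
  have h := map_brak swap ρ (genSlot1 (AlgHom.id K (RepAlgebra K A B))) (genSlot2 (AlgHom.id K _))
    (form12 _ ht.form) y x
  rw [h1, h2, swap_form12 ht.form_comm] at h
  rw [genBracket, genBracket, (isSlotSystem (AlgHom.id K _) ht).brak_antisymm hρ, ← h]
  change -(swap _) _ = _
  rw [swap_apply]

theorem genBracket_eq {t : B} (ht : IsTraceLike K t) (ρ : A →ₗ[K] A →ₗ[K] A)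
    (x : A) (b : B) (y : A) (c : B) :
    genBracket ht ρ x b y c = sw K y fun y' y'' => sw K c fun c' c'' =>
      (sw K x fun x' x'' => vel ρ (genSlot1 (AlgHom.id K _)) (form12 _ ht.form) x' y' *
        genSlot1 (AlgHom.id K _) x'' : Slot K B (RepAlgebra K A B)) (b ⊗ₜ (c' ⊗ₜ 1)) *
        gen K A B y'' c'' := by
  rw [genBracket, brak, sw_sw, lin_sw (g := fun G : Slot K B (RepAlgebra K A B) =>
    G (b ⊗ₜ (c ⊗ₜ 1))) (by fun_prop)]
  refine congrArg (sw K y) (funext₂ fun y' y'' => ?_)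
  rw [← sw_mul_right]
  exact mul_genSlot2_apply _ _ _ _ _ _

theorem genBracket_mul_right {t : B} (ht : IsTraceLike K t) (ρ : A →ₗ[K] A →ₗ[K] A)
    (x : A) (b : B) (y : A) (c e : B) :
    genBracket ht ρ x b y (c * e) = sw K y fun y' y'' =>
      gen K A B y' c * genBracket ht ρ x b y'' e + gen K A B y'' e * genBracket ht ρ x b y' c := by
  simp only [genBracket_eq]
  refine sw_der_mul (v := fun y c => (sw K x fun x' x'' => vel ρ (genSlot1 (AlgHom.id K _))
    (form12 _ ht.form) x' y * genSlot1 (AlgHom.id K _) x'' : Slot K B (RepAlgebra K A B))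
      (b ⊗ₜ (c ⊗ₜ 1))) (by fun_prop) (fun y => ?_) y c e
  exact IsSlotDer.sw _ (fun x' x'' => (isSlotDer_vel _ ht ρ x' y).mul_slot1 _) b 1

theorem genBracket_mul_left {t : B} (ht : IsTraceLike K t) {ρ : A →ₗ[K] A →ₗ[K] A}
    (hρ : IsFoxPairing ρ) (x : A) (b : B) (y z : A) (c : B) :
    genBracket ht ρ x b (y * z) c = sw K c fun c' c'' =>
      gen K A B y c' * genBracket ht ρ x b z c'' + gen K A B z c'' * genBracket ht ρ x b y c' := by
  rw [genBracket, (isSlotSystem (AlgHom.id K _) ht).brak_mul_right hρ]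
  refine (Slot.add_apply _ _ _).trans ?_
  rw [mul_genSlot2_apply, genSlot2_mul_apply, add_comm, ← sw_add]
  refine congrArg (sw K c) (funext₂ fun c' c'' => ?_)
  rw [mul_comm (gen K A B z c'')]
  rfl

theorem exists_genBracket {t : B} (ht : IsTraceLike K t) {ρ : A →ₗ[K] A →ₗ[K] A}
    (hρ : IsQuasiPoissonFox ρ) :
    ∃ br : RepAlgebra K A B →ₗ[K] RepAlgebra K A B →ₗ[K] RepAlgebra K A B, IsBracket br ∧
      ∀ x b y c, br (gen K A B x b) (gen K A B y c) = genBracket ht ρ x b y c :=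
  exists_bracket (genBracket ht ρ) (fun b y c => by unfold genBracket brak; fun_prop)
    (fun x y c => by unfold genBracket; fun_prop) (genBracket_antisymm ht hρ)
    (genBracket_mul_left ht hρ.toIsFoxPairing) (genBracket_mul_right ht ρ)

/-- Both sides invert x ↦ (b ↦ x_b) in the convolution algebra over A, one from the left and one
from the right. For the right side this uses x'_{b} x''_{c} = x_{bc} and b' s(b'') = ε(b) 1. -/
theorem gen_antipode (x : A) (b : B) : gen K A B (antipode K x) b = gen K A B x (antipode K b) := by
  let X : A →ₐ[K] WithConv (B →ₗ[K] RepAlgebra K A B) := genHom (AlgHom.id K _)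
  let Y : WithConv (A →ₗ[K] WithConv (B →ₗ[K] RepAlgebra K A B)) := toConv (Lin.mk'
    (f := fun x => toConv (gen K A B x ∘ₗ antipode K)) ⟨fun x y => by
      refine WithConv.ext (LinearMap.ext fun b => ?_)
      change gen K A B (x + y) (antipode K b) = gen K A B x _ + gen K A B y _
      rw [map_add]; rfl, fun k x => by
      refine WithConv.ext (LinearMap.ext fun b => ?_)
      change gen K A B (k • x) (antipode K b) = k • gen K A B x _
      rw [map_smul]; rfl⟩)
  have h : hv X * Y = 1 := by
    refine WithConv.ext (LinearMap.ext fun x => WithConv.ext (LinearMap.ext fun b => ?_))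
    change (hv X * Y : WithConv (A →ₗ[K] WithConv (B →ₗ[K] RepAlgebra K A B))) x b =
      (algebraMap K (WithConv (B →ₗ[K] RepAlgebra K A B)) (counit x)) b
    rw [conv_apply, lin_sw (g := fun f : WithConv (B →ₗ[K] RepAlgebra K A B) => f b) (by fun_prop),
      Algebra.algebraMap_eq_smul_one]
    have e : ∀ x' x'' : A, (hv X x' * Y x'' : WithConv (B →ₗ[K] RepAlgebra K A B)) b =
        sw K b fun b' b'' => gen K A B x' b' * gen K A B x'' (antipode K b'') :=
      fun x' x'' => conv_apply _ _ _
    simp only [e]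
    rw [sw_sw]
    simp only [← gen_mul_right]
    rw [← lin_sw (Lin.coe (gen K A B x)), sw_mul_antipode_eq, map_smul, gen_one_right]
    change _ = counit (R := K) x • algebraMap K (RepAlgebra K A B) (counit b)
    rw [Algebra.algebraMap_eq_smul_one, Algebra.algebraMap_eq_smul_one, smul_comm]
  have h' : hvInv X = Y := left_inv_eq_right_inv (hvInv_mul_hv X) h
  have := congrArg (fun f : WithConv (A →ₗ[K] WithConv (B →ₗ[K] RepAlgebra K A B)) => f x b) h'
  exact this

theorem ad_form_apply {t : B} (ht : IsTraceLike K t) (a : A) (b c : B) :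
    (ad (genSlot1 (AlgHom.id K _)) a (form12 _ ht.form) : Slot K B (RepAlgebra K A B))
      (b ⊗ₜ (c ⊗ₜ 1)) = sw3 K b fun b₁ b₂ b₃ => ht.form c b₂ •
        gen K A B a (antipode K b₃ * b₁) := by
  rw [ad_apply, lin_sw (g := fun F : Slot K B (RepAlgebra K A B) => F (b ⊗ₜ (c ⊗ₜ 1)))
    (by fun_prop)]
  simp only [mul_assoc, genSlot1_mul_apply, mul_genSlot1_apply, sw_mul_left, form12_apply,
    Bialgebra.counit_one, mul_one, smul_mul_assoc, one_mul, mul_smul_comm, AlgHom.id_apply]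
  rw [sw_sw, sw3]
  refine congrArg (sw K b) (funext₂ fun b₁ d => ?_)
  rw [sw_sw]
  refine congrArg (sw K d) (funext₂ fun b₂ b₃ => ?_)
  rw [mul_comm (antipode K b₃), gen_mul_right, sw_smul, ht.form_comm c]
  simp only [gen_antipode]

theorem genBracket_formula {t : B} (ht : IsTraceLike K t) {ρ : A →ₗ[K] A →ₗ[K] A}
    (hρ : IsFoxPairing ρ) (x y : A) (b c : B) : genBracket ht ρ x b y c =
    sw K x fun x' x'' => sw K y fun y' y'' => sw4 K b fun b₁ b₂ b₃ b₄ => sw K c fun c' c'' =>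
      ht.form c'' b₂ • (gen K A B (ρ x' y') (antipode K b₃ * b₁) * gen K A B x'' b₄ *
        gen K A B y'' c') := by
  rw [genBracket, (isSlotSystem (AlgHom.id K _) ht).brak_eq hρ, lin_sw
    (g := fun F : Slot K B (RepAlgebra K A B) => F (b ⊗ₜ (c ⊗ₜ 1))) (by fun_prop)]
  refine congrArg (sw K x) (funext₂ fun x' x'' => ?_)
  rw [lin_sw (g := fun F : Slot K B (RepAlgebra K A B) => F (b ⊗ₜ (c ⊗ₜ 1))) (by fun_prop)]
  refine congrArg (sw K y) (funext₂ fun y' y'' => ?_)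
  have e : ∀ c' c'' : B, gen K A B y'' c' * (sw K b fun e b₄ => (sw3 K e fun b₁ b₂ b₃ =>
      ht.form c'' b₂ • gen K A B (ρ x' y') (antipode K b₃ * b₁)) * gen K A B x'' b₄) =
      sw4 K b fun b₁ b₂ b₃ b₄ => ht.form c'' b₂ • (gen K A B (ρ x' y') (antipode K b₃ * b₁) *
        gen K A B x'' b₄ * gen K A B y'' c') := by
    intro c' c''
    have h1 := sw_assoc (K := K) (F := fun b₁ d b₄ => sw K d fun b₂ b₃ => ht.form c'' b₂ •
      (gen K A B (ρ x' y') (antipode K b₃ * b₁) * gen K A B x'' b₄ * gen K A B y'' c'))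
      (by fun_prop) (by fun_prop) (by fun_prop) b
    have h2 : ∀ b₁ f, _ := fun b₁ f => sw_assoc (K := K) (F := fun b₂ b₃ b₄ => ht.form c'' b₂ •
      (gen K A B (ρ x' y') (antipode K b₃ * b₁) * gen K A B x'' b₄ * gen K A B y'' c'))
      (by fun_prop) (by fun_prop) (by fun_prop) f
    simp only [h2] at h1
    refine Eq.trans ?_ h1
    simp only [sw3, sw_mul_left, sw_mul_right]
    refine congrArg (sw K b) (funext₂ fun e b₄ => congrArg (sw K e) (funext₂ fun b₁ d =>
      congrArg (sw K d) (funext₂ fun b₂ b₃ => ?_)))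
    rw [smul_mul_assoc, mul_smul_comm, mul_comm (gen K A B y'' c')]
  simp only [genSlot2_mul_apply, mul_genSlot1_apply, ad_form_apply, AlgHom.id_apply, e]
  simp only [sw4, sw3]
  rw [sw_sw]
  refine congrArg (sw K b) (funext₂ fun b₁ d => ?_)
  rw [sw_sw]
  refine congrArg (sw K d) (funext₂ fun b₂ f => ?_)
  rw [sw_sw]

theorem isInducedBracket_iff {t : B} (ht : IsTraceLike K t) {ρ : A →ₗ[K] A →ₗ[K] A}
    (hρ : IsFoxPairing ρ) (br : RepAlgebra K A B →ₗ[K] RepAlgebra K A B →ₗ[K] RepAlgebra K A B) :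
    IsInducedBracket ρ ht.form br ↔ IsBracket br ∧
      ∀ x b y c, br (gen K A B x b) (gen K A B y c) = genBracket ht ρ x b y c :=
  ⟨fun h => ⟨h.toIsBracket, fun x b y c => by rw [genBracket_formula ht hρ]; exact h.apply_gen _ _ _ _⟩,
    fun h => ⟨h.1, fun x y b c => by rw [← genBracket_formula ht hρ]; exact h.2 _ _ _ _⟩⟩

theorem existsUnique_inducedBracket {t : B} (ht : IsTraceLike K t) {ρ : A →ₗ[K] A →ₗ[K] A}
    (hρ : IsQuasiPoissonFox ρ) :
    ∃! br : RepAlgebra K A B →ₗ[K] RepAlgebra K A B →ₗ[K] RepAlgebra K A B,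
      IsInducedBracket ρ ht.form br := by
  obtain ⟨br, h, hg⟩ := exists_genBracket (A := A) ht hρ
  refine ⟨br, (isInducedBracket_iff ht hρ.toIsFoxPairing br).2 ⟨h, hg⟩, fun br' h' => ?_⟩
  have h'' := (isInducedBracket_iff ht hρ.toIsFoxPairing br').1 h'
  exact h''.1.induced_ext h fun x b y c => by rw [h''.2, hg]

end Existence

end RepAlg

namespace RepAlg

set_option linter.unusedSectionVars false

/-! ### Antisymmetry and equivariance -/

section Antisymmetry

variable {K A B : Type*} [CommRing K] [Ring A] [HopfAlgebra K A] [IsCocomm K A]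
  [CommRing B] [HopfAlgebra K B]

/-- The negative of the flipped bracket is again a bracket, and brackets are determined by their
values on generators. -/
theorem IsBracket.antisymm_of_gen {br : RepAlgebra K A B →ₗ[K] RepAlgebra K A B →ₗ[K]
    RepAlgebra K A B} (h : IsBracket br)
    (e : ∀ x b y c, br (gen K A B x b) (gen K A B y c) = -br (gen K A B y c) (gen K A B x b))
    (u v : RepAlgebra K A B) : br u v = -br v u := by
  have h' : IsBracket (-br.flip) := ⟨fun x y z => by
    simp only [LinearMap.neg_apply, LinearMap.flip_apply, h.leibniz_left]; ring, fun x y z => by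
    simp only [LinearMap.neg_apply, LinearMap.flip_apply, h.leibniz_right]; ring⟩
  exact congr($(h.induced_ext h' e) u v)

end Antisymmetry

section Equivariance

variable {K A B S T : Type*} [CommRing K] [Ring A] [HopfAlgebra K A] [IsCocomm K A]
  [CommRing B] [HopfAlgebra K B] [CommRing S] [Algebra K S] [CommRing T] [Algebra K T]

open Slot

/-- Postcomposition with an algebra homomorphism. -/
noncomputable def Slot.postHom (h : S →ₐ[K] T) : Slot K B S →ₐ[K] Slot K B T :=
  AlgHom.ofLinearMap (Lin.mk' (f := post h) ⟨fun _ _ => Slot.ext fun _ _ _ => map_add h _ _,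
    fun _ _ => Slot.ext fun _ _ _ => map_smul h _ _⟩) (post_one h) (post_mul h)

theorem Slot.postHom_apply (h : S →ₐ[K] T) (F : Slot K B S) (z : B ⊗[K] (B ⊗[K] B)) :
    Slot.postHom h F z = h (F z) := rfl

theorem postHom_genSlot1 (h : S →ₐ[K] T) (j : RepAlgebra K A B →ₐ[K] S) :
    (Slot.postHom h).comp (genSlot1 j) = genSlot1 (h.comp j) :=
  AlgHom.ext fun x => Slot.ext fun b c d => by
    change h (slot1 (genHom j x) _) = slot1 (genHom (h.comp j) x) _
    rw [slot1_apply, slot1_apply, map_smul]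
    rfl

theorem postHom_genSlot2 (h : S →ₐ[K] T) (j : RepAlgebra K A B →ₐ[K] S) :
    (Slot.postHom h).comp (genSlot2 j) = genSlot2 (h.comp j) :=
  AlgHom.ext fun x => Slot.ext fun b c d => by
    change h (slot2 (genHom j x) _) = slot2 (genHom (h.comp j) x) _
    rw [slot2_apply, slot2_apply, map_smul]
    rfl

theorem postHom_form12 (h : S →ₐ[K] T) (ω : B →ₗ[K] B →ₗ[K] K) :
    Slot.postHom h (form12 S ω) = form12 T ω :=
  Slot.ext fun b c d => by
    rw [Slot.postHom_apply, form12_apply, form12_apply, map_smul, map_one]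

theorem map_genBracket {t : B} (ht : IsTraceLike K t) (ρ : A →ₗ[K] A →ₗ[K] A)
    (h : RepAlgebra K A B →ₐ[K] S) (x : A) (b : B) (y : A) (c : B) :
    h (genBracket ht ρ x b y c) =
      brak ρ (genSlot1 h) (genSlot2 h) (form12 _ ht.form) x y (b ⊗ₜ (c ⊗ₜ 1)) := by
  have := map_brak (Slot.postHom h) ρ (genSlot1 (AlgHom.id K (RepAlgebra K A B)))
    (genSlot2 (AlgHom.id K _)) (form12 _ ht.form) x y
  rw [postHom_genSlot1, postHom_genSlot2, postHom_form12, AlgHom.comp_id] at this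
  rw [← this, Slot.postHom_apply]
  rfl

/-- Conjugation by a unit. -/
noncomputable def conjHom {E : Type*} [Ring E] [Algebra K E] {g g' : E} (h : g' * g = 1)
    (h' : g * g' = 1) : E →ₐ[K] E :=
  AlgHom.ofLinearMap (Lin.mk' (f := fun e => g' * e * g) (by fun_prop))
    (by rw [Lin.mk'_apply, mul_one, h])
    (fun e f => by
      simp only [Lin.mk'_apply, mul_assoc]
      rw [← mul_assoc g, h', one_mul])

theorem conjHom_apply {E : Type*} [Ring E] [Algebra K E] {g g' : E} (h : g' * g = 1)
    (h' : g * g' = 1) (e : E) : conjHom (K := K) h h' e = g' * e * g := rfl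

/-- As in `commute_gen_total`: f(b) f(c) = f(bc), so the claim is the image of `form_invariant`
under f. -/
theorem commute_cv_total (f : B →ₐ[K] S) {t : B} (ht : IsTraceLike K t) :
    Commute (slot1 (cv f) * slot2 (cv f)) (form12 S ht.form) := by
  have e : ∀ b c d : B, (slot1 (cv f) * slot2 (cv f)) (b ⊗ₜ (c ⊗ₜ d)) =
      counit (R := K) d • f (b * c) := by
    intro b c d
    rw [slot1_mul_apply]
    simp only [slot2_apply, mul_smul, mul_smul_comm]
    rw [sw_counit_right (F := fun b => counit (R := K) d • (cv f b * cv f c)) (by fun_prop),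
      map_mul]
    rfl
  refine Slot.ext fun b c d => ?_
  rw [form12_mul_apply, mul_form12_apply]
  simp only [e]
  have h := congrArg (counit (R := K) d • f.toLinearMap) (ht.form_invariant b c)
  simp only [map_sw, map_smul] at h
  exact h

/-- The bracket `{m ⊗ a, n ⊗ b} = {m, n} ⊗ a b`. -/
noncomputable def extBracket (br : RepAlgebra K A B →ₗ[K] RepAlgebra K A B →ₗ[K] RepAlgebra K A B) :
    RepAlgebra K A B ⊗[K] B →ₗ[K] RepAlgebra K A B ⊗[K] B →ₗ[K] RepAlgebra K A B ⊗[K] B :=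
  TensorProduct.map₂ br (LinearMap.mul K B)

variable {br : RepAlgebra K A B →ₗ[K] RepAlgebra K A B →ₗ[K] RepAlgebra K A B}

theorem extBracket_tmul (m n : RepAlgebra K A B) (a b : B) :
    extBracket br (m ⊗ₜ a) (n ⊗ₜ b) = br m n ⊗ₜ (a * b) := rfl

theorem extBracket_mul_right (h : IsBracket br) (u v w : RepAlgebra K A B ⊗[K] B) :
    extBracket br u (v * w) = extBracket br u v * w + v * extBracket br u w := by
  induction u with
  | zero => simp
  | add u u' hu hu' => simp only [map_add, LinearMap.add_apply, hu, hu']; ring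
  | tmul m a =>
    induction v with
    | zero => simp
    | add v v' hv hv' => simp only [map_add, add_mul, hv, hv']; ring
    | tmul n b =>
      induction w with
      | zero => simp
      | add w w' hw hw' => simp only [map_add, mul_add, hw, hw']; ring
      | tmul k c =>
        simp only [extBracket_tmul, Algebra.TensorProduct.tmul_mul_tmul, h.leibniz_right,
          TensorProduct.add_tmul]
        congr 2 <;> ring

theorem extBracket_mul_left (h : IsBracket br) (u v w : RepAlgebra K A B ⊗[K] B) :
    extBracket br (u * v) w = extBracket br u w * v + u * extBracket br v w := by
  induction u with
  | zero => simp
  | add u u' hu hu' => simp only [map_add, add_mul, LinearMap.add_apply, hu, hu']; ring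
  | tmul m a =>
    induction v with
    | zero => simp
    | add v v' hv hv' => simp only [map_add, mul_add, LinearMap.add_apply, hv, hv']; ring
    | tmul n b =>
      induction w with
      | zero => simp
      | add w w' hw hw' => simp only [map_add, add_mul, mul_add, hw, hw']; ring
      | tmul k c =>
        simp only [extBracket_tmul, Algebra.TensorProduct.tmul_mul_tmul, h.leibniz_left,
          TensorProduct.add_tmul]
        rw [add_comm]
        congr 2 <;> ring

theorem commute_slots (f g : WithConv (B →ₗ[K] T)) : Commute (slot1 f) (slot2 g) :=
  commute_slot12 fun _ _ => Commute.all _ _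

theorem cvInv_slots_mul (r : B →ₐ[K] T) :
    (slot1 (cvInv r) * slot2 (cvInv r)) * (slot1 (cv r) * slot2 (cv r)) = (1 : Slot K B T) := by
  rw [(commute_slots (cvInv r) (cvInv r)).eq, mul_assoc, ← mul_assoc (slot1 (cvInv r)), ← map_mul,
    cvInv_mul_cv, map_one, one_mul, ← map_mul, cvInv_mul_cv, map_one]

theorem cv_slots_mul (r : B →ₐ[K] T) :
    (slot1 (cv r) * slot2 (cv r)) * (slot1 (cvInv r) * slot2 (cvInv r)) = (1 : Slot K B T) := by
  rw [(commute_slots (cv r) (cv r)).eq, mul_assoc, ← mul_assoc (slot1 (cv r)), ← map_mul,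
    cv_mul_cvInv, map_one, one_mul, ← map_mul, cv_mul_cvInv, map_one]

/-- Conjugation by the product of the two copies of r is an algebra automorphism. It carries the
generators of i to those of δ in both slots and fixes Ω₁₂ by `commute_cv_total`, so it carries one
bracket to the other. -/
theorem brak_conj {t : B} (ht : IsTraceLike K t) (ρ : A →ₗ[K] A →ₗ[K] A)
    {i δ : RepAlgebra K A B →ₐ[K] T} {r : B →ₐ[K] T}
    (hδ : ∀ x, genHom δ x = cvInv r * (genHom i x * cv r)) (x y : A) :
    brak ρ (genSlot1 δ) (genSlot2 δ) (form12 T ht.form) x y =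
      (slot1 (cvInv r) * slot2 (cvInv r)) * brak ρ (genSlot1 i) (genSlot2 i) (form12 T ht.form) x y
        * (slot1 (cv r) * slot2 (cv r)) := by
  have h := cvInv_slots_mul r
  have h' := cv_slots_mul r
  have g1 : (conjHom (K := K) h h').comp (genSlot1 i) = genSlot1 δ := AlgHom.ext fun x => by
    change (slot1 (cvInv r) * slot2 (cvInv r)) * slot1 (genHom i x) * (slot1 (cv r) * slot2 (cv r)) =
      slot1 (genHom δ x)
    rw [hδ, map_mul, map_mul, mul_assoc (slot1 (cvInv r)), ← (commute_slots (genHom i x) _).eq,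
      ← mul_assoc (slot1 (cvInv r)), mul_assoc, ← mul_assoc (slot2 (cvInv r)),
      ← (commute_slots (cv r) _).eq,
      mul_assoc (slot1 (cv r)), ← map_mul slot2, cvInv_mul_cv, map_one, mul_one, mul_assoc]
  have g2 : (conjHom (K := K) h h').comp (genSlot2 i) = genSlot2 δ := AlgHom.ext fun x => by
    change (slot1 (cvInv r) * slot2 (cvInv r)) * slot2 (genHom i x) * (slot1 (cv r) * slot2 (cv r)) =
      slot2 (genHom δ x)
    rw [hδ, map_mul, map_mul, (commute_slots (cvInv r) _).eq, mul_assoc (slot2 (cvInv r)),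
      (commute_slots (cvInv r) _).eq, mul_assoc (slot2 (cvInv r)), mul_assoc (slot2 (genHom i x)),
      ← mul_assoc (slot1 (cvInv r)), ← map_mul slot1, cvInv_mul_cv, map_one, one_mul]
  have g3 : conjHom (K := K) h h' (form12 T ht.form) = form12 T ht.form := by
    rw [conjHom_apply, mul_assoc, ← (commute_cv_total r ht).eq, ← mul_assoc, h, one_mul]
  have hb := map_brak (conjHom (K := K) h h') ρ (genSlot1 i) (genSlot2 i) (form12 T ht.form) x y
  rw [g1, g2, g3, conjHom_apply] at hb
  exact hb.symm

theorem map_genBracket_conj {t : B} (ht : IsTraceLike K t) (ρ : A →ₗ[K] A →ₗ[K] A)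
    {i δ : RepAlgebra K A B →ₐ[K] T} {r : B →ₐ[K] T}
    (hδ : ∀ x, genHom δ x = cvInv r * (genHom i x * cv r)) (x : A) (b : B) (y : A) (c : B) :
    δ (genBracket ht ρ x b y c) = sw3 K b fun b₁ b₂ b₃ => sw3 K c fun c₁ c₂ c₃ =>
      i (genBracket ht ρ x b₂ y c₂) * r ((antipode K b₁ * b₃) * (antipode K c₁ * c₃)) := by
  rw [map_genBracket, brak_conj ht ρ hδ]
  have e1 : ∀ F : Slot K B T, (slot1 (cvInv r) * slot2 (cvInv r) * F *
      (slot1 (cv r) * slot2 (cv r))) (b ⊗ₜ (c ⊗ₜ 1)) = sw K b fun b₁ d => r (antipode K b₁) *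
        sw K c fun c₁ e => r (antipode K c₁) * sw K e fun c₂ c₃ => (sw K d fun b₂ b₃ =>
          F (b₂ ⊗ₜ (c₂ ⊗ₜ 1)) * r b₃) * r c₃ := fun F => by
    rw [mul_assoc (slot1 (cvInv r)), mul_assoc (slot1 (cvInv r)), mul_assoc (slot2 (cvInv r)),
      slot1_mul_apply]
    refine congrArg (sw K b) (funext₂ fun b₁ d => ?_)
    rw [slot2_mul_apply]
    refine congrArg (_ * ·) (congrArg (sw K c) (funext₂ fun c₁ e => ?_))
    rw [← mul_assoc F, mul_slot2_apply]
    refine congrArg (_ * ·) (congrArg (sw K e) (funext₂ fun c₂ c₃ => ?_))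
    rw [mul_slot1_apply]
    rfl
  rw [e1]
  simp only [← map_genBracket, sw_mul_left, sw_mul_right, sw3]
  refine congrArg (sw K b) (funext₂ fun b₁ d => ?_)
  have sw3sw : ∀ F : B → B → B → B → B → T, (sw K c fun c₁ e => sw K e fun c₂ c₃ => sw K d fun b₂ b₃ =>
      F c₁ c₂ c₃ b₂ b₃) = sw K d fun b₂ b₃ => sw K c fun c₁ e => sw K e fun c₂ c₃ =>
        F c₁ c₂ c₃ b₂ b₃ := fun F =>
    (congrArg (sw K c) (funext₂ fun c₁ e => sw_sw e d _)).trans (sw_sw c d _)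
  refine Eq.trans ?_ (sw3sw fun c₁ c₂ c₃ b₂ b₃ => i (genBracket ht ρ x b₂ y c₂) *
    r ((antipode K b₁ * b₃) * (antipode K c₁ * c₃)))
  refine congrArg (sw K c) (funext₂ fun c₁ e => congrArg (sw K e) (funext₂ fun c₂ c₃ =>
    congrArg (sw K d) (funext₂ fun b₂ b₃ => ?_)))
  simp only [map_mul]
  ring

theorem genHom_coactHom (x : A) : genHom (coactHom (K := K) (A := A) (B := B)) x =
    cvInv Algebra.TensorProduct.includeRight *
      (genHom Algebra.TensorProduct.includeLeft x * cv Algebra.TensorProduct.includeRight) := by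
  have h := post_coactHom (AlgHom.id K (RepAlgebra K A B ⊗[K] B)) x
  rw [AlgHom.id_comp, AlgHom.id_comp, AlgHom.id_comp] at h
  exact h

theorem coactHom_genBracket {t : B} (ht : IsTraceLike K t) (ρ : A →ₗ[K] A →ₗ[K] A)
    (x : A) (b : B) (y : A) (c : B) :
    coactHom (genBracket ht ρ x b y c) = sw3 K b fun b₁ b₂ b₃ => sw3 K c fun c₁ c₂ c₃ =>
      genBracket ht ρ x b₂ y c₂ ⊗ₜ ((antipode K b₁ * b₃) * (antipode K c₁ * c₃)) := by
  have hδ (x : A) := genHom_coactHom (K := K) (B := B) x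
  have key := map_genBracket_conj (T := RepAlgebra K A B ⊗[K] B) ht ρ
    (i := Algebra.TensorProduct.includeLeft) (δ := coactHom)
    (r := Algebra.TensorProduct.includeRight) hδ x b y c
  rw [key]
  simp only [Algebra.TensorProduct.includeLeft_apply, Algebra.TensorProduct.includeRight_apply,
    Algebra.TensorProduct.tmul_mul_tmul, mul_one, one_mul]

/-- The coaction is compatible with the bracket. -/
theorem coactHom_bracket {t : B} (ht : IsTraceLike K t) {ρ : A →ₗ[K] A →ₗ[K] A} (h : IsBracket br)
    (hg : ∀ x b y c, br (gen K A B x b) (gen K A B y c) = genBracket ht ρ x b y c)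
    (u v : RepAlgebra K A B) : coactHom (br u v) = extBracket br (coactHom u) (coactHom v) := by
  have lc : Lin K (coactHom (K := K) (A := A) (B := B)) := Lin.coe_alg _ Lin.id
  refine der_ext coactHom (f := fun u => coactHom (br u v))
    (g := fun u => extBracket br (coactHom u) (coactHom v)) (by fun_prop)
    (by fun_prop) (fun u w => ?_) (fun u w => ?_) (fun x b => ?_) u
  · rw [h.leibniz_left, map_add, map_mul, map_mul, add_comm]
  · rw [map_mul, extBracket_mul_left h]
  · refine der_ext coactHom (f := fun v => coactHom (br (gen K A B x b) v))
      (g := fun v => extBracket br (coactHom (gen K A B x b)) (coactHom v)) (by fun_prop)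
      (by fun_prop) (fun u w => ?_) (fun u w => ?_) (fun y c => ?_) v
    · rw [h.leibniz_right, map_add, map_mul, map_mul]
    · rw [map_mul, extBracket_mul_right h]
    · rw [hg, coactHom_genBracket, coactHom_gen, coactHom_gen]
      simp only [sw3, map_sw (extBracket br), sw_apply]
      simp only [map_sw, extBracket_tmul, hg]

theorem sweedler_mul_antipode (z : RepAlgebra K A B ⊗[K] B) (q : B) :
    sweedler z (fun m a => m ⊗ₜ[K] (a * antipode K q)) =
      z * ((1 : RepAlgebra K A B) ⊗ₜ[K] antipode K q) := by
  conv_rhs => rw [(TensorProduct.exists_finset (R := K) z).choose_spec]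
  simp only [sweedler, Finset.sum_mul, Algebra.TensorProduct.tmul_mul_tmul, mul_one]

theorem extBracket_mul_one_tmul (u w : RepAlgebra K A B ⊗[K] B) (a : B) :
    extBracket br (u * (1 ⊗ₜ a)) w = extBracket br u w * (1 ⊗ₜ a) := by
  induction u with
  | zero => simp
  | add u u' hu hu' => simp only [map_add, add_mul, LinearMap.add_apply, hu, hu']
  | tmul m b =>
    induction w with
    | zero => simp
    | add w w' hw hw' => simp only [map_add, add_mul, hw, hw']
    | tmul n c =>
      simp only [extBracket_tmul, Algebra.TensorProduct.tmul_mul_tmul, mul_one]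
      congr 1
      ring

/-- The extended bracket is B-linear in its first argument, so the factor m₁ʳ pulled out of it meets
s of the next leg, and coassociativity and the counit remove both. -/
theorem isEquivariant_of_coactHom
    (h : ∀ u v, coactHom (br u v) = extBracket br (coactHom u) (coactHom v)) :
    IsEquivariant (repCoaction K A B) br := by
  intro m₁ m₂
  change sweedler (coactHom m₂) (fun m₂l m₂r => br m₁ m₂l ⊗ₜ[K] m₂r) =
    sweedler (coactHom m₁) fun m₁l m₁r => sweedler (coactHom (br m₁l m₂)) fun nl nr =>
      nl ⊗ₜ[K] (nr * antipode K m₁r)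
  simp only [sweedler_mul_antipode, h]
  set w := coactHom m₂
  let P : RepAlgebra K A B →ₗ[K] RepAlgebra K A B ⊗[K] B :=
    Lin.mk' (f := fun m => extBracket br (m ⊗ₜ 1) w) (by fun_prop)
  have hP : ∀ m a, extBracket br (m ⊗ₜ a) w = P m * (1 ⊗ₜ a) := fun m a => by
    change _ = extBracket br (m ⊗ₜ 1) w * _
    rw [← extBracket_mul_one_tmul, Algebra.TensorProduct.tmul_mul_tmul, mul_one, one_mul]
  -- Applied to the two sides of coassociativity at m₁, the map Q : m ⊗ a ⊗ a' ↦ P(m)(1 ⊗ a s(a'))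
  -- gives the two sides of the equivariance identity.
  let Q : RepAlgebra K A B ⊗[K] (B ⊗[K] B) →ₗ[K] RepAlgebra K A B ⊗[K] B :=
    LinearMap.mul' K _ ∘ₗ TensorProduct.map P
      (TensorProduct.mk K (RepAlgebra K A B) B 1 ∘ₗ LinearMap.mul' K B ∘ₗ
        LinearMap.lTensor B (antipode K))
  have e1 : ∀ z : RepAlgebra K A B ⊗[K] B, Q (LinearMap.lTensor _ (comul (R := K)) z) =
      P (TensorProduct.rid K _ (LinearMap.lTensor _ (counit (R := K)) z)) := fun z => by
    induction z with
    | zero => simp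
    | add u v hu hv => simp only [map_add, hu, hv]
    | tmul m a =>
      change P m * ((1 : RepAlgebra K A B) ⊗ₜ[K]
        (LinearMap.mul' K B (LinearMap.lTensor B (antipode K) (comul a)))) =
        P ((counit (R := K) a) • m)
      rw [mul_antipode_lTensor_comul_apply, Algebra.algebraMap_eq_smul_one,
        TensorProduct.tmul_smul, ← Algebra.TensorProduct.one_def, mul_smul_comm, mul_one, map_smul]
  have e2 : ∀ z : RepAlgebra K A B ⊗[K] B, Q (TensorProduct.assoc K _ B B
      (LinearMap.rTensor B coactHom.toLinearMap z)) = sweedler z fun l r =>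
        extBracket br (coactHom l) w * (1 ⊗ₜ antipode K r) := fun z => by
    have e3 : ∀ u r, Q (TensorProduct.assoc K _ B B (u ⊗ₜ r)) =
        extBracket br u w * (1 ⊗ₜ antipode K r) := fun u r => by
      induction u with
      | zero => simp
      | add u v hu hv => simp only [TensorProduct.add_tmul, map_add, add_mul, hu, hv,
          LinearMap.add_apply]
      | tmul m a =>
        change P m * ((1 : RepAlgebra K A B) ⊗ₜ[K] (a * antipode K r)) = _
        rw [hP, mul_assoc, Algebra.TensorProduct.tmul_mul_tmul, mul_one]
    conv_lhs => rw [(TensorProduct.exists_finset (R := K) z).choose_spec]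
    simp only [sweedler, map_sum, LinearMap.rTensor_tmul]
    exact Finset.sum_congr rfl fun p _ => e3 _ _
  rw [← e2]
  refine Eq.trans ?_ (congrArg Q ((repCoaction K A B).coassoc m₁)).symm
  rw [e1]
  refine Eq.trans ?_ (congrArg P ((repCoaction K A B).counit m₁)).symm
  change _ = extBracket br (m₁ ⊗ₜ 1) w
  conv_rhs => rw [(TensorProduct.exists_finset (R := K) w).choose_spec]
  simp only [sweedler, map_sum, extBracket_tmul, one_mul]

end Equivariance

end RepAlg

namespace RepAlg

set_option linter.unusedSectionVars false

/-! ### Functions of the last two variables -/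

namespace Slot

variable {K B S : Type*} [CommRing K] [CommRing B] [HopfAlgebra K B] [CommRing S] [Algebra K S]

/-- The functions of three variables that do not depend on the first one. -/
def IsConstFirst (F : Slot K B S) : Prop :=
  ∀ b c d, F (b ⊗ₜ[K] (c ⊗ₜ[K] d)) = counit (R := K) b • F (1 ⊗ₜ (c ⊗ₜ d))

theorem IsConstFirst.mul_left_apply {F : Slot K B S} (hF : IsConstFirst F) (G : Slot K B S)
    (b c d : B) : (F * G) (b ⊗ₜ[K] (c ⊗ₜ[K] d)) = sw K c fun c' c'' => sw K d fun d' d'' =>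
      F (1 ⊗ₜ (c' ⊗ₜ d')) * G (b ⊗ₜ (c'' ⊗ₜ d'')) := by
  rw [Slot.mul_apply]
  refine (congrArg (sw K b) (funext₂ fun b' b'' => ?_)).trans
    (sw_counit_left (F := fun b => sw K c fun c' c'' => sw K d fun d' d'' =>
      F (1 ⊗ₜ (c' ⊗ₜ d')) * G (b ⊗ₜ (c'' ⊗ₜ d''))) (by fun_prop) b)
  rw [sw_smul]
  refine congrArg (sw K c) (funext₂ fun c' c'' => ?_)
  rw [sw_smul]
  refine congrArg (sw K d) (funext₂ fun d' d'' => ?_)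
  rw [hF b', smul_mul_assoc]

theorem IsConstFirst.mul_right_apply {G : Slot K B S} (hG : IsConstFirst G) (F : Slot K B S)
    (b c d : B) : (F * G) (b ⊗ₜ[K] (c ⊗ₜ[K] d)) = sw K c fun c' c'' => sw K d fun d' d'' =>
      F (b ⊗ₜ (c' ⊗ₜ d')) * G (1 ⊗ₜ (c'' ⊗ₜ d'')) := by
  rw [Slot.mul_apply]
  refine (congrArg (sw K b) (funext₂ fun b' b'' => ?_)).trans
    (sw_counit_right (F := fun b => sw K c fun c' c'' => sw K d fun d' d'' =>
      F (b ⊗ₜ (c' ⊗ₜ d')) * G (1 ⊗ₜ (c'' ⊗ₜ d''))) (by fun_prop) b)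
  rw [sw_smul]
  refine congrArg (sw K c) (funext₂ fun c' c'' => ?_)
  rw [sw_smul]
  refine congrArg (sw K d) (funext₂ fun d' d'' => ?_)
  rw [hG b'', mul_smul_comm]

theorem IsConstFirst.commute_slot1 {F : Slot K B S} (hF : IsConstFirst F)
    (f : WithConv (B →ₗ[K] S)) : Commute F (slot1 f) :=
  ext fun b c d => by
    rw [slot1_mul_apply, mul_slot1_apply]
    refine ((congrArg (sw K b) (funext₂ fun b' b'' => ?_)).trans
      (sw_counit_left (F := fun b => F (1 ⊗ₜ (c ⊗ₜ d)) * f b) (by fun_prop) b)).trans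
      ((congrArg (sw K b) (funext₂ fun b' b'' => ?_)).trans
        (sw_counit_right (F := fun b => F (1 ⊗ₜ (c ⊗ₜ d)) * f b) (by fun_prop) b)).symm
    · rw [hF b', smul_mul_assoc]
    · rw [hF b'', mul_smul_comm, mul_comm]

variable (K B S) in
/-- The subalgebra of functions that do not depend on the first variable. -/
noncomputable def constFirst : Subalgebra K (Slot K B S) where
  carrier := {F | IsConstFirst F}
  mul_mem' {F G} (hF : IsConstFirst F) (hG : IsConstFirst G) b c d := by
    rw [hF.mul_left_apply, hF.mul_left_apply]
    simp only [hG b, mul_smul_comm, sw_smul]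
  add_mem' {F G} hF hG b c d := by
    rw [Slot.add_apply, Slot.add_apply, hF, hG, smul_add]
  algebraMap_mem' k b c d := by
    rw [Algebra.algebraMap_eq_smul_one, Slot.smul_apply, Slot.smul_apply, Slot.one_apply,
      Slot.one_apply, Bialgebra.counit_one, one_mul, mul_smul, smul_comm k]

theorem slot2_mem_constFirst (f : WithConv (B →ₗ[K] S)) : slot2 f ∈ constFirst K B S :=
  fun b c d => by
    rw [slot2_apply, slot2_apply, Bialgebra.counit_one, one_mul, mul_smul]

theorem slot3_mem_constFirst (f : WithConv (B →ₗ[K] S)) : slot3 f ∈ constFirst K B S :=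
  fun b c d => by
    rw [slot3_apply, slot3_apply, Bialgebra.counit_one, one_mul, mul_smul]

theorem form23_mem_constFirst (ω : B →ₗ[K] B →ₗ[K] K) : form23 S ω ∈ constFirst K B S :=
  fun b c d => by
    rw [form23_apply, form23_apply, Bialgebra.counit_one, mul_one, mul_comm, mul_smul]

end Slot

/-! ### The Jacobi sum of generators -/

section JacobiGen

variable {K A B : Type*} [CommRing K] [Ring A] [HopfAlgebra K A] [IsCocomm K A]
  [CommRing B] [HopfAlgebra K B]

open Slot

theorem sw_mem {E : Type*} [Ring E] [Algebra K E] (S : Subalgebra K E) (a : A) {f : A → A → E}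
    (hf : ∀ a b, f a b ∈ S) : sw K a f ∈ S :=
  S.sum_mem fun _ _ => hf _ _

theorem brak_mem {E : Type*} [Ring E] [Algebra K E] (S : Subalgebra K E) (ρ : A →ₗ[K] A →ₗ[K] A)
    {X₁ X₂ : A →ₐ[K] E} {Ω : E} (h₁ : ∀ a, X₁ a ∈ S) (h₂ : ∀ a, X₂ a ∈ S) (hΩ : Ω ∈ S) (x y : A) :
    brak ρ X₁ X₂ Ω x y ∈ S := by
  refine sw_mem S x fun x' x'' => sw_mem S y fun y' y'' => S.mul_mem (S.mul_mem ?_ (h₁ _)) (h₂ _)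
  rw [vel, ad_apply]
  exact sw_mem S _ fun a b => S.mul_mem (S.mul_mem (h₁ _) hΩ) (h₁ _)

/-- The bracket of `x` in the first slot. -/
noncomputable def slotDer (br : RepAlgebra K A B →ₗ[K] RepAlgebra K A B →ₗ[K] RepAlgebra K A B)
    (x : A) : Slot K B (RepAlgebra K A B) →ₗ[K] Slot K B (RepAlgebra K A B) :=
  Lin.mk' (f := fun F : Slot K B (RepAlgebra K A B) => tri (fun b c d =>
      br (gen K A B x b) (F (1 ⊗ₜ (c ⊗ₜ d)))) (by fun_prop) (by fun_prop) (by fun_prop))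
    ⟨fun F G => Slot.ext fun b c d => by simp only [Slot.add_apply, tri_apply, map_add],
      fun k F => Slot.ext fun b c d => by simp only [Slot.smul_apply, tri_apply, map_smul]⟩

variable {br : RepAlgebra K A B →ₗ[K] RepAlgebra K A B →ₗ[K] RepAlgebra K A B}

theorem slotDer_apply (x : A) (F : Slot K B (RepAlgebra K A B)) (b c d : B) :
    slotDer br x F (b ⊗ₜ (c ⊗ₜ d)) = br (gen K A B x b) (F (1 ⊗ₜ (c ⊗ₜ d))) := by
  rw [slotDer, Lin.mk'_apply, tri_apply]

theorem slotDer_mul (h : IsBracket br) (x : A) {F G : Slot K B (RepAlgebra K A B)}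
    (hF : IsConstFirst F) (hG : IsConstFirst G) :
    slotDer br x (F * G) = slotDer br x F * G + F * slotDer br x G :=
  Slot.ext fun b c d => by
    rw [Slot.add_apply, hG.mul_right_apply, hF.mul_left_apply, slotDer_apply, hF.mul_left_apply,
      ← sw_add, lin_sw (Lin.coe (br (gen K A B x b)))]
    refine congrArg (sw K c) (funext₂ fun c' c'' => ?_)
    rw [← sw_add, lin_sw (Lin.coe (br (gen K A B x b)))]
    refine congrArg (sw K d) (funext₂ fun d' d'' => ?_)
    rw [h.leibniz_right, slotDer_apply, slotDer_apply]

theorem IsBracket.map_one_right (h : IsBracket br) (u : RepAlgebra K A B) : br u 1 = 0 := by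
  simpa using h.leibniz_right u 1 1

theorem lin_slotDer {M : Type*} [AddCommGroup M] [Module K M] (F : Slot K B (RepAlgebra K A B))
    {f : M → A} (hf : Lin K f) : Lin K fun m => slotDer br (f m) F :=
  ⟨fun x y => Slot.ext fun b c d => by
      simp only [Slot.add_apply, slotDer_apply, hf.add, map_add, LinearMap.add_apply],
    fun k x => Slot.ext fun b c d => by
      simp only [Slot.smul_apply, slotDer_apply, hf.smul, map_smul, LinearMap.smul_apply]⟩

variable (K A B) in
/-- The generators in the slots, with values in the representation algebra. -/
noncomputable abbrev Y₁ : A →ₐ[K] Slot K B (RepAlgebra K A B) := genSlot1 (AlgHom.id K _)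

variable (K A B) in
/-- The generators in the second slot. -/
noncomputable abbrev Y₂ : A →ₐ[K] Slot K B (RepAlgebra K A B) := genSlot2 (AlgHom.id K _)

variable (K A B) in
/-- The generators in the third slot. -/
noncomputable abbrev Y₃ : A →ₐ[K] Slot K B (RepAlgebra K A B) := genSlot3 (AlgHom.id K _)

theorem rot_comp_Y₁ : rot.comp (Y₁ K A B) = Y₂ K A B := rfl

theorem rot_comp_Y₂ : rot.comp (Y₂ K A B) = Y₃ K A B := rfl

theorem rot_comp_Y₃ : rot.comp (Y₃ K A B) = Y₁ K A B := AlgHom.ext fun a => rot_genSlot3 _ a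

variable {t : B} (ht : IsTraceLike K t) (ρ : A →ₗ[K] A →ₗ[K] A)

theorem brak23_apply (y z : A) (b c d : B) :
    brak ρ (Y₂ K A B) (Y₃ K A B) (form23 _ ht.form) y z (b ⊗ₜ (c ⊗ₜ d)) =
      counit (R := K) b • genBracket ht ρ y c z d := by
  have h : IsConstFirst (brak ρ (Y₂ K A B) (Y₃ K A B) (form23 _ ht.form) y z) :=
    brak_mem (constFirst K B (RepAlgebra K A B)) ρ (fun a => slot2_mem_constFirst _)
      (fun a => slot3_mem_constFirst _) (form23_mem_constFirst _) y z
  have e := map_brak rot ρ (Y₁ K A B) (Y₂ K A B) (form12 _ ht.form) y z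
  rw [rot_comp_Y₁, rot_comp_Y₂, rot_form12] at e
  rw [h, ← e, rot_apply]
  rfl

theorem brak31_apply (z x : A) (b c d : B) :
    brak ρ (Y₃ K A B) (Y₁ K A B) (form31 _ ht.form) z x (b ⊗ₜ (c ⊗ₜ d)) =
      counit (R := K) c • genBracket ht ρ z d x b := by
  have e := map_brak rot ρ (Y₂ K A B) (Y₃ K A B) (form23 _ ht.form) z x
  rw [rot_comp_Y₂, rot_comp_Y₃, rot_form23] at e
  rw [← e, rot_apply, brak23_apply]

theorem brak12_apply (x y : A) (b c d : B) :
    brak ρ (Y₁ K A B) (Y₂ K A B) (form12 _ ht.form) x y (b ⊗ₜ (c ⊗ₜ d)) =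
      counit (R := K) d • genBracket ht ρ x b y c := by
  have e := map_brak rot ρ (Y₃ K A B) (Y₁ K A B) (form31 _ ht.form) x y
  rw [rot_comp_Y₃, rot_comp_Y₁, rot_form31] at e
  rw [← e, rot_apply, brak31_apply]

end JacobiGen

end RepAlg

namespace RepAlg

set_option linter.unusedSectionVars false

/-! ### Double brackets of generators of the representation algebra -/

section JacobiSum

variable {K A E : Type*} [CommRing K] [Ring A] [HopfAlgebra K A] [IsCocomm K A]
  [Ring E] [Algebra K E]

/-- `∑ J(x', y', z') X₁(x'') X₂(y'') X₃(z'')`. -/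
noncomputable def dress (X₁ X₂ X₃ : A →ₐ[K] E) (J : A → A → A → E) (x y z : A) : E :=
  sw K x fun x' x'' => sw K y fun y' y'' => sw K z fun z' z'' =>
    J x' y' z' * X₁ x'' * X₂ y'' * X₃ z''

theorem map_dress_jac {E' : Type*} [Ring E'] [Algebra K E'] (h : E →ₐ[K] E')
    (ρ : A →ₗ[K] A →ₗ[K] A) (X₁ X₂ X₃ : A →ₐ[K] E) (Ω₁₂ Ω₂₃ Ω₃₁ : E) (x y z : A) :
    h (dress X₁ X₂ X₃ (jac ρ X₁ X₂ X₃ Ω₁₂ Ω₂₃ Ω₃₁) x y z) =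
      dress (h.comp X₁) (h.comp X₂) (h.comp X₃)
        (jac ρ (h.comp X₁) (h.comp X₂) (h.comp X₃) (h Ω₁₂) (h Ω₂₃) (h Ω₃₁)) x y z := by
  simp only [dress, jac, vel, map_sw, map_mul, map_add, map_sub, map_ad]
  rfl

theorem dress_rotate {X₁ X₂ X₃ : A →ₐ[K] E} (c12 : ∀ a b, Commute (X₁ a) (X₂ b))
    (c13 : ∀ a b, Commute (X₁ a) (X₃ b)) (J : A → A → A → E) (x y z : A) :
    dress X₂ X₃ X₁ J y z x = dress X₁ X₂ X₃ (fun a b c => J b c a) x y z := by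
  unfold dress
  refine Eq.trans ?_ (sw_sw y x _)
  refine congrArg (sw K y) (funext₂ fun y' y'' => ?_)
  refine Eq.trans ?_ (sw_sw z x _)
  refine congrArg (sw K z) (funext₂ fun z' z'' => congrArg (sw K x) (funext₂ fun x' x'' => ?_))
  simp only [mul_assoc]
  rw [← (c13 x'' z'').eq, ← mul_assoc (X₂ y''), ← (c12 x'' y'').eq, mul_assoc]

end JacobiSum

section JacobiGen

variable {K A B : Type*} [CommRing K] [Ring A] [HopfAlgebra K A] [IsCocomm K A]
  [CommRing B] [HopfAlgebra K B]
  {br : RepAlgebra K A B →ₗ[K] RepAlgebra K A B →ₗ[K] RepAlgebra K A B}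

open Slot

attribute [fun_prop] lin_slotDer

/-- An application of `deriv_bracket` to bracketing with x in the first slot, considered on
functions constant in the first variable. -/
theorem bracket_bracket_gen {t : B} (ht : IsTraceLike K t) {ρ : A →ₗ[K] A →ₗ[K] A}
    (hρ : IsQuasiPoissonFox ρ) (h : IsBracket br)
    (hg : ∀ x b y c, br (gen K A B x b) (gen K A B y c) = genBracket ht ρ x b y c)
    (x y z : A) (b c d : B) :
    br (gen K A B x b) (br (gen K A B y c) (gen K A B z d)) =
      dress (Y₁ K A B) (Y₂ K A B) (Y₃ K A B) (jac ρ (Y₁ K A B) (Y₂ K A B) (Y₃ K A B)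
        (form12 _ ht.form) (form23 _ ht.form) (form31 _ ht.form)) x y z (b ⊗ₜ (c ⊗ₜ d)) := by
  have hs := isSlotSystem (AlgHom.id K (RepAlgebra K A B)) ht
  -- Dividing by X₁(x'') on the right leaves D(X₂(y)) and D(X₃(z)) free of the generator in slot 1,
  -- as `deriv_bracket` requires; `slot_eq` multiplies it back.
  let D : A → Slot K B (RepAlgebra K A B) →ₗ[K] Slot K B (RepAlgebra K A B) := fun x =>
    Lin.mk' (f := fun F => sw K x fun x' x'' => slotDer br x' F * Y₁ K A B (antipode K x''))
      (by fun_prop)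
  have D_eq : ∀ x F, D x F = sw K x fun x' x'' => slotDer br x' F * Y₁ K A B (antipode K x'') :=
    fun x F => rfl
  have slot_eq : ∀ F, slotDer br x F = sw K x fun x' x'' => D x' F * Y₁ K A B x'' := fun F => by
    simp only [D_eq, sw_mul_right]
    rw [sw_assoc (F := fun a b c => slotDer br a F * Y₁ K A B (antipode K b) * Y₁ K A B c)
      (by fun_prop) (by fun_prop) (by fun_prop)]
    have q : ∀ x' x'' : A, (sw K x'' fun a b => slotDer br x' F * Y₁ K A B (antipode K a) *
        Y₁ K A B b) = counit (R := K) x'' • slotDer br x' F := fun x' x'' => by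
      simp only [mul_assoc, ← map_mul]
      rw [← sw_mul_left, ← lin_sw (g := fun a => Y₁ K A B a) (by fun_prop), sw_antipode_mul_eq,
        map_smul, map_one, mul_smul_comm, mul_one]
    simp only [q]
    exact (sw_counit_right (F := fun x => slotDer br x F) (by fun_prop) x).symm
  have cancel : ∀ (x : A) (G : A → Slot K B (RepAlgebra K A B)), Lin K G →
      (sw K x fun x' x'' => (sw K x' fun a b => G a * Y₁ K A B b) * Y₁ K A B (antipode K x'')) =
        G x := fun x G hG => by
    simp only [sw_mul_right]
    rw [sw_assoc (F := fun a b c => G a * Y₁ K A B b * Y₁ K A B (antipode K c))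
      (by fun_prop) (by fun_prop) (by fun_prop)]
    have q : ∀ x' x'' : A, (sw K x'' fun a b => G x' * Y₁ K A B a *
        Y₁ K A B (antipode K b)) = counit (R := K) x'' • G x' := fun x' x'' => by
      simp only [mul_assoc, ← map_mul]
      rw [← sw_mul_left, ← lin_sw (g := fun a => Y₁ K A B a) (by fun_prop), sw_mul_antipode_eq,
        map_smul, map_one, mul_smul_comm, mul_one]
    simp only [q]
    exact sw_counit_right hG x
  have d2 : ∀ x y, slotDer br x (Y₂ K A B y) =
      brak ρ (Y₁ K A B) (Y₂ K A B) (form12 _ ht.form) x y := fun x y =>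
    Slot.ext fun b c d => by
      rw [slotDer_apply, brak12_apply]
      change br _ (slot2 (genHom _ y) _) = _
      rw [slot2_apply, Bialgebra.counit_one, one_mul, map_smul, ← hg]
      rfl
  have d3 : ∀ x z, slotDer br x (Y₃ K A B z) =
      -brak ρ (Y₃ K A B) (Y₁ K A B) (form31 _ ht.form) z x := fun x z =>
    Slot.ext fun b c d => by
      change _ = -(brak ρ (Y₃ K A B) (Y₁ K A B) (form31 _ ht.form) z x (b ⊗ₜ[K] (c ⊗ₜ[K] d)))
      rw [slotDer_apply, brak31_apply, ← smul_neg, ← genBracket_antisymm ht hρ]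
      change br _ (slot3 (genHom _ z) _) = _
      rw [slot3_apply, Bialgebra.counit_one, one_mul, map_smul, ← hg]
      rfl
  have d0 : ∀ x, slotDer br x (form23 _ ht.form) = 0 := fun x =>
    Slot.ext fun b c d => by
      rw [slotDer_apply, form23_apply, map_smul, h.map_one_right, smul_zero]
      rfl
  have hD : ∀ x, ∀ f ∈ constFirst K B (RepAlgebra K A B), ∀ g ∈ constFirst K B (RepAlgebra K A B),
      D x (f * g) = D x f * g + f * D x g := fun x f hf g hg' => by
    simp only [D_eq, sw_mul_left, sw_mul_right, ← sw_add]
    refine congrArg (sw K x) (funext₂ fun x' x'' => ?_)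
    have hc : Commute g (Y₁ K A B (antipode K x'')) := IsConstFirst.commute_slot1 hg' _
    rw [slotDer_mul h x' hf hg', add_mul, mul_assoc, mul_assoc, hc.eq]
    simp only [mul_assoc]
  have main := fun x' => hs.deriv_bracket ρ x' (D x') (constFirst K B _) (hD x')
    (fun a => slot2_mem_constFirst _) (fun a => slot3_mem_constFirst _) (form23_mem_constFirst _)
    (by simp only [D_eq, d0, zero_mul]; exact Finset.sum_const_zero)
    (fun y => by
      simp only [D_eq, d2, brak]
      rw [← cancel x' (fun x' => sw K y fun y' y'' => vel ρ (Y₁ K A B) (form12 _ ht.form) x' y' *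
        Y₂ K A B y'') (by fun_prop)]
      refine congrArg (sw K x') (funext₂ fun x' x'' => congrArg (· * _)
        (congrArg (sw K x') (funext₂ fun a b => ?_)))
      rw [sw_mul_right]
      refine congrArg (sw K y) (funext₂ fun y' y'' => ?_)
      rw [mul_assoc, mul_assoc, (hs.c12 _ _).eq])
    (fun z => by
      simp only [D_eq, d3, brak]
      rw [← cancel x' (fun x' => -sw K z fun z' z'' => vel ρ (Y₃ K A B) (form31 _ ht.form) z' x' *
        Y₃ K A B z'') (by fun_prop)]
      refine congrArg (sw K x') (funext₂ fun x' x'' => congrArg (· * _) ?_)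
      rw [sw_sw]
      simp only [neg_mul, sw_neg, sw_mul_right]) y z
  have e := congrArg (fun F : Slot K B (RepAlgebra K A B) => F (b ⊗ₜ (c ⊗ₜ d)))
    (slot_eq (brak ρ (Y₂ K A B) (Y₃ K A B) (form23 _ ht.form) y z))
  simp only [slotDer_apply, brak23_apply, Bialgebra.counit_one, one_smul] at e
  rw [hg, e]
  refine congrArg (fun F : Slot K B (RepAlgebra K A B) => F (b ⊗ₜ (c ⊗ₜ d))) ?_
  unfold brak dress
  refine congrArg (sw K x) (funext₂ fun x' x'' => ?_)
  rw [main x', sw_mul_right]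
  refine congrArg (sw K y) (funext₂ fun y' y'' => ?_)
  rw [sw_mul_right]
  refine congrArg (sw K z) (funext₂ fun z' z'' => ?_)
  simp only [mul_assoc]
  rw [← (hs.c13 x'' z'').eq, ← mul_assoc (genSlot2 _ y''), ← (hs.c12 x'' y'').eq, mul_assoc]

/-- Rotation of the variables brings the double bracket of (y, z, x) to the same point b ⊗ c ⊗ d as
that of (x, y, z), at the cost of rotating the slot system. -/
theorem dress_jac_rotate {t : B} (ht : IsTraceLike K t) (ρ : A →ₗ[K] A →ₗ[K] A) (x y z : A)
    (b c d : B) :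
    dress (Y₁ K A B) (Y₂ K A B) (Y₃ K A B) (jac ρ (Y₁ K A B) (Y₂ K A B) (Y₃ K A B)
        (form12 _ ht.form) (form23 _ ht.form) (form31 _ ht.form)) y z x (c ⊗ₜ (d ⊗ₜ b)) =
      dress (Y₁ K A B) (Y₂ K A B) (Y₃ K A B) (fun x y z => jac ρ (Y₂ K A B) (Y₃ K A B) (Y₁ K A B)
        (form23 _ ht.form) (form31 _ ht.form) (form12 _ ht.form) y z x) x y z
        (b ⊗ₜ (c ⊗ₜ d)) := by
  have hs := isSlotSystem (AlgHom.id K (RepAlgebra K A B)) ht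
  have e := map_dress_jac rot ρ (Y₁ K A B) (Y₂ K A B) (Y₃ K A B)
    (form12 _ ht.form) (form23 _ ht.form) (form31 _ ht.form) y z x
  rw [rot_comp_Y₁, rot_comp_Y₂, rot_comp_Y₃, rot_form12, rot_form23, rot_form31] at e
  rw [← rot_apply, e, dress_rotate hs.c12 hs.c13]

theorem dress_jac_rotate_rotate {t : B} (ht : IsTraceLike K t) (ρ : A →ₗ[K] A →ₗ[K] A)
    (x y z : A) (b c d : B) :
    dress (Y₁ K A B) (Y₂ K A B) (Y₃ K A B) (jac ρ (Y₁ K A B) (Y₂ K A B) (Y₃ K A B)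
        (form12 _ ht.form) (form23 _ ht.form) (form31 _ ht.form)) z x y (d ⊗ₜ (b ⊗ₜ c)) =
      dress (Y₁ K A B) (Y₂ K A B) (Y₃ K A B) (fun x y z => jac ρ (Y₃ K A B) (Y₁ K A B) (Y₂ K A B)
        (form31 _ ht.form) (form12 _ ht.form) (form23 _ ht.form) z x y) x y z
        (b ⊗ₜ (c ⊗ₜ d)) := by
  have hs := isSlotSystem (AlgHom.id K (RepAlgebra K A B)) ht
  have e := map_dress_jac rot ρ (Y₁ K A B) (Y₂ K A B) (Y₃ K A B)
    (form12 _ ht.form) (form23 _ ht.form) (form31 _ ht.form) z x y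
  rw [rot_comp_Y₁, rot_comp_Y₂, rot_comp_Y₃, rot_form12, rot_form23, rot_form31] at e
  have e' := map_dress_jac rot ρ (Y₂ K A B) (Y₃ K A B) (Y₁ K A B)
    (form23 _ ht.form) (form31 _ ht.form) (form12 _ ht.form) z x y
  rw [rot_comp_Y₁, rot_comp_Y₂, rot_comp_Y₃, rot_form12, rot_form23, rot_form31] at e'
  rw [← rot_apply, ← rot_apply, e, e', dress_rotate hs.c23 hs.c21, dress_rotate hs.c12 hs.c13]

end JacobiGen

/-! ### The eight terms as an iterated commutator -/

section Commutator

variable {K A E : Type*} [CommRing K] [Ring A] [HopfAlgebra K A] [IsCocomm K A]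
  [Ring E] [Algebra K E]

/-- The sums are carried out one slot at a time: summing over x turns p₁ into T₁, which passes
through the operators of the other slots, and so on. -/
theorem dress_operators {X₁ X₂ X₃ : A →ₐ[K] E} {p₁ p₂ p₃ : A → E → E} {T₁ T₂ T₃ : E → E}
    {x y z : A} (h₁ : ∀ e, (sw K x fun a' a'' => p₁ a' e * X₁ a'') = T₁ e)
    (h₂ : ∀ e, (sw K y fun a' a'' => p₂ a' e * X₂ a'') = T₂ e)
    (h₃ : ∀ e, (sw K z fun a' a'' => p₃ a' e * X₃ a'') = T₃ e)
    (c12 : ∀ b e, T₁ (p₂ b e) = p₂ b (T₁ e)) (c13 : ∀ b e, T₁ (p₃ b e) = p₃ b (T₁ e))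
    (c23 : ∀ b e, T₂ (p₃ b e) = p₃ b (T₂ e)) (φ : E) :
    dress X₁ X₂ X₃ (fun x y z => p₁ x (p₂ y (p₃ z φ))) x y z = T₃ (T₂ (T₁ φ)) := by
  unfold dress
  rw [sw_sw]
  have e1 : ∀ y' y'' : A, (sw K x fun x' x'' => sw K z fun z' z'' =>
      p₁ x' (p₂ y' (p₃ z' φ)) * X₁ x'' * X₂ y'' * X₃ z'') =
      sw K z fun z' z'' => p₂ y' (p₃ z' (T₁ φ)) * X₂ y'' * X₃ z'' := fun y' y'' => by
    rw [sw_sw]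
    refine congrArg (sw K z) (funext₂ fun z' z'' => ?_)
    rw [← sw_mul_right, ← sw_mul_right, h₁, c12, c13]
  simp only [e1]
  rw [sw_sw]
  have e2 : ∀ z' z'' : A, (sw K y fun y' y'' => p₂ y' (p₃ z' (T₁ φ)) * X₂ y'' * X₃ z'') =
      p₃ z' (T₂ (T₁ φ)) * X₃ z'' := fun z' z'' => by
    rw [← sw_mul_right, h₂, c23]
  simp only [e2, h₃]

theorem ad_mul_left_comm {X Y : A →ₐ[K] E} (h : ∀ a b, Commute (X a) (Y b)) (a b : A) (e : E) :
    X a * ad Y b e = ad Y b (X a * e) :=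
  (ad_mul_of_commute_left Y e fun c => (h a c).symm) b |>.symm

theorem ad_mul_right_comm {X Y : A →ₐ[K] E} (h : ∀ a b, Commute (X a) (Y b)) (a b : A) (e : E) :
    ad Y b e * X a = ad Y b (e * X a) :=
  (ad_mul_of_commute_right Y e fun c => (h a c).symm) b |>.symm

open IsSlotSystem in
/-- The dressed right-hand side of the Jacobi sum is an iterated commutator. -/
theorem dress_commutator {X₁ X₂ X₃ : A →ₐ[K] E}
    (c12 : ∀ a b, Commute (X₁ a) (X₂ b)) (c13 : ∀ a b, Commute (X₁ a) (X₃ b))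
    (c23 : ∀ a b, Commute (X₂ a) (X₃ b)) (φ : E) (x y z : A) :
    dress X₁ X₂ X₃ (fun x y z =>
      counit (R := K) x • conj3 X₁ X₂ X₃ φ 1 y z + counit (R := K) y • conj3 X₁ X₂ X₃ φ x 1 z +
        counit (R := K) z • conj3 X₁ X₂ X₃ φ x y 1 +
        counit (R := K) x • counit (R := K) y • counit (R := K) z • conj3 X₁ X₂ X₃ φ 1 1 1 -
        counit (R := K) x • counit (R := K) z • conj3 X₁ X₂ X₃ φ 1 y 1 -
        counit (R := K) x • counit (R := K) y • conj3 X₁ X₂ X₃ φ 1 1 z -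
        counit (R := K) y • counit (R := K) z • conj3 X₁ X₂ X₃ φ x 1 1 -
        conj3 X₁ X₂ X₃ φ x y z) x y z =
      -(X₁ x * (X₂ y * (X₃ z * φ - φ * X₃ z) - (X₃ z * φ - φ * X₃ z) * X₂ y) -
        (X₂ y * (X₃ z * φ - φ * X₃ z) - (X₃ z * φ - φ * X₃ z) * X₂ y) * X₁ x) := by
  -- Multiplied by X(a''), the operator Ad(a') becomes left multiplication by X(a), and the counit
  -- becomes right multiplication. The eight signed terms are thus the expansion of -(L₁ - R₁)(L₂ -
  -- R₂)(L₃ - R₃) φ.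
  have k1 : ∀ (X : A →ₐ[K] E) (a : A) (e : E), (sw K a fun a' a'' => ad X a' e * X a'') =
      X a * e := fun X a e => (mul_eq_sw_ad X a e).symm
  have k0 : ∀ (X : A →ₐ[K] E) (a : A) (e : E), (sw K a fun a' a'' =>
      (counit (R := K) a' • e) * X a'') = e * X a := fun X a e => by
    simp only [smul_mul_assoc]
    exact sw_counit_left (F := fun a => e * X a) (by fun_prop) a
  have l0 : ∀ (X : A →ₐ[K] E) (a b : A) (e : E), X a * (counit (R := K) b • e) =
      counit (R := K) b • (X a * e) := fun X a b e => mul_smul_comm _ _ _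
  have r0 : ∀ (X : A →ₐ[K] E) (a b : A) (e : E), (counit (R := K) b • e) * X a =
      counit (R := K) b • (e * X a) := fun X a b e => smul_mul_assoc _ _ _
  have l12 := ad_mul_left_comm c12 x
  have l13 := ad_mul_left_comm c13 x
  have l23 := ad_mul_left_comm c23 y
  have r12 := ad_mul_right_comm c12 x
  have r13 := ad_mul_right_comm c13 x
  have r23 := ad_mul_right_comm c23 y
  -- In the names, the digit 1 marks a slot with left multiplication and 0 a slot with right
  -- multiplication.
  have t011 := dress_operators (k0 X₁ x) (k1 X₂ y) (k1 X₃ z) r12 r13 l23 φ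
  have t101 := dress_operators (k1 X₁ x) (k0 X₂ y) (k1 X₃ z) (l0 X₁ x) l13 r23 φ
  have t110 := dress_operators (k1 X₁ x) (k1 X₂ y) (k0 X₃ z) l12 (l0 X₁ x) (l0 X₂ y) φ
  have t000 := dress_operators (k0 X₁ x) (k0 X₂ y) (k0 X₃ z) (r0 X₁ x) (r0 X₁ x) (r0 X₂ y) φ
  have t010 := dress_operators (k0 X₁ x) (k1 X₂ y) (k0 X₃ z) r12 (r0 X₁ x) (l0 X₂ y) φ
  have t001 := dress_operators (k0 X₁ x) (k0 X₂ y) (k1 X₃ z) (r0 X₁ x) r13 r23 φ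
  have t100 := dress_operators (k1 X₁ x) (k0 X₂ y) (k0 X₃ z) (l0 X₁ x) (l0 X₁ x) (r0 X₂ y) φ
  have t111 := dress_operators (k1 X₁ x) (k1 X₂ y) (k1 X₃ z) l12 l13 l23 φ
  simp only [dress, map_smul] at t011 t101 t110 t000 t010 t001 t100 t111
  simp only [dress, conj3_apply, map_one, Module.End.one_apply, add_mul, sub_mul, sw_add, sw_sub]
  rw [t011, t101, t110, t000, t010, t001, t100, t111]
  simp only [mul_sub, sub_mul, mul_assoc, (c12 x y).eq, (c13 x z).eq, (c23 y z).eq]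
  have q1 : ∀ e, X₁ x * (X₂ y * e) = X₂ y * (X₁ x * e) := fun e => by
    rw [← mul_assoc, (c12 x y).eq, mul_assoc]
  have q2 : ∀ e, X₁ x * (X₃ z * e) = X₃ z * (X₁ x * e) := fun e => by
    rw [← mul_assoc, (c13 x z).eq, mul_assoc]
  have q3 : ∀ e, X₂ y * (X₃ z * e) = X₃ z * (X₂ y * e) := fun e => by
    rw [← mul_assoc, (c23 y z).eq, mul_assoc]
  simp only [q1, q2, q3]
  abel

end Commutator

end RepAlg

namespace RepAlg

set_option linter.unusedSectionVars false

/-! ### The infinitesimal coaction -/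

section CoactDer

variable {K A B : Type*} [CommRing K] [Ring A] [HopfAlgebra K A] [CommRing B] [HopfAlgebra K B]
  {t : B}

/-- The linear map `m ⊗ b ↦ (b • τ) m`. -/
noncomputable def formTmul (ht : IsTraceLike K t) (τ : B) :
    RepAlgebra K A B ⊗[K] B →ₗ[K] RepAlgebra K A B :=
  TensorProduct.lift (Lin.mk₂ (f := fun m b => ht.form b τ • m) (by fun_prop) (by fun_prop))

theorem formTmul_tmul (ht : IsTraceLike K t) (τ : B) (m : RepAlgebra K A B) (b : B) :
    formTmul ht τ (m ⊗ₜ b) = ht.form b τ • m := rfl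

theorem sweedler_form (ht : IsTraceLike K t) (τ : B) (z : RepAlgebra K A B ⊗[K] B) :
    (sweedler z fun m b => ht.form b τ • m) = formTmul ht τ z :=
  sweedler_eq_lift z (Lin.mk₂ (f := fun (m : RepAlgebra K A B) b => ht.form b τ • m)
    (by fun_prop) (by fun_prop))

/-- The derivation `m ↦ (mʳ • τ) mˡ`. -/
noncomputable def coactDer (ht : IsTraceLike K t) (τ : B) : RepAlgebra K A B →ₗ[K] RepAlgebra K A B :=
  formTmul ht τ ∘ₗ coactHom.toLinearMap

theorem coactDer_apply (ht : IsTraceLike K t) (τ : B) (m : RepAlgebra K A B) :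
    coactDer ht τ m = formTmul ht τ (coactHom m) := rfl

@[fun_prop] theorem lin_coactDer {M : Type*} [AddCommGroup M] [Module K M] (ht : IsTraceLike K t)
    (m : RepAlgebra K A B) {f : M → B} (hf : Lin K f) : Lin K fun a => coactDer ht (f a) m := by
  simp only [coactDer_apply]
  generalize coactHom m = z
  induction z with
  | zero => simp only [map_zero]; fun_prop
  | tmul m b => simp only [formTmul_tmul]; fun_prop
  | add u v hu hv => simp only [map_add]; fun_prop

theorem formTmul_mul (ht : IsTraceLike K t) (τ : B) (z w : RepAlgebra K A B ⊗[K] B) :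
    formTmul ht τ (z * w) =
      formTmul ht τ z * TensorProduct.rid K _ (LinearMap.lTensor _ (counit (R := K)) w) +
        TensorProduct.rid K _ (LinearMap.lTensor _ (counit (R := K)) z) * formTmul ht τ w := by
  induction z with
  | zero => simp
  | add z z' hz hz' => simp only [add_mul, map_add, hz, hz']; ring
  | tmul m b =>
    induction w with
    | zero => simp
    | add w w' hw hw' => simp only [mul_add, map_add, hw, hw']; ring
    | tmul n c =>
      rw [Algebra.TensorProduct.tmul_mul_tmul]
      simp only [formTmul_tmul, (ht.isCounitDer_form' τ).map_mul, LinearMap.lTensor_tmul,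
        TensorProduct.rid_tmul, smul_mul_assoc, mul_smul_comm, add_smul, smul_eq_mul, mul_smul]
      rw [smul_comm (counit (R := K) b), add_comm]

theorem coactDer_mul (ht : IsTraceLike K t) (τ : B) (u v : RepAlgebra K A B) :
    coactDer ht τ (u * v) = coactDer ht τ u * v + u * coactDer ht τ v := by
  rw [coactDer_apply, map_mul, formTmul_mul]
  have e := (repCoaction K A B).counit
  change ∀ m, TensorProduct.rid K _ (LinearMap.lTensor _ (counit (R := K)) (coactHom m)) = m at e
  rw [e, e]
  rfl

/-- The derivation property and μ(s(b)) = -μ(b) split s(b') b''' into two terms. The outcome is the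
shape of a commutator of a generator with the form, which is how `iterComm_form_apply` uses it. -/
theorem coactDer_gen (ht : IsTraceLike K t) (τ : B) (x : A) (b : B) :
    coactDer ht τ (gen K A B x b) = sw K b fun b' b'' =>
      ht.form b'' τ • gen K A B x b' - ht.form b' τ • gen K A B x b'' := by
  have hd := ht.isCounitDer_form' τ
  rw [coactDer_apply, coactHom_gen]
  simp only [sw3, map_sw, formTmul_tmul, hd.map_mul, hd.map_antipode, counit_antipode, smul_eq_mul,
    add_smul, mul_smul, sw_add, sw_sub]
  rw [sub_eq_add_neg]
  congr 1
  · simp only [← sw_smul]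
    exact sw_counit_left (F := fun b => sw K b fun b' b'' => ht.form b'' τ • gen K A B x b')
      (by fun_prop) b
  · rw [← sw_neg]
    refine congrArg (sw K b) (funext₂ fun b' d => ?_)
    rw [sw_counit_right (F := fun d => (-ht.form b' τ) • gen K A B x d) (by fun_prop), neg_smul]

theorem coactDer_eq_zero (ht : IsTraceLike K t) (τ : B) {m : RepAlgebra K A B}
    (hm : m ∈ (repCoaction K A B).invariants) : coactDer ht τ m = 0 := by
  have e : coactHom m = m ⊗ₜ[K] (1 : B) := hm
  rw [coactDer_apply, e, formTmul_tmul, (ht.isCounitDer_form' τ).map_one, zero_smul]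

end CoactDer

/-! ### The quasi-Jacobi identity for generators -/

section Generators

variable {K A B : Type*} [CommRing K] [Ring A] [HopfAlgebra K A] [IsCocomm K A]
  [CommRing B] [HopfAlgebra K B]
  {br : RepAlgebra K A B →ₗ[K] RepAlgebra K A B →ₗ[K] RepAlgebra K A B} {t : B}

open Slot

/-- `[X₁(x), [X₂(y), [X₃(z), φ]]]`. -/
def iterComm {E : Type*} [Ring E] [Algebra K E] (X₁ X₂ X₃ : A →ₐ[K] E) (x y z : A) (φ : E) : E :=
  X₁ x * (X₂ y * (X₃ z * φ - φ * X₃ z) - (X₃ z * φ - φ * X₃ z) * X₂ y) -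
    (X₂ y * (X₃ z * φ - φ * X₃ z) - (X₃ z * φ - φ * X₃ z) * X₂ y) * X₁ x

theorem iterComm_sub {E : Type*} [Ring E] [Algebra K E] (X₁ X₂ X₃ : A →ₐ[K] E) (x y z : A)
    (φ ψ : E) : iterComm X₁ X₂ X₃ x y z (φ - ψ) =
      iterComm X₁ X₂ X₃ x y z φ - iterComm X₁ X₂ X₃ x y z ψ := by
  simp only [iterComm, mul_sub, sub_mul]
  abel

theorem dress_add {E : Type*} [Ring E] [Algebra K E] (X₁ X₂ X₃ : A →ₐ[K] E)
    (J J' : A → A → A → E) (x y z : A) :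
    dress X₁ X₂ X₃ J x y z + dress X₁ X₂ X₃ J' x y z =
      dress X₁ X₂ X₃ (fun x y z => J x y z + J' x y z) x y z := by
  simp only [dress, add_mul, sw_add]

/-- The three double brackets are rotated to the common point b ⊗ c ⊗ d, summed by `jac_cyclic`, and
multiplied by generators as in `dress_commutator`. -/
theorem jacobi_gen (ht : IsTraceLike K t) {ρ : A →ₗ[K] A →ₗ[K] A}
    (hρ : IsQuasiPoissonFox ρ) (h : IsBracket br)
    (hg : ∀ x b y c, br (gen K A B x b) (gen K A B y c) = genBracket ht ρ x b y c)
    (x y z : A) (b c d : B) :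
    br (gen K A B x b) (br (gen K A B y c) (gen K A B z d)) +
      br (gen K A B z d) (br (gen K A B x b) (gen K A B y c)) +
      br (gen K A B y c) (br (gen K A B z d) (gen K A B x b)) =
    -(iterComm (Y₁ K A B) (Y₂ K A B) (Y₃ K A B) x y z
      (form12 _ ht.form * form23 _ ht.form - form23 _ ht.form * form12 _ ht.form)
        (b ⊗ₜ (c ⊗ₜ d))) := by
  have hs := isSlotSystem (AlgHom.id K (RepAlgebra K A B)) ht
  rw [bracket_bracket_gen ht hρ h hg, bracket_bracket_gen ht hρ h hg,
    bracket_bracket_gen ht hρ h hg, dress_jac_rotate ht ρ x y z b c d,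
    dress_jac_rotate_rotate ht ρ x y z b c d,
    add_right_comm, ← Slot.add_apply, ← Slot.add_apply, dress_add, dress_add]
  have e := dress_commutator hs.c12 hs.c13 hs.c23
    (form12 _ ht.form * form23 _ ht.form - form23 _ ht.form * form12 _ ht.form) x y z
  have e' : (fun x y z : A => _) = _ :=
    funext fun x => funext₂ fun y z => hs.jac_cyclic hρ x y z rfl
  rw [← e'] at e
  rw [e]
  rfl

/-- By `coactDer_gen`, a commutator with a generator x in a slot replaces the factor b • τ by
`coactDer ht τ` of x_b; this is done in slots 3, 2, 1 successively. The functions p, q, r record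
which leg of t goes to which slot. -/
theorem iterComm_form_apply (ht : IsTraceLike K t) {p q r : B → B → B → B}
    {φ : Slot K B (RepAlgebra K A B)}
    (hφ : ∀ b c d, φ (b ⊗ₜ (c ⊗ₜ d)) = sw3 K t fun t₁ t₂ t₃ => ht.form d (r t₁ t₂ t₃) •
      ht.form c (q t₁ t₂ t₃) • ht.form b (p t₁ t₂ t₃) • 1) (x y z : A) (b c d : B) :
    iterComm (Y₁ K A B) (Y₂ K A B) (Y₃ K A B) x y z φ (b ⊗ₜ (c ⊗ₜ d)) =
      sw3 K t fun t₁ t₂ t₃ => coactDer ht (p t₁ t₂ t₃) (gen K A B x b) *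
        coactDer ht (q t₁ t₂ t₃) (gen K A B y c) * coactDer ht (r t₁ t₂ t₃) (gen K A B z d) := by
  have key : ∀ (x : A) (s : B → B → B → B) (G : B → B → B → RepAlgebra K A B) (b : B),
      (sw K b fun b' b'' => gen K A B x b' * (sw3 K t fun t₁ t₂ t₃ =>
        ht.form b'' (s t₁ t₂ t₃) • G t₁ t₂ t₃)) - (sw K b fun b' b'' => (sw3 K t fun t₁ t₂ t₃ =>
        ht.form b' (s t₁ t₂ t₃) • G t₁ t₂ t₃) * gen K A B x b'') =
      sw3 K t fun t₁ t₂ t₃ => coactDer ht (s t₁ t₂ t₃) (gen K A B x b) * G t₁ t₂ t₃ := by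
    intro x s G b
    simp only [sw3, sw_mul_left, sw_mul_right, ← sw_sub, coactDer_gen]
    rw [sw_sw]
    refine congrArg (sw K t) (funext₂ fun t₁ e => ?_)
    rw [sw_sw]
    refine congrArg (sw K e) (funext₂ fun t₂ t₃ => congrArg (sw K b) (funext₂ fun b' b'' => ?_))
    rw [sub_mul, mul_smul_comm, smul_mul_assoc, smul_mul_assoc, smul_mul_assoc, mul_comm (G _ _ _)]
  have a₁ : ∀ (F : Slot K B (RepAlgebra K A B)) (b c d : B),
      (Y₁ K A B x * F - F * Y₁ K A B x) (b ⊗ₜ (c ⊗ₜ d)) =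
      (sw K b fun b' b'' => gen K A B x b' * F (b'' ⊗ₜ (c ⊗ₜ d))) -
        sw K b fun b' b'' => F (b' ⊗ₜ (c ⊗ₜ d)) * gen K A B x b'' := fun F b c d =>
    congrArg₂ (· - ·) (slot1_mul_apply (genHom (AlgHom.id K _) x) F b c d)
      (mul_slot1_apply (genHom (AlgHom.id K _) x) F b c d)
  have a₂ : ∀ (F : Slot K B (RepAlgebra K A B)) (b c d : B),
      (Y₂ K A B y * F - F * Y₂ K A B y) (b ⊗ₜ (c ⊗ₜ d)) =
      (sw K c fun c' c'' => gen K A B y c' * F (b ⊗ₜ (c'' ⊗ₜ d))) -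
        sw K c fun c' c'' => F (b ⊗ₜ (c' ⊗ₜ d)) * gen K A B y c'' := fun F b c d =>
    congrArg₂ (· - ·) (slot2_mul_apply (genHom (AlgHom.id K _) y) F b c d)
      (mul_slot2_apply (genHom (AlgHom.id K _) y) F b c d)
  have a₃ : ∀ (F : Slot K B (RepAlgebra K A B)) (b c d : B),
      (Y₃ K A B z * F - F * Y₃ K A B z) (b ⊗ₜ (c ⊗ₜ d)) =
      (sw K d fun d' d'' => gen K A B z d' * F (b ⊗ₜ (c ⊗ₜ d''))) -
        sw K d fun d' d'' => F (b ⊗ₜ (c ⊗ₜ d')) * gen K A B z d'' := fun F b c d =>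
    congrArg₂ (· - ·) (slot3_mul_apply (genHom (AlgHom.id K _) z) F b c d)
      (mul_slot3_apply (genHom (AlgHom.id K _) z) F b c d)
  have s₃ : ∀ b c d, (Y₃ K A B z * φ - φ * Y₃ K A B z) (b ⊗ₜ (c ⊗ₜ d)) =
      sw3 K t fun t₁ t₂ t₃ => ht.form c (q t₁ t₂ t₃) • ht.form b (p t₁ t₂ t₃) •
        coactDer ht (r t₁ t₂ t₃) (gen K A B z d) := fun b c d => by
    simp only [a₃, hφ, key, mul_smul_comm, mul_one]
  have s₂ : ∀ b c d, (Y₂ K A B y * (Y₃ K A B z * φ - φ * Y₃ K A B z) -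
      (Y₃ K A B z * φ - φ * Y₃ K A B z) * Y₂ K A B y) (b ⊗ₜ (c ⊗ₜ d)) =
      sw3 K t fun t₁ t₂ t₃ => ht.form b (p t₁ t₂ t₃) • (coactDer ht (q t₁ t₂ t₃) (gen K A B y c) *
        coactDer ht (r t₁ t₂ t₃) (gen K A B z d)) := fun b c d => by
    simp only [a₂, s₃, key, mul_smul_comm]
  rw [iterComm, a₁]
  simp only [s₂, key, mul_assoc]

end Generators

end RepAlg

namespace RepAlg

set_option linter.unusedSectionVars false

/-! ### The quasi-Jacobi identity -/

theorem Slot.sub_apply {K B S : Type*} [CommRing K] [CommRing B] [HopfAlgebra K B] [CommRing S]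
    [Algebra K S] (F G : Slot K B S) (z : B ⊗[K] (B ⊗[K] B)) : (F - G) z = F z - G z := rfl

section QuasiJacobi

variable {K A B : Type*} [CommRing K] [Ring A] [HopfAlgebra K A] [CommRing B] [HopfAlgebra K B]
  {br : RepAlgebra K A B →ₗ[K] RepAlgebra K A B →ₗ[K] RepAlgebra K A B} {t : B}

open Slot

/-- The action of the trivector defined by the trace-like element. -/
noncomputable def coactTriDer (ht : IsTraceLike K t) (u v w : RepAlgebra K A B) : RepAlgebra K A B :=
  (sw3 K t fun t₁ t₂ t₃ => coactDer ht t₁ u * coactDer ht t₂ v * coactDer ht t₃ w) -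
    sw3 K t fun t₁ t₂ t₃ => coactDer ht t₁ u * coactDer ht t₃ v * coactDer ht t₂ w

theorem coactTriDer_rotate (ht : IsTraceLike K t) (u v w : RepAlgebra K A B) :
    coactTriDer ht v w u = coactTriDer ht u v w := by
  unfold coactTriDer
  congr 1
  · rw [← ht.sw3_rotate (F := fun t₁ t₂ t₃ => coactDer ht t₁ v * coactDer ht t₂ w *
      coactDer ht t₃ u) (by fun_prop) (by fun_prop) (by fun_prop)]
    refine congrArg (sw3 K t) (funext₃ fun t₁ t₂ t₃ => ?_)
    ring
  · rw [← ht.sw3_rotate (F := fun t₁ t₂ t₃ => coactDer ht t₁ v * coactDer ht t₃ w *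
      coactDer ht t₂ u) (by fun_prop) (by fun_prop) (by fun_prop),
      ← ht.sw3_rotate (F := fun t₁ t₂ t₃ => coactDer ht t₂ v * coactDer ht t₁ w *
      coactDer ht t₃ u) (by fun_prop) (by fun_prop) (by fun_prop)]
    refine congrArg (sw3 K t) (funext₃ fun t₁ t₂ t₃ => ?_)
    ring

theorem coactTriDer_mul (ht : IsTraceLike K t) (u v w w' : RepAlgebra K A B) :
    coactTriDer ht u v (w * w') = coactTriDer ht u v w * w' + w * coactTriDer ht u v w' := by
  have e : ∀ a b : RepAlgebra K A B, ∀ τ, a * b * coactDer ht τ (w * w') =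
      a * b * coactDer ht τ w * w' + w * (a * b * coactDer ht τ w') := fun a b τ => by
    rw [coactDer_mul]; ring
  simp only [coactTriDer, sub_mul, mul_sub, sw3, sw_mul_left, sw_mul_right, e, sw_add]
  ring

/-- The Jacobi sum of a bracket. -/
noncomputable def jacobiator (br : RepAlgebra K A B →ₗ[K] RepAlgebra K A B →ₗ[K] RepAlgebra K A B)
    (u v w : RepAlgebra K A B) : RepAlgebra K A B :=
  br u (br v w) + br w (br u v) + br v (br w u)

theorem jacobiator_rotate (u v w : RepAlgebra K A B) :
    jacobiator br v w u = jacobiator br u v w := by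
  unfold jacobiator; abel

/-- By antisymmetry the cross terms {u, w}{v, w'} and {v, w}{u, w'} cancel between the double
brackets. -/
theorem jacobiator_mul (h : IsBracket br) (anti : ∀ u v, br u v = -br v u)
    (u v w w' : RepAlgebra K A B) :
    jacobiator br u v (w * w') = jacobiator br u v w * w' + w * jacobiator br u v w' := by
  simp only [jacobiator, h.leibniz_right, h.leibniz_left, map_add, anti v w, anti w' u]
  rw [anti v w', anti w u]
  ring

/-- Both sides are derivations in the third argument and cyclically symmetric, so the identity is
extended from generators one argument at a time, with rotations in between. -/
theorem jacobiator_eq_of_gen (ht : IsTraceLike K t) (h : IsBracket br)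
    (anti : ∀ u v, br u v = -br v u)
    (hg : ∀ x b y c z d, jacobiator br (gen K A B x b) (gen K A B y c) (gen K A B z d) =
      coactTriDer ht (gen K A B x b) (gen K A B y c) (gen K A B z d)) (u v w : RepAlgebra K A B) :
    jacobiator br u v w = coactTriDer ht u v w := by
  have ext : ∀ u v, (∀ z d, jacobiator br u v (gen K A B z d) =
      coactTriDer ht u v (gen K A B z d)) → ∀ w, jacobiator br u v w = coactTriDer ht u v w :=
    fun u v e w => der_ext (AlgHom.id K _) (f := fun w => jacobiator br u v w)
      (g := fun w => coactTriDer ht u v w) (by unfold jacobiator; fun_prop)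
      (by unfold coactTriDer sw3; fun_prop) (jacobiator_mul h anti u v) (coactTriDer_mul ht u v) e w
  have rot : ∀ u v w, jacobiator br u v w = coactTriDer ht u v w →
      jacobiator br v w u = coactTriDer ht v w u := fun u v w e => by
    rw [jacobiator_rotate, e, coactTriDer_rotate ht u v w]
  have h1 := fun x b y c => ext (gen K A B x b) (gen K A B y c) (hg x b y c)
  have h2 := fun x b w => ext w (gen K A B x b) fun y c => rot _ _ _ (rot _ _ _ (h1 x b y c w))
  exact ext u v (fun z d => rot _ _ _ (rot _ _ _ (h2 z d v u))) w

theorem coactTriDer_eq (ht : IsTraceLike K t) (u v w : RepAlgebra K A B) :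
    (sweedler (coactHom u) fun ul ur => sweedler (coactHom v) fun vl vr =>
      sweedler (coactHom w) fun wl wr => sw3 K t fun t₁ t₂ t₃ =>
        (ht.form ur t₁ * ht.form vr t₂ * ht.form wr t₃) • (ul * vl * wl)) -
    (sweedler (coactHom u) fun ul ur => sweedler (coactHom v) fun vl vr =>
      sweedler (coactHom w) fun wl wr => sw3 K t fun t₁ t₂ t₃ =>
        (ht.form ur t₁ * ht.form vr t₃ * ht.form wr t₂) • (ul * vl * wl)) =
      coactTriDer ht u v w := by
  have sweedler_sw3 : ∀ (z : RepAlgebra K A B ⊗[K] B) (F : RepAlgebra K A B → B → B → B → B →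
      RepAlgebra K A B), (sweedler z fun m a => sw3 K t fun t₁ t₂ t₃ => F m a t₁ t₂ t₃) =
      sw3 K t fun t₁ t₂ t₃ => sweedler z fun m a => F m a t₁ t₂ t₃ := fun z F => by
    simp only [sweedler, sw3, sw]
    rw [Finset.sum_comm]
    exact Finset.sum_congr rfl fun _ _ => Finset.sum_comm
  have key : ∀ p q r : B, (sweedler (coactHom u) fun ul ur => sweedler (coactHom v) fun vl vr =>
      sweedler (coactHom w) fun wl wr => (ht.form ur p * ht.form vr q * ht.form wr r) •
        (ul * vl * wl)) = coactDer ht p u * coactDer ht q v * coactDer ht r w := fun p q r => by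
    have inner : ∀ (τ : B) (k : K) (m n w : RepAlgebra K A B), (sweedler (coactHom w) fun l a =>
        (k * ht.form a τ) • (m * l * n)) = k • (m * coactDer ht τ w * n) := fun τ k m n w => by
      rw [coactDer_apply, ← sweedler_form]
      simp only [sweedler, Finset.mul_sum, Finset.sum_mul, Finset.smul_sum, mul_smul,
        mul_smul_comm, smul_mul_assoc]
    have i₃ := fun k m => inner r k m 1 w
    have i₁ := fun n => inner p 1 1 n u
    simp only [mul_one, one_mul, one_smul] at i₁ i₃
    simp only [i₃]
    have i₂' : ∀ ul ur, (sweedler (coactHom v) fun vl vr => (ht.form ur p * ht.form vr q) •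
        (ul * vl * coactDer ht r w)) = _ := fun ul ur => inner q _ ul (coactDer ht r w) v
    simp only [i₂']
    simp only [mul_assoc, i₁]
  simp only [sweedler_sw3, key]
  rfl

end QuasiJacobi

/-! ### The quasi-Jacobi identity and the bracket on invariants -/

section Main

variable {K A B : Type*} [CommRing K] [Ring A] [HopfAlgebra K A] [IsCocomm K A]
  [CommRing B] [HopfAlgebra K B]
  {br : RepAlgebra K A B →ₗ[K] RepAlgebra K A B →ₗ[K] RepAlgebra K A B} {t : B}

open Slot

/-- Rewritten with b in the first place of `form3`, the commutator of tensors is the trivector with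
the last two legs of t exchanged minus the trivector itself. The sign in `jacobi_gen` restores the
stated order. -/
theorem jacobiator_gen (ht : IsTraceLike K t) {ρ : A →ₗ[K] A →ₗ[K] A}
    (hρ : IsQuasiPoissonFox ρ) (h : IsBracket br)
    (hg : ∀ x b y c, br (gen K A B x b) (gen K A B y c) = genBracket ht ρ x b y c)
    (x : A) (b : B) (y : A) (c : B) (z : A) (d : B) :
    jacobiator br (gen K A B x b) (gen K A B y c) (gen K A B z d) =
      coactTriDer ht (gen K A B x b) (gen K A B y c) (gen K A B z d) := by
  let φ : (B → B → B → B) → (B → B → B → B) → (B → B → B → B) → Slot K B (RepAlgebra K A B) :=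
    fun p q r => tri (fun b c d => sw3 K t fun t₁ t₂ t₃ => ht.form d (r t₁ t₂ t₃) •
      ht.form c (q t₁ t₂ t₃) • ht.form b (p t₁ t₂ t₃) • 1) (by unfold sw3; fun_prop)
      (by unfold sw3; fun_prop) (by unfold sw3; fun_prop)
  have hφ : ∀ p q r b c d, φ p q r (b ⊗ₜ (c ⊗ₜ d)) = _ := fun p q r b c d =>
    tri_apply _ _ _ _ b c d
  have e : (form12 _ ht.form * form23 _ ht.form - form23 _ ht.form * form12 _ ht.form :
      Slot K B (RepAlgebra K A B)) = φ (fun t₁ _ _ => t₁) (fun _ _ t₃ => t₃) (fun _ t₂ _ => t₂) -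
        φ (fun t₁ _ _ => t₁) (fun _ t₂ _ => t₂) (fun _ _ t₃ => t₃) :=
    Slot.ext fun b c d => by
      rw [commutator_form_apply]
      rw [Slot.sub_apply, hφ, hφ, ht.form3_rotate c b d,
        ← ht.form3_rotate b c d, sub_smul]
      simp only [IsTraceLike.form3, sw3, sw, sweedler, Finset.sum_smul, smul_smul]
      congr 1 <;> refine Finset.sum_congr rfl fun i _ => Finset.sum_congr rfl fun j _ => ?_ <;>
        congr 1 <;> ring
  refine (jacobi_gen ht hρ h hg x y z b c d).trans ?_
  rw [e, iterComm_sub]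
  rw [Slot.sub_apply, iterComm_form_apply ht (hφ _ _ _), iterComm_form_apply ht (hφ _ _ _), neg_sub]
  rfl

theorem IsInducedBracket.isQuasiPoissonBracket (ht : IsTraceLike K t) {ρ : A →ₗ[K] A →ₗ[K] A}
    (hρ : IsQuasiPoissonFox ρ) (h : IsInducedBracket ρ ht.form br) :
    IsQuasiPoissonBracket (repCoaction K A B) ht br := by
  obtain ⟨hb, hg⟩ := (isInducedBracket_iff ht hρ.toIsFoxPairing br).1 h
  have anti : ∀ u v, br u v = -br v u := hb.antisymm_of_gen fun x b y c => by
    rw [hg, hg, genBracket_antisymm ht hρ]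
  exact ⟨hb, isEquivariant_of_coactHom (coactHom_bracket ht hb hg), anti, fun u v w =>
    (jacobiator_eq_of_gen ht hb anti (jacobiator_gen ht hρ hb hg) u v w).trans
      (coactTriDer_eq ht u v w).symm⟩

theorem IsInducedBracket.map_mem_invariants (ht : IsTraceLike K t) {ρ : A →ₗ[K] A →ₗ[K] A}
    (hρ : IsQuasiPoissonFox ρ) (h : IsInducedBracket ρ ht.form br) {u v : RepAlgebra K A B}
    (hu : u ∈ (repCoaction K A B).invariants) (hv : v ∈ (repCoaction K A B).invariants) :
    br u v ∈ (repCoaction K A B).invariants := by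
  obtain ⟨hb, hg⟩ := (isInducedBracket_iff ht hρ.toIsFoxPairing br).1 h
  change coactHom (br u v) = br u v ⊗ₜ[K] (1 : B)
  have hu' : coactHom u = u ⊗ₜ[K] (1 : B) := hu
  have hv' : coactHom v = v ⊗ₜ[K] (1 : B) := hv
  rw [coactHom_bracket ht hb hg, hu', hv', extBracket_tmul, one_mul]

theorem coactTriDer_eq_zero (ht : IsTraceLike K t) {u : RepAlgebra K A B}
    (hu : u ∈ (repCoaction K A B).invariants) (v w : RepAlgebra K A B) :
    coactTriDer ht u v w = 0 := by
  simp [coactTriDer, coactDer_eq_zero ht _ hu, sw3, sw, sweedler]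

theorem IsInducedBracket.exists_isPoissonBracket (ht : IsTraceLike K t) {ρ : A →ₗ[K] A →ₗ[K] A}
    (hρ : IsQuasiPoissonFox ρ) (h : IsInducedBracket ρ ht.form br) :
    ∃ brInv : (repCoaction K A B).invariants →ₗ[K] (repCoaction K A B).invariants →ₗ[K]
      (repCoaction K A B).invariants, (∀ u v, (brInv u v : RepAlgebra K A B) = br u v) ∧
        IsPoissonBracket brInv := by
  have hq := h.isQuasiPoissonBracket ht hρ
  let brInv : (repCoaction K A B).invariants →ₗ[K] (repCoaction K A B).invariants →ₗ[K]
      (repCoaction K A B).invariants := LinearMap.mk₂ K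
    (fun u v => ⟨br u v, h.map_mem_invariants ht hρ u.2 v.2⟩)
    (fun u u' v => Subtype.ext (by simp)) (fun k u v => Subtype.ext (by simp))
    (fun u v v' => Subtype.ext (by simp)) (fun k u v => Subtype.ext (by simp))
  refine ⟨brInv, fun u v => rfl, ⟨⟨fun u v w => Subtype.ext (hq.leibniz_right _ _ _),
    fun u v w => Subtype.ext (hq.leibniz_left _ _ _)⟩, fun u v => Subtype.ext (hq.antisymm _ _),
    fun u v w => Subtype.ext ?_⟩⟩
  change br u (br v w) + br v (br w u) + br w (br u v) = 0
  rw [add_right_comm]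
  -- The trivector term contains a derivation applied to the invariant element u, hence vanishes.
  exact ((hq.quasi_jacobi _ _ _).trans (coactTriDer_eq ht _ _ _)).trans
    (coactTriDer_eq_zero ht u.2 _ _)

end Main

end RepAlg

theorem mainTheorem3 {K A B : Type*} [CommRing K] [Ring A] [HopfAlgebra K A]
    [Coalgebra.IsCocomm K A] [CommRing B] [HopfAlgebra K B]
    (ρ : A →ₗ[K] A →ₗ[K] A) (hρ : RepAlg.IsQuasiPoissonFox ρ)
    (t : B) (ht : RepAlg.IsTraceLike K t) :
    (∃! br : RepAlg.RepAlgebra K A B →ₗ[K] RepAlg.RepAlgebra K A B →ₗ[K] RepAlg.RepAlgebra K A B,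
      RepAlg.IsInducedBracket ρ ht.form br) ∧
    ∀ br : RepAlg.RepAlgebra K A B →ₗ[K] RepAlg.RepAlgebra K A B →ₗ[K] RepAlg.RepAlgebra K A B,
      RepAlg.IsInducedBracket ρ ht.form br →
        RepAlg.IsQuasiPoissonBracket (RepAlg.repCoaction K A B) ht br ∧
        ∃ brInv : (RepAlg.repCoaction K A B).invariants →ₗ[K]
            (RepAlg.repCoaction K A B).invariants →ₗ[K] (RepAlg.repCoaction K A B).invariants,
          (∀ u v, (brInv u v : RepAlg.RepAlgebra K A B) = br u v) ∧
          RepAlg.IsPoissonBracket brInv :=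
  ⟨RepAlg.existsUnique_inducedBracket ht hρ, fun _ h =>
    ⟨h.isQuasiPoissonBracket ht hρ, h.exists_isPoissonBracket ht hρ⟩⟩
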